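/- For $r\in(0,1)$ let $\mathbb{D}=\{z\in\mathbb{C}:|z|<1\}$, $\mathbb{A}_r=\{z\in\mathbb{C}: r<|z|<1\}$ and $C_r=\{z\in\mathbb{C}:|z|=r\}$. Let $e>\delta\ge 1$ be integers. Finite sets $\{p_1,\dots,p_e\}$ are understood as divisors (points counted with multiplicity). The degree of a proper holomorphic map $f:\mathbb{A}_r\to\mathbb{D}$ is the number of preimages, counted with multiplicity, of each point of $\mathbb{D}$; $\deg(f|_{C_r})$ is the topological degree of the continuous extension of $f$ to $C_r$ as a map from $C_r$ to the unit circle, where $C_r$ is oriented as part of the boundary of $\mathbb{A}_r$ (clockwise); and $f(1)=1$ means that $f(z)\to 1$ as $z\to 1$ in $\mathbb{A}_r$. **(1)** Let $r\in(0,1)$ and let $p_1,\dots,p_e\in\mathbb{A}_r$ be not necessarily distinct. There is a proper holomorphic map $f:\mathbb{A}_r\to\mathbb{D}$ of degree $e$ with $f^{-1}(0)=\{p_1,\dots,p_e\}$ and $\deg(f|_{C_r})=\delta$ if and only if $$|p_1p_2\cdots p_e|=r^{\delta}.$$ **(2)** If this condition holds, there is exactly one such map with $f(1)=1$. This $f$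 is given by $$f(z)=z^{-\delta}B_0(z)\prod_{j\ge 1}\big(B_j(z)B_{-j}(z)\big),\qquad z\in\mathbb{A}_r,$$ where the product converges for every $z\in\mathbb{A}_r$ and $$B_j(z)=\left(\prod_{k=1}^e\frac{1-\overline{p_k}\,r^{2j}}{1-p_k r^{2j}}\right)\left(\prod_{k=1}^e\frac{z-p_k r^{2j}}{1-\overline{p_k}\,r^{2j}z}\right),\qquad j\in\mathbb{Z}.$$ The representation is unique: if $f$ is also given on $\mathbb{A}_r$ by the same formula with an integer $\delta'\ge 0$ and points $q_1,\dots,q_e\in\mathbb{A}_r$ in place of $\delta$ and $p_1,\dots,p_e$, then $\delta'=\delta$ and $(q_1,\dots,q_e)$ is a permutation of $(p_1,\dots,p_e)$. **(3)** Let $\boldsymbol{A}(e,\delta)$ be the set of all proper holomorphic maps $f:\mathbb{A}_r\to\mathbb{D}$ of degree $e$ with $\deg(f|_{C_r})=\delta$ and $f(1)=1$, where $r$ ranges over all numbers in $(0,1)$. Give it the topology in which a set $U$ is open if and only if every sequence converging to a point of $U$ is eventually in $U$; here $\phi_k:\mathbb{A}_{r_k}\to\mathbb{D}$ converges to $\phi:\mathbb{A}_r\to\mathbb{D}$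 if $r_k\to r$ and, for every compact $K\subset\mathbb{A}_r$, the maps $\phi_k$ (which are defined on $K$ for large $k$) converge to $\phi$ uniformly on $K$. Then $\boldsymbol{A}(e,\delta)$ is homeomorphic to $\mathbb{R}^{2e-1}\times S^1$. -/

import Mathlib

/-- The round annulus `𝔸_r = {z : r < |z| < 1}`. -/
def annulus (r : ℝ) : Set ℂ := {z | r < ‖z‖ ∧ ‖z‖ < 1}

/-- The open unit disk. -/
abbrev disk : Set ℂ := Metric.ball (0 : ℂ) 1

/-- A map `𝔸_r → 𝔻` as a function `ℂ → ℂ`, with the value `0` outside `𝔸_r`. It is only ever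
evaluated on, or near points of, the open set `𝔸_r`. -/
noncomputable def annulusExt {r : ℝ} (f : annulus r → disk) : ℂ → ℂ :=
  Function.extend (Subtype.val : annulus r → ℂ) (fun z => (f z : ℂ)) 0

/-- `f : 𝔸_r → 𝔻` is proper and holomorphic. -/
structure IsProperHolomorphic {r : ℝ} (f : annulus r → disk) : Prop where
  proper : IsProperMap f
  holomorphic : DifferentiableOn ℂ (annulusExt f) (annulus r)

/-- The mapping degree of `f` is `e` (a positive integer): every `w ∈ 𝔻` has exactly `e` preimages
in `𝔸_r`, counted with multiplicity, the multiplicity of `z` being the order of vanishing at `z` of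
`f - w`. -/
def HasMappingDegree {r : ℝ} (f : annulus r → disk) (e : ℕ) : Prop :=
  ∀ w ∈ disk, ∑ᶠ z : annulus r, analyticOrderNatAt (fun ζ => annulusExt f ζ - w) (z : ℂ) = e

/-- `f⁻¹(0) = {p_1, …, p_e}` as divisors: the order of vanishing of `f` at each `z ∈ 𝔸_r` is the
number of indices `k` with `p_k = z`. -/
def HasZeroDivisor {r : ℝ} {e : ℕ} (f : annulus r → disk) (p : Fin e → ℂ) : Prop :=
  ∀ z ∈ annulus r,
    analyticOrderAt (annulusExt f) z = ((Finset.univ.filter fun k => p k = z).card : ℕ∞)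

/-- `deg(f|_{C_r}) = δ`: the map `f` extends continuously to the inner boundary circle
`C_r = {|z| = r}`, and the extension maps `C_r` to the unit circle with topological degree `δ`.
Here `C_r` is oriented as part of the boundary of `𝔸_r`, that is clockwise, which is the orientation
for which a proper holomorphic map has positive degree on `C_r`. The degree is read off from a lift
`θ` of the boundary map to `ℝ`. -/
def HasInnerDegree {r : ℝ} (f : annulus r → disk) (δ : ℕ) : Prop :=
  ∃ F : ℂ → ℂ, ContinuousOn F {z | r ≤ ‖z‖ ∧ ‖z‖ < 1} ∧
    (∀ z : annulus r, F z = f z) ∧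
    ∃ θ : ℝ → ℝ, Continuous θ ∧
      (∀ t : ℝ, F (r * Complex.exp (-(t * Complex.I))) = Complex.exp (θ t * Complex.I)) ∧
      ∀ t : ℝ, θ (t + 2 * Real.pi) = θ t + 2 * Real.pi * δ

/-- `f(1) = 1`, in the sense of boundary values: `f(z) → 1` as `z → 1` in `𝔸_r`. -/
def FixesOne {r : ℝ} (f : annulus r → disk) : Prop :=
  Filter.Tendsto (annulusExt f) (nhdsWithin 1 (annulus r)) (nhds 1)

/-- The Blaschke-type factor
`B_j(z) = (∏_k (1 - p̄_k r^{2j}) / (1 - p_k r^{2j})) (∏_k (z - p_k r^{2j}) / (1 - p̄_k r^{2j} z))`. -/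
noncomputable def blaschkeFactor (r : ℝ) {e : ℕ} (p : Fin e → ℂ) (j : ℤ) (z : ℂ) : ℂ :=
  (∏ k, (1 - starRingEnd ℂ (p k) * (r : ℂ) ^ (2 * j)) / (1 - p k * (r : ℂ) ^ (2 * j))) *
    ∏ k, (z - p k * (r : ℂ) ^ (2 * j)) / (1 - starRingEnd ℂ (p k) * (r : ℂ) ^ (2 * j) * z)

/-- The `j`-th factor `B_j(z) B_{-j}(z)` of the infinite product, where `j = i + 1 ≥ 1`. -/
noncomputable def pairedFactor (r : ℝ) {e : ℕ} (p : Fin e → ℂ) (z : ℂ) (i : ℕ) : ℂ :=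
  blaschkeFactor r p ((i : ℤ) + 1) z * blaschkeFactor r p (-((i : ℤ) + 1)) z

/-- `z^{-δ} B_0(z) ∏_{j ≥ 1} (B_j(z) B_{-j}(z))`. -/
noncomputable def annulusBlaschke (r : ℝ) {e : ℕ} (δ : ℕ) (p : Fin e → ℂ) (z : ℂ) : ℂ :=
  z ^ (-(δ : ℤ)) * blaschkeFactor r p 0 z * ∏' i : ℕ, pairedFactor r p z i

/-- The model space `A(e, δ)` of all proper holomorphic maps `m : 𝔸_r → 𝔻` of degree `e`, with
`deg(m|_{C_r}) = δ` and `m(1) = 1`, where `r` ranges over `(0, 1)`. -/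
structure ModelSpace (e δ : ℕ) where
  r : ℝ
  r_mem : r ∈ Set.Ioo (0 : ℝ) 1
  toMap : annulus r → disk
  isProperHolomorphic : IsProperHolomorphic toMap
  degree : HasMappingDegree toMap e
  innerDegree : HasInnerDegree toMap δ
  fixesOne : FixesOne toMap

namespace ModelSpace

/-- Convergence of a sequence in `A(e, δ)`: `r_k → r`, and `φ_k → φ` uniformly on every compact
`K ⊆ 𝔸_r` (such a `K` lies in `𝔸_{r_k}` for all large `k`). -/
def ConvergesTo {e δ : ℕ} (φ : ℕ → ModelSpace e δ) (ψ : ModelSpace e δ) : Prop :=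
  Filter.Tendsto (fun k => (φ k).r) Filter.atTop (nhds ψ.r) ∧
    ∀ K ⊆ annulus ψ.r, IsCompact K →
      TendstoUniformlyOn (fun k => annulusExt (φ k).toMap) (annulusExt ψ.toMap) Filter.atTop K

/-- The topology of `A(e, δ)` given by this notion of convergence: a set is open if and only if
every sequence that converges to one of its points is eventually in it. -/
instance (e δ : ℕ) : TopologicalSpace (ModelSpace e δ) where
  IsOpen U := ∀ ψ ∈ U, ∀ φ : ℕ → ModelSpace e δ, ConvergesTo φ ψ →
    ∀ᶠ k in Filter.atTop, φ k ∈ U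
  isOpen_univ := fun _ _ _ _ => Filter.Eventually.of_forall fun _ => Set.mem_univ _
  isOpen_inter := fun _ _ hU hV ψ hψ φ h =>
    (hU ψ hψ.1 φ h).and (hV ψ hψ.2 φ h)
  isOpen_sUnion := fun _ hS ψ ⟨U, hU, hψ⟩ φ h =>
    (hS U hU ψ hψ φ h).mono fun _ hk => ⟨U, hU, hk⟩

end ModelSpace

/-!
# Proper holomorphic maps from an annulus to the disk

**Fixed annulus.** For a point `p` of `𝔸_r` the quotient of theta functions `annTheta r p` is
holomorphic near the closed annulus, has a simple zero at `p` and no other zero, and has modulus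
`|p|` on the circle `C_r` and `1` on the unit circle. Let `f` be a holomorphic function whose
modulus tends to `1` at both boundary circles, with zeros `p_1, …, p_n`, and divide it by the
product of the `annTheta r p_k`. The quotient `u` is zero-free, and `|u(z)| |z|^s → 1` at the
boundary for the real number `s` with `|p_1 ⋯ p_n| = r^s`. Pulled back by `exp` to a strip,
`u(e^ζ) e^{sζ}` is holomorphic and its modulus is a function on the annulus, so the maximum
principle for it and for its inverse shows that it is a unimodular constant. Periodicity under
`ζ ↦ ζ + 2πi` makes `s` an integer `d`, and `f = c z^{-d} ∏ annTheta r p_k`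
(`exists_eq_monomial_mul_annThetaProd`).

Each `annTheta r p` has winding number `0` on `C_r` and `1` on the unit circle, so `d` is the degree
on `C_r`, and `f` winds `n - d` times around on the unit circle. A Möbius transformation of the disk
preserves the winding numbers of unimodular loops, so that `f` takes every value of the disk as
often as the value `0` (`exists_preimage_list`). This gives the criterion `|p_1 ⋯ p_e| = r^δ`, and
the condition `f(1) = 1` fixes the constant `c`. Grouping the factors of the theta quotients yields
the product formula (`annulusBlaschke_eq`), and the zeros and the exponent can be read off from it
(`product_representation`).

**The space of all maps.** By the first part, sending a radius and zeros `(r, p)` with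
`|p_1 ⋯ p_e| = r^δ` to the normalized map is surjective onto the model space, with the orbits of the
permutations of the zeros as fibres. It is a quotient map (`isQuotientMap_toModelSpace`): it is
continuous, and over a convergent sequence of maps the zeros subconverge to zeros of the limit,
because a zero escaping to the boundary would leave the limit with fewer than `e` zeros.

Replace `|p_k|` by the logit `x_k` of `log |p_k| / log r ∈ (0, 1)`. The condition on the product
becomes `∑ sigmoid x_k = δ`, and on every line `x + ℝ (1, …, 1)` there is exactly one point with
this property, as `0 < δ < e`; it may be replaced by the point with `∑ x_k = 0`. Thus the space of
zeros is equivariantly homeomorphic to the product of `ℝ` and the families `q ∈ ℂ^e` with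
`|q_1 ⋯ q_e| = 1` (`zeroSpaceHomeomorph`). The passage from roots to coefficients of a monic
polynomial is proper, hence it identifies the quotient of such families by permutations with the
polynomials of unimodular constant coefficient, that is with `S¹ × ℂ^{e-1}`
(`isProperMap_circleCoeffs`, `circleCoeffs_eq_iff`). Together with the radius this is
`ℝ^{2e-1} × S¹`.
-/

/-! ### The infinite product `∏ (1 - x q ^ j)` -/

/-- The `q`-Pochhammer symbol `(x; q)_∞ = ∏_{j ≥ 0} (1 - x q ^ j)`; meaningful for `‖q‖ < 1`. -/
noncomputable def qProd (q x : ℂ) : ℂ := ∏' j : ℕ, (1 - x * q ^ j)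

lemma summable_norm_mul_pow {q : ℂ} (hq : ‖q‖ < 1) (x : ℂ) :
    Summable fun j : ℕ => ‖-(x * q ^ j)‖ := by
  simpa using (summable_geometric_of_lt_one (norm_nonneg q) hq).mul_left ‖x‖

lemma hasProd_qProd {q : ℂ} (hq : ‖q‖ < 1) (x : ℂ) :
    HasProd (fun j : ℕ => 1 - x * q ^ j) (qProd q x) := by
  have h : Multipliable fun j : ℕ => 1 - x * q ^ j := by
    simp only [sub_eq_add_neg]
    exact multipliable_one_add_of_summable (summable_norm_mul_pow hq x)
  exact h.hasProd

lemma qProd_eq {q : ℂ} (hq : ‖q‖ < 1) (x : ℂ) : qProd q x = (1 - x) * qProd q (q * x) := by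
  have h1 := (hasProd_qProd hq (q * x))
  have e : (fun j : ℕ => 1 - q * x * q ^ j) = fun j : ℕ => 1 - x * q ^ (j + 1) := by
    funext j
    ring
  rw [e] at h1
  have h2 := tprod_eq_zero_mul' (f := fun j : ℕ => 1 - x * q ^ j) h1.multipliable
  rw [h1.tprod_eq] at h2
  rw [show qProd q x = ∏' j : ℕ, (1 - x * q ^ j) from rfl]
  simpa using h2

lemma qProd_ne_zero_of_forall {q : ℂ} (hq : ‖q‖ < 1) {x : ℂ} (h : ∀ j : ℕ, x * q ^ j ≠ 1) :
    qProd q x ≠ 0 := by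
  have := tprod_one_add_ne_zero_of_summable (f := fun j : ℕ => -(x * q ^ j))
    (fun j => by rw [← sub_eq_add_neg]; exact sub_ne_zero.2 (h j).symm)
    (summable_norm_mul_pow hq x)
  simpa [sub_eq_add_neg, qProd] using this

lemma qProd_ne_zero {q : ℂ} (hq : ‖q‖ < 1) {x : ℂ} (hx : ‖x‖ < 1) : qProd q x ≠ 0 := by
  refine qProd_ne_zero_of_forall hq fun j h => ?_
  have h1 : ‖x * q ^ j‖ = 1 := by rw [h, norm_one]
  have h2 : ‖x * q ^ j‖ ≤ ‖x‖ := by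
    rw [norm_mul, norm_pow]
    exact mul_le_of_le_one_right (norm_nonneg _) (pow_le_one₀ (norm_nonneg _) hq.le)
  linarith

lemma star_qProd {q : ℂ} (hq : ‖q‖ < 1) (x : ℂ) :
    starRingEnd ℂ (qProd q x) = qProd (starRingEnd ℂ q) (starRingEnd ℂ x) := by
  rw [qProd, (hasProd_qProd hq x).multipliable.map_tprod (starRingEnd ℂ) Complex.continuous_conj]
  simp [qProd]

lemma continuousAt_qProd {q x : ℂ} (hq : ‖q‖ < 1) :
    ContinuousAt (fun a : ℂ × ℂ => qProd a.1 a.2) (q, x) := by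
  obtain ⟨ρ, hρ, hρ1⟩ := exists_between hq
  have hρ0 : 0 ≤ ρ := (norm_nonneg q).trans hρ.le
  set K : Set (ℂ × ℂ) := Metric.ball 0 ρ ×ˢ Metric.ball 0 (‖x‖ + 1) with hK
  have hKo : IsOpen K := Metric.isOpen_ball.prod Metric.isOpen_ball
  have hsum : Summable fun j : ℕ => (‖x‖ + 1) * ρ ^ j :=
    (summable_geometric_of_lt_one hρ0 hρ1).mul_left _
  have hmem : (q, x) ∈ K := by simp [hK, hρ]
  have h := Summable.hasProdLocallyUniformlyOn_nat_one_add
    (f := fun (j : ℕ) (a : ℂ × ℂ) => -(a.2 * a.1 ^ j)) hKo hsum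
    (Filter.Eventually.of_forall fun j a ha => by
      simp only [hK, Set.mem_prod, mem_ball_zero_iff] at ha
      rw [norm_neg, norm_mul, norm_pow]
      gcongr
      · exact ha.2.le
      · exact ha.1.le)
    (fun j => by fun_prop)
  have hc := h.continuousOn (Filter.Frequently.of_forall fun s => by fun_prop)
  have := hc.continuousAt (hKo.mem_nhds hmem)
  simpa [sub_eq_add_neg, qProd] using this

lemma differentiable_qProd {q : ℂ} (hq : ‖q‖ < 1) : Differentiable ℂ (qProd q) := by
  intro x
  have hsum : Summable fun j : ℕ => (‖x‖ + 1) * ‖q‖ ^ j :=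
    (summable_geometric_of_lt_one (norm_nonneg q) hq).mul_left _
  have hmem : x ∈ Metric.ball (0 : ℂ) (‖x‖ + 1) := by simp
  have h := Summable.hasProdLocallyUniformlyOn_nat_one_add
    (f := fun (j : ℕ) (a : ℂ) => -(a * q ^ j))
    (Metric.isOpen_ball : IsOpen (Metric.ball (0 : ℂ) (‖x‖ + 1))) hsum
    (Filter.Eventually.of_forall fun j a ha => by
      have hb : ‖a‖ < ‖x‖ + 1 := by simpa using ha
      rw [norm_neg, norm_mul, norm_pow]
      gcongr)
    (fun j => by fun_prop)
  have hc := TendstoLocallyUniformlyOn.differentiableOn h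
    (Filter.Eventually.of_forall fun s => by fun_prop)
    Metric.isOpen_ball
  have e : qProd q = fun x => ∏' j : ℕ, (1 + -(x * q ^ j)) := by
    funext x
    simp only [qProd, sub_eq_add_neg]
  rw [e]
  exact hc.differentiableAt (Metric.isOpen_ball.mem_nhds hmem)

/-! ### The elementary factors with a prescribed zero -/

/-- The function of `z`, multiplicatively periodic up to a constant under `z ↦ r ^ 2 z`, with a
simple zero at `p` and no other zero or pole near the closed annulus `r ≤ ‖z‖ ≤ 1`. It has
constant modulus on each of the two boundary circles. -/
noncomputable def annTheta (r : ℝ) (p z : ℂ) : ℂ :=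
  p * qProd ((r : ℂ) ^ 2) (z / p) * qProd ((r : ℂ) ^ 2) ((r : ℂ) ^ 2 * p / z) /
    (qProd ((r : ℂ) ^ 2) (starRingEnd ℂ p * z) *
      qProd ((r : ℂ) ^ 2) ((r : ℂ) ^ 2 / (starRingEnd ℂ p * z)))

/-- The open region of parameters on which `annTheta` is holomorphic in `z`, jointly continuous,
and vanishes only for `z = p`. The conditions are symmetric in `p` and `z`; they allow the
two points to lie on the boundary of the annulus, but not both on the same circle. -/
structure ThetaDom (r : ℝ) (p z : ℂ) : Prop where
  r_pos : 0 < r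
  r_lt : r < 1
  h1 : r ^ 2 * ‖z‖ < ‖p‖
  h2 : r ^ 2 * ‖p‖ < ‖z‖
  h3 : r ^ 2 < ‖p‖ * ‖z‖
  h4 : ‖p‖ * ‖z‖ < 1

lemma ThetaDom.symm {r : ℝ} {p z : ℂ} (h : ThetaDom r p z) : ThetaDom r z p :=
  ⟨h.r_pos, h.r_lt, h.h2, h.h1, by linarith [h.h3, mul_comm ‖p‖ ‖z‖],
    by linarith [h.h4, mul_comm ‖p‖ ‖z‖]⟩

lemma thetaDom_of_mem_annulus {r : ℝ} (hr : 0 < r) (hr1 : r < 1) {p z : ℂ} (hp : p ∈ annulus r)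
    (hz : r ≤ ‖z‖) (hz1 : ‖z‖ ≤ 1) : ThetaDom r p z := by
  obtain ⟨hp0, hp1⟩ := hp
  refine ⟨hr, hr1, ?_, ?_, ?_, ?_⟩ <;> nlinarith

lemma thetaDom_of_mem_annulus' {r : ℝ} (hr : 0 < r) (hr1 : r < 1) {p z : ℂ} (hp : r ≤ ‖p‖)
    (hp1 : ‖p‖ ≤ 1) (hz : z ∈ annulus r) : ThetaDom r p z :=
  (thetaDom_of_mem_annulus hr hr1 hz hp hp1).symm

section

variable {r : ℝ} {p z : ℂ}

lemma norm_ofReal_sq_lt_one (hr : 0 < r) (hr1 : r < 1) : ‖(r : ℂ) ^ 2‖ < 1 := by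
  rw [norm_pow, Complex.norm_real, Real.norm_of_nonneg hr.le]
  nlinarith

lemma ThetaDom.norm_q_lt (h : ThetaDom r p z) : ‖(r : ℂ) ^ 2‖ < 1 :=
  norm_ofReal_sq_lt_one h.r_pos h.r_lt

lemma ThetaDom.p_ne_zero (h : ThetaDom r p z) : p ≠ 0 := by
  rintro rfl
  have := h.h3
  have := h.r_pos
  simp only [norm_zero, zero_mul] at *
  nlinarith

lemma ThetaDom.z_ne_zero (h : ThetaDom r p z) : z ≠ 0 := h.symm.p_ne_zero

lemma norm_ofReal_sq : ‖(r : ℂ) ^ 2‖ = r ^ 2 := by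
  rw [norm_pow, Complex.norm_real, Real.norm_eq_abs, sq_abs]

lemma ThetaDom.norm_mul_div_lt (h : ThetaDom r p z) : ‖(r : ℂ) ^ 2 * p / z‖ < 1 := by
  have hz : 0 < ‖z‖ := norm_pos_iff.2 h.z_ne_zero
  rw [norm_div, norm_mul, norm_ofReal_sq, div_lt_one hz]
  exact h.h2

lemma ThetaDom.norm_conj_mul_lt (h : ThetaDom r p z) : ‖starRingEnd ℂ p * z‖ < 1 := by
  rw [norm_mul, RCLike.norm_conj]
  exact h.h4

lemma ThetaDom.norm_div_conj_mul_lt (h : ThetaDom r p z) :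
    ‖(r : ℂ) ^ 2 / (starRingEnd ℂ p * z)‖ < 1 := by
  have hz : 0 < ‖p‖ * ‖z‖ := mul_pos (norm_pos_iff.2 h.p_ne_zero) (norm_pos_iff.2 h.z_ne_zero)
  rw [norm_div, norm_mul, norm_ofReal_sq, RCLike.norm_conj, div_lt_one hz]
  exact h.h3

lemma ThetaDom.norm_mul_div_lt' (h : ThetaDom r p z) : ‖(r : ℂ) ^ 2 * (z / p)‖ < 1 := by
  rw [← mul_div_assoc]
  exact h.symm.norm_mul_div_lt

lemma ThetaDom.denom_ne_zero (h : ThetaDom r p z) :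
    qProd ((r : ℂ) ^ 2) (starRingEnd ℂ p * z) *
      qProd ((r : ℂ) ^ 2) ((r : ℂ) ^ 2 / (starRingEnd ℂ p * z)) ≠ 0 :=
  mul_ne_zero (qProd_ne_zero h.norm_q_lt h.norm_conj_mul_lt)
    (qProd_ne_zero h.norm_q_lt h.norm_div_conj_mul_lt)

/-- The part of `annTheta` without zeros. -/
noncomputable def annThetaUnit (r : ℝ) (p z : ℂ) : ℂ :=
  qProd ((r : ℂ) ^ 2) ((r : ℂ) ^ 2 * (z / p)) * qProd ((r : ℂ) ^ 2) ((r : ℂ) ^ 2 * p / z) /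
    (qProd ((r : ℂ) ^ 2) (starRingEnd ℂ p * z) *
      qProd ((r : ℂ) ^ 2) ((r : ℂ) ^ 2 / (starRingEnd ℂ p * z)))

lemma ThetaDom.annThetaUnit_ne_zero (h : ThetaDom r p z) : annThetaUnit r p z ≠ 0 :=
  div_ne_zero (mul_ne_zero (qProd_ne_zero h.norm_q_lt h.norm_mul_div_lt')
    (qProd_ne_zero h.norm_q_lt h.norm_mul_div_lt)) h.denom_ne_zero

lemma ThetaDom.annTheta_eq (h : ThetaDom r p z) :
    annTheta r p z = (p - z) * annThetaUnit r p z := by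
  have hp := h.p_ne_zero
  rw [annTheta, annThetaUnit, qProd_eq h.norm_q_lt (z / p)]
  have : p * (1 - z / p) = p - z := by field_simp
  rw [← this]
  ring

lemma ThetaDom.annTheta_ne_zero (h : ThetaDom r p z) (hne : z ≠ p) : annTheta r p z ≠ 0 := by
  rw [h.annTheta_eq]
  exact mul_ne_zero (sub_ne_zero.2 hne.symm) h.annThetaUnit_ne_zero

lemma ThetaDom.eventually (h : ThetaDom r p z) :
    ∀ᶠ a : ℝ × ℂ × ℂ in nhds (r, p, z), ThetaDom a.1 a.2.1 a.2.2 := by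
  have e1 : ∀ᶠ a : ℝ × ℂ × ℂ in nhds (r, p, z), 0 < a.1 :=
    continuous_fst.continuousAt.eventually (lt_mem_nhds h.r_pos)
  have e2 : ∀ᶠ a : ℝ × ℂ × ℂ in nhds (r, p, z), a.1 < 1 :=
    continuous_fst.continuousAt.eventually (gt_mem_nhds h.r_lt)
  have e3 : ∀ᶠ a : ℝ × ℂ × ℂ in nhds (r, p, z), a.1 ^ 2 * ‖a.2.2‖ < ‖a.2.1‖ :=
    ContinuousAt.eventually_lt (by fun_prop) (by fun_prop) h.h1
  have e4 : ∀ᶠ a : ℝ × ℂ × ℂ in nhds (r, p, z), a.1 ^ 2 * ‖a.2.1‖ < ‖a.2.2‖ :=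
    ContinuousAt.eventually_lt (by fun_prop) (by fun_prop) h.h2
  have e5 : ∀ᶠ a : ℝ × ℂ × ℂ in nhds (r, p, z), a.1 ^ 2 < ‖a.2.1‖ * ‖a.2.2‖ :=
    ContinuousAt.eventually_lt (by fun_prop) (by fun_prop) h.h3
  have e6 : ∀ᶠ a : ℝ × ℂ × ℂ in nhds (r, p, z), ‖a.2.1‖ * ‖a.2.2‖ < 1 :=
    ContinuousAt.eventually_lt (by fun_prop) (by fun_prop) h.h4
  filter_upwards [e1, e2, e3, e4, e5, e6] with a h1 h2 h3 h4 h5 h6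
  exact ⟨h1, h2, h3, h4, h5, h6⟩

lemma ThetaDom.eventually_right (h : ThetaDom r p z) : ∀ᶠ w in nhds z, ThetaDom r p w := by
  have hc : ContinuousAt (fun w : ℂ => ((r, p, w) : ℝ × ℂ × ℂ)) z := by fun_prop
  exact hc.eventually h.eventually

lemma ThetaDom.continuousAt_annTheta (h : ThetaDom r p z) :
    ContinuousAt (fun a : ℝ × ℂ × ℂ => annTheta a.1 a.2.1 a.2.2) (r, p, z) := by
  have hp := h.p_ne_zero
  have hz := h.z_ne_zero
  have hp' : starRingEnd ℂ p ≠ 0 := (map_ne_zero _).2 hp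
  have key : ∀ g : ℝ × ℂ × ℂ → ℂ, ContinuousAt g (r, p, z) →
      ContinuousAt (fun a : ℝ × ℂ × ℂ => qProd ((a.1 : ℂ) ^ 2) (g a)) (r, p, z) := by
    intro g hg
    have h1 : ContinuousAt (fun a : ℝ × ℂ × ℂ => ((a.1 : ℂ) ^ 2, g a)) (r, p, z) :=
      ContinuousAt.prodMk (by fun_prop) hg
    exact ContinuousAt.comp (f := fun a : ℝ × ℂ × ℂ => ((a.1 : ℂ) ^ 2, g a))
      (g := fun b : ℂ × ℂ => qProd b.1 b.2) (continuousAt_qProd h.norm_q_lt) h1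
  have c1 : ContinuousAt (fun a : ℝ × ℂ × ℂ => a.2.2 / a.2.1) (r, p, z) :=
    ContinuousAt.div (by fun_prop) (by fun_prop) hp
  have c2 : ContinuousAt (fun a : ℝ × ℂ × ℂ => (a.1 : ℂ) ^ 2 * a.2.1 / a.2.2) (r, p, z) :=
    ContinuousAt.div (by fun_prop) (by fun_prop) hz
  have c3 : ContinuousAt (fun a : ℝ × ℂ × ℂ => starRingEnd ℂ a.2.1 * a.2.2) (r, p, z) := by
    have : Continuous (fun a : ℝ × ℂ × ℂ => starRingEnd ℂ a.2.1) :=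
      Complex.continuous_conj.comp (by fun_prop)
    exact this.continuousAt.mul (by fun_prop)
  have c4 : ContinuousAt (fun a : ℝ × ℂ × ℂ => (a.1 : ℂ) ^ 2 / (starRingEnd ℂ a.2.1 * a.2.2))
      (r, p, z) := ContinuousAt.div (by fun_prop) c3 (mul_ne_zero hp' hz)
  have c0 : ContinuousAt (fun a : ℝ × ℂ × ℂ => a.2.1) (r, p, z) := by fun_prop
  exact ((c0.mul (key _ c1)).mul (key _ c2)).div ((key _ c3).mul (key _ c4)) h.denom_ne_zero

lemma ThetaDom.differentiableAt_annThetaUnit (h : ThetaDom r p z) :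
    DifferentiableAt ℂ (annThetaUnit r p) z := by
  have hp := h.p_ne_zero
  have hz := h.z_ne_zero
  have hp' : starRingEnd ℂ p ≠ 0 := (map_ne_zero _).2 hp
  have key : ∀ g : ℂ → ℂ, DifferentiableAt ℂ g z →
      DifferentiableAt ℂ (fun w => qProd ((r : ℂ) ^ 2) (g w)) z := by
    intro g hg
    exact (differentiable_qProd h.norm_q_lt).differentiableAt.comp z hg
  exact ((key _ (by fun_prop)).mul (key (fun w => (r : ℂ) ^ 2 * p / w)
    (by fun_prop (disch := assumption)))).div
    ((key _ (by fun_prop)).mul (key (fun w => (r : ℂ) ^ 2 / (starRingEnd ℂ p * w))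
    (by fun_prop (disch := exact mul_ne_zero hp' hz)))) h.denom_ne_zero

lemma ThetaDom.analyticAt_annThetaUnit (h : ThetaDom r p z) :
    AnalyticAt ℂ (annThetaUnit r p) z := by
  rw [Complex.analyticAt_iff_eventually_differentiableAt]
  filter_upwards [h.eventually_right] with w hw using hw.differentiableAt_annThetaUnit

lemma ThetaDom.eventuallyEq_annTheta (h : ThetaDom r p z) :
    annTheta r p =ᶠ[nhds z] fun w => (p - w) * annThetaUnit r p w := by
  filter_upwards [h.eventually_right] with w hw using hw.annTheta_eq

lemma ThetaDom.analyticAt_annTheta (h : ThetaDom r p z) : AnalyticAt ℂ (annTheta r p) z := by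
  refine AnalyticAt.congr ?_ h.eventuallyEq_annTheta.symm
  exact AnalyticAt.mul (by fun_prop) h.analyticAt_annThetaUnit

lemma ThetaDom.analyticOrderAt_annTheta (h : ThetaDom r p z) :
    analyticOrderAt (annTheta r p) z = if p = z then 1 else 0 := by
  split_ifs with hpz
  · subst hpz
    refine (h.analyticAt_annTheta.analyticOrderAt_eq_natCast (n := 1)).2
      ⟨fun w => -annThetaUnit r p w, h.analyticAt_annThetaUnit.neg,
        neg_ne_zero.2 h.annThetaUnit_ne_zero, ?_⟩
    filter_upwards [h.eventuallyEq_annTheta] with w hw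
    rw [hw, smul_eq_mul]
    ring
  · exact h.analyticAt_annTheta.analyticOrderAt_eq_zero.2 (h.annTheta_ne_zero (Ne.symm hpz))

lemma star_qProd_ofReal (hr : 0 < r) (hr1 : r < 1) (x : ℂ) :
    starRingEnd ℂ (qProd ((r : ℂ) ^ 2) x) = qProd ((r : ℂ) ^ 2) (starRingEnd ℂ x) := by
  rw [star_qProd (norm_ofReal_sq_lt_one hr hr1)]
  simp

lemma norm_qProd_conj (hr : 0 < r) (hr1 : r < 1) (x : ℂ) :
    ‖qProd ((r : ℂ) ^ 2) (starRingEnd ℂ x)‖ = ‖qProd ((r : ℂ) ^ 2) x‖ := by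
  rw [← star_qProd_ofReal hr hr1, RCLike.norm_conj]

/-- On the inner circle the four products cancel in conjugate pairs, because there
`z̄ = r ^ 2 / z`. -/
lemma norm_annTheta_inner (h : ThetaDom r p z) (hz : ‖z‖ = r) : ‖annTheta r p z‖ = ‖p‖ := by
  have hz0 := h.z_ne_zero
  have hp0 := h.p_ne_zero
  have hp' : starRingEnd ℂ p ≠ 0 := (map_ne_zero _).2 hp0
  have hc : starRingEnd ℂ z = (r : ℂ) ^ 2 / z := by
    rw [eq_div_iff hz0, mul_comm, Complex.mul_conj', hz]
  have hr : (r : ℂ) ≠ 0 := by exact_mod_cast h.r_pos.ne'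
  have e1 : ‖qProd ((r : ℂ) ^ 2) (z / p)‖ =
      ‖qProd ((r : ℂ) ^ 2) ((r : ℂ) ^ 2 / (starRingEnd ℂ p * z))‖ := by
    rw [← norm_qProd_conj h.r_pos h.r_lt, map_div₀, hc, div_div, mul_comm z]
  have e2 : ‖qProd ((r : ℂ) ^ 2) ((r : ℂ) ^ 2 * p / z)‖ =
      ‖qProd ((r : ℂ) ^ 2) (starRingEnd ℂ p * z)‖ := by
    rw [← norm_qProd_conj h.r_pos h.r_lt, map_div₀, hc]
    congr 2
    simp only [map_mul, map_pow, Complex.conj_ofReal]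
    field_simp
  have hd := norm_ne_zero_iff.2 h.denom_ne_zero
  rw [annTheta, norm_div, norm_mul, norm_mul, e1, e2, div_eq_iff hd, norm_mul]
  ring

lemma norm_annTheta_outer (h : ThetaDom r p z) (hz : ‖z‖ = 1) : ‖annTheta r p z‖ = 1 := by
  have hz0 := h.z_ne_zero
  have hp0 := h.p_ne_zero
  have hp' : starRingEnd ℂ p ≠ 0 := (map_ne_zero _).2 hp0
  have hc : starRingEnd ℂ z = 1 / z := by
    rw [eq_div_iff hz0, mul_comm, Complex.mul_conj', hz]
    simp
  have hr : (r : ℂ) ≠ 0 := by exact_mod_cast h.r_pos.ne'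
  have e1 : ‖qProd ((r : ℂ) ^ 2) ((r : ℂ) ^ 2 * (z / p))‖ =
      ‖qProd ((r : ℂ) ^ 2) ((r : ℂ) ^ 2 / (starRingEnd ℂ p * z))‖ := by
    rw [← norm_qProd_conj h.r_pos h.r_lt, map_mul, map_div₀, hc]
    congr 2
    simp only [map_pow, Complex.conj_ofReal]
    field_simp
  have e2 : ‖qProd ((r : ℂ) ^ 2) ((r : ℂ) ^ 2 * p / z)‖ =
      ‖qProd ((r : ℂ) ^ 2) ((r : ℂ) ^ 2 * (starRingEnd ℂ p * z))‖ := by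
    rw [← norm_qProd_conj h.r_pos h.r_lt, map_div₀, hc]
    congr 2
    simp only [map_mul, map_pow, Complex.conj_ofReal]
    field_simp
  have e3 : ‖p - z‖ = ‖1 - starRingEnd ℂ p * z‖ := by
    have : starRingEnd ℂ (p - z) = -((1 - starRingEnd ℂ p * z) * starRingEnd ℂ z) := by
      rw [map_sub, hc]
      field_simp
      ring
    rw [← RCLike.norm_conj, this, norm_neg, norm_mul, RCLike.norm_conj, hz, mul_one]
  have hd := norm_ne_zero_iff.2 h.denom_ne_zero
  rw [h.annTheta_eq, annThetaUnit, norm_mul, norm_div, norm_mul, e1, e2, e3, mul_div_assoc',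
    div_eq_iff hd, qProd_eq h.norm_q_lt (starRingEnd ℂ p * z), norm_mul, norm_mul]
  ring

end

/-! ### Winding numbers of loops -/

/-- The loop `u`, parametrized by `t ∈ ℝ` with period `2π`, lies in `ℂ ∖ {0}` and has winding
number `d` about `0`: `u t = exp (i d t + L t)` for a continuous `2π`-periodic `L`. -/
def HasWinding (u : ℝ → ℂ) (d : ℤ) : Prop :=
  ∃ L : ℝ → ℂ, Continuous L ∧ (∀ t, L (t + 2 * Real.pi) = L t) ∧
    ∀ t : ℝ, u t = Complex.exp (d * t * Complex.I + L t)

namespace HasWinding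

variable {u v : ℝ → ℂ} {d d' : ℤ}

lemma ne_zero (h : HasWinding u d) (t : ℝ) : u t ≠ 0 := by
  obtain ⟨L, -, -, hL⟩ := h
  rw [hL]
  exact Complex.exp_ne_zero _

lemma continuous (h : HasWinding u d) : Continuous u := by
  obtain ⟨L, hL, -, h⟩ := h
  rw [funext h]
  fun_prop

lemma periodic (h : HasWinding u d) (t : ℝ) : u (t + 2 * Real.pi) = u t := by
  obtain ⟨L, -, hL, h⟩ := h
  rw [h, h, hL, Complex.exp_eq_exp_iff_exists_int]
  refine ⟨d, ?_⟩
  push_cast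
  ring

lemma congr (h : HasWinding u d) (huv : ∀ t, v t = u t) : HasWinding v d := by
  rwa [funext huv]

/-- A continuous branch of `log (u t)` increases by `2πi d` over a period. -/
lemma unique (h : HasWinding u d) (h' : HasWinding u d') : d = d' := by
  obtain ⟨L, hc, hp, hL⟩ := h
  obtain ⟨L', hc', hp', hL'⟩ := h'
  set g : ℝ → ℂ := fun t => (d * t * Complex.I + L t) - (d' * t * Complex.I + L' t) with hg
  have hgc : Continuous g := by fun_prop
  have h1 : ∀ t, ∃ n : ℤ, g t = n * (2 * Real.pi * Complex.I) := fun t => by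
    rw [← Complex.exp_eq_one_iff, hg, Complex.exp_sub, ← hL, ← hL', div_self]
    rw [hL]
    exact Complex.exp_ne_zero _
  have hpi : (2 * Real.pi : ℝ) ≠ 0 := by positivity
  have hT : IsDiscrete (Set.range ((↑) : ℤ → ℝ)) := by
    rw [isDiscrete_iff_discreteTopology]
    exact Int.isClosedEmbedding_coe_real.isEmbedding.toHomeomorph.symm.isEmbedding.discreteTopology
  have h2 : (g (0 + 2 * Real.pi)).im / (2 * Real.pi) = (g 0).im / (2 * Real.pi) := by
    refine isPreconnected_univ.constant_of_mapsTo hT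
      (f := fun t => (g t).im / (2 * Real.pi)) ?_ ?_ (Set.mem_univ _) (Set.mem_univ _)
    · exact ((Complex.continuous_im.comp hgc).div_const _).continuousOn
    · intro t _
      obtain ⟨n, hn⟩ := h1 t
      refine ⟨n, ?_⟩
      simp only [hn]
      rw [eq_div_iff hpi]
      simp
  rw [div_left_inj' hpi] at h2
  have h3 : (g (0 + 2 * Real.pi)).im = (g 0).im + (d - d') * (2 * Real.pi) := by
    simp only [hg, hp, hp']
    simp
    ring
  rw [h3] at h2
  have h4 : ((d : ℝ) - d') * (2 * Real.pi) = 0 := by linarith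
  have h5 := (mul_eq_zero.1 h4).resolve_right hpi
  exact_mod_cast sub_eq_zero.1 h5

lemma mul (hu : HasWinding u d) (hv : HasWinding v d') :
    HasWinding (fun t => u t * v t) (d + d') := by
  obtain ⟨L, hc, hp, hL⟩ := hu
  obtain ⟨L', hc', hp', hL'⟩ := hv
  refine ⟨fun t => L t + L' t, by fun_prop, fun t => by simp only [hp, hp'], fun t => ?_⟩
  beta_reduce
  rw [hL, hL', ← Complex.exp_add]
  congr 1
  push_cast
  ring

lemma inv (hu : HasWinding u d) : HasWinding (fun t => (u t)⁻¹) (-d) := by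
  obtain ⟨L, hc, hp, hL⟩ := hu
  refine ⟨fun t => -L t, by fun_prop, fun t => by simp only [hp], fun t => ?_⟩
  beta_reduce
  rw [hL, ← Complex.exp_neg]
  congr 1
  push_cast
  ring

lemma div (hu : HasWinding u d) (hv : HasWinding v d') :
    HasWinding (fun t => u t / v t) (d - d') := by
  simp only [div_eq_mul_inv, sub_eq_add_neg]
  exact hu.mul hv.inv

lemma const {c : ℂ} (hc : c ≠ 0) : HasWinding (fun _ => c) 0 :=
  ⟨fun _ => Complex.log c, continuous_const, fun _ => rfl, fun t => by
    simp [Complex.exp_log hc]⟩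

lemma zpow (hu : HasWinding u d) (n : ℤ) : HasWinding (fun t => u t ^ n) (n * d) := by
  obtain ⟨L, hc, hp, hL⟩ := hu
  refine ⟨fun t => n * L t, by fun_prop, fun t => by simp only [hp], fun t => ?_⟩
  beta_reduce
  rw [hL, ← Complex.exp_int_mul]
  congr 1
  push_cast
  ring

lemma prod {ι : Type*} (s : Finset ι) {w : ι → ℝ → ℂ} {n : ℤ}
    (h : ∀ i ∈ s, HasWinding (w i) n) :
    HasWinding (fun t => ∏ i ∈ s, w i t) (s.card * n) := by
  classical
  induction s using Finset.induction_on with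
  | empty => simpa using const one_ne_zero
  | insert a s ha ih =>
    have h1 := (h a (Finset.mem_insert_self _ _)).mul
      (ih fun i hi => h i (Finset.mem_insert_of_mem hi))
    simp only [Finset.prod_insert ha, Finset.card_insert_of_notMem ha]
    convert h1 using 1
    push_cast
    ring

lemma comp_neg (hu : HasWinding u d) : HasWinding (fun t => u (-t)) (-d) := by
  obtain ⟨L, hc, hp, hL⟩ := hu
  refine ⟨fun t => L (-t), by fun_prop, fun t => ?_, fun t => ?_⟩
  · beta_reduce
    rw [← hp (-(t + 2 * Real.pi))]
    congr 1
    ring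
  · beta_reduce
    rw [hL]
    congr 1
    push_cast
    ring

lemma circle {ρ : ℝ} (hρ : 0 < ρ) : HasWinding (fun t => ρ * Complex.exp (t * Complex.I)) 1 := by
  refine ⟨fun _ => Real.log ρ, continuous_const, fun _ => rfl, fun t => ?_⟩
  rw [Complex.exp_add, ← Complex.ofReal_exp, Real.exp_log hρ]
  simp [mul_comm]

end HasWinding

/-- A nowhere vanishing holomorphic function on a disc has a holomorphic logarithm. -/
lemma exists_exp_eq_of_ne_zero_on_ball {f : ℂ → ℂ} {R : ℝ} (hR : 0 < R)
    (hf : DifferentiableOn ℂ f (Metric.ball 0 R)) (h0 : ∀ z ∈ Metric.ball (0 : ℂ) R, f z ≠ 0) :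
    ∃ g : ℂ → ℂ, ContinuousOn g (Metric.ball 0 R) ∧
      ∀ z ∈ Metric.ball (0 : ℂ) R, f z = Complex.exp (g z) := by
  have hd : DifferentiableOn ℂ (fun z => deriv f z / f z) (Metric.ball 0 R) :=
    (hf.deriv Metric.isOpen_ball).div hf h0
  have h00 : (0 : ℂ) ∈ Metric.ball (0 : ℂ) R := by simpa
  obtain ⟨g, hg0, hg⟩ := hd.isExactOn_ball.with_val_at 0 (Complex.log (f 0))
  refine ⟨g, fun z hz => (hg z hz).continuousAt.continuousWithinAt, fun z hz => ?_⟩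
  have hq : ∀ w ∈ Metric.ball (0 : ℂ) R,
      HasDerivAt (fun w => f w * Complex.exp (-g w)) 0 w := by
    intro w hw
    have h1 := (hf.differentiableAt (Metric.isOpen_ball.mem_nhds hw)).hasDerivAt
    have h2 := h1.mul ((hg w hw).neg.cexp)
    convert! h2 using 1
    have := h0 w hw
    field_simp
    ring
  have hc := Metric.isOpen_ball.is_const_of_deriv_eq_zero
    (convex_ball (0 : ℂ) R).isPreconnected
    (fun w hw => (hq w hw).differentiableAt.differentiableWithinAt)
    (fun w hw => (hq w hw).deriv) hz h00
  simp only [hg0, Complex.exp_neg, Complex.exp_log (h0 0 h00)] at hc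
  rw [mul_inv_cancel₀ (h0 0 h00), ← div_eq_mul_inv, div_eq_one_iff_eq (Complex.exp_ne_zero _)] at hc
  exact hc

lemma HasWinding.comp_of_ne_zero_on_ball {f : ℂ → ℂ}
    (hf : DifferentiableOn ℂ f (Metric.ball 0 1)) (h0 : ∀ z ∈ Metric.ball (0 : ℂ) 1, f z ≠ 0)
    {x : ℝ → ℂ} (hx : Continuous x) (hp : ∀ t, x (t + 2 * Real.pi) = x t) (h1 : ∀ t, ‖x t‖ < 1) :
    HasWinding (fun t => f (x t)) 0 := by
  obtain ⟨g, hg, hfg⟩ := exists_exp_eq_of_ne_zero_on_ball one_pos hf h0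
  refine ⟨fun t => g (x t), ?_, fun t => by simp only [hp], fun t => ?_⟩
  · exact hg.comp_continuous hx fun t => by simpa using h1 t
  · simp [hfg (x t) (by simpa using h1 t)]

lemma HasWinding.one_sub {x : ℝ → ℂ} (hx : Continuous x) (hp : ∀ t, x (t + 2 * Real.pi) = x t)
    (h1 : ∀ t, ‖x t‖ < 1) : HasWinding (fun t => 1 - x t) 0 := by
  refine HasWinding.comp_of_ne_zero_on_ball (f := fun z => 1 - z) (by fun_prop) ?_ hx hp h1
  intro z hz h
  rw [← sub_eq_zero.1 h] at hz
  simp at hz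

/-- The Möbius transformations of the disk preserve the winding number of loops in the unit
circle. -/
lemma HasWinding.moebius {u : ℝ → ℂ} {d : ℤ} (h : HasWinding u d) (hu : ∀ t, ‖u t‖ = 1) {w : ℂ}
    (hw : ‖w‖ < 1) :
    HasWinding (fun t => (u t - w) / (1 - starRingEnd ℂ w * u t)) d := by
  have hc := h.continuous
  have h0 := h.ne_zero
  have h1 : HasWinding (fun t => 1 - w / u t) 0 :=
    .one_sub (continuous_const.div hc h0) (fun t => by rw [h.periodic])
      fun t => by rw [norm_div, hu, div_one]; exact hw
  have h2 : HasWinding (fun t => 1 - starRingEnd ℂ w * u t) 0 :=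
    .one_sub (by fun_prop) (fun t => by rw [h.periodic])
      fun t => by rw [norm_mul, hu, mul_one, RCLike.norm_conj]; exact hw
  have h3 := (h.mul h1).div h2
  rw [add_zero, sub_zero] at h3
  refine h3.congr fun t => ?_
  have := h0 t
  congr 1
  field_simp

/-! ### Winding numbers of the elementary factors -/

section

variable {r : ℝ} {p : ℂ}

lemma HasWinding.qProd (hr : 0 < r) (hr1 : r < 1) {x : ℝ → ℂ} (hx : Continuous x)
    (hp : ∀ t, x (t + 2 * Real.pi) = x t) (h1 : ∀ t, ‖x t‖ < 1) :
    HasWinding (fun t => qProd ((r : ℂ) ^ 2) (x t)) 0 :=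
  .comp_of_ne_zero_on_ball (differentiable_qProd (norm_ofReal_sq_lt_one hr hr1)).differentiableOn
    (fun z hz => qProd_ne_zero (norm_ofReal_sq_lt_one hr hr1) (by simpa using hz)) hx hp h1

lemma norm_circleParam {ρ : ℝ} (hρ : 0 < ρ) (t : ℝ) : ‖ρ * Complex.exp (t * Complex.I)‖ = ρ := by
  rw [norm_mul, Complex.norm_exp_ofReal_mul_I, mul_one, Complex.norm_real,
    Real.norm_of_nonneg hρ.le]

lemma hasWinding_annThetaUnit {ρ : ℝ} (hρ : 0 < ρ)
    (h : ∀ t : ℝ, ThetaDom r p (ρ * Complex.exp (t * Complex.I))) :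
    HasWinding (fun t : ℝ => annThetaUnit r p (ρ * Complex.exp (t * Complex.I))) 0 := by
  have hr := (h 0).r_pos
  have hr1 := (h 0).r_lt
  have hp := (h 0).p_ne_zero
  have hp' : starRingEnd ℂ p ≠ 0 := (map_ne_zero _).2 hp
  have hz := fun t => (h t).z_ne_zero
  set z : ℝ → ℂ := fun t => ρ * Complex.exp (t * Complex.I) with hzdef
  have hzc : Continuous z := by fun_prop
  have hzp : ∀ t, z (t + 2 * Real.pi) = z t := (HasWinding.circle hρ).periodic
  have w1 := HasWinding.qProd hr hr1 (x := fun t => (r : ℂ) ^ 2 * (z t / p)) (by fun_prop)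
    (fun t => by rw [hzp]) fun t => (h t).norm_mul_div_lt'
  have w2 := HasWinding.qProd hr hr1 (x := fun t => (r : ℂ) ^ 2 * p / z t)
    (continuous_const.div hzc hz) (fun t => by rw [hzp]) fun t => (h t).norm_mul_div_lt
  have w3 := HasWinding.qProd hr hr1 (x := fun t => starRingEnd ℂ p * z t)
    (by fun_prop) (fun t => by rw [hzp]) fun t => (h t).norm_conj_mul_lt
  have w4 := HasWinding.qProd hr hr1 (x := fun t => (r : ℂ) ^ 2 / (starRingEnd ℂ p * z t))
    (continuous_const.div (by fun_prop) fun t => mul_ne_zero hp' (hz t))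
    (fun t => by rw [hzp]) fun t => (h t).norm_div_conj_mul_lt
  have w := (w1.mul w2).div (w3.mul w4)
  simp only [add_zero, sub_zero] at w
  exact w.congr fun t => by rw [annThetaUnit]

lemma hasWinding_annTheta_inner (hr : 0 < r) (hr1 : r < 1) (hp : p ∈ annulus r) :
    HasWinding (fun t : ℝ => annTheta r p (r * Complex.exp (t * Complex.I))) 0 := by
  have h : ∀ t : ℝ, ThetaDom r p (r * Complex.exp (t * Complex.I)) := fun t =>
    thetaDom_of_mem_annulus hr hr1 hp (norm_circleParam hr t).ge
      ((norm_circleParam hr t).le.trans hr1.le)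
  have hp0 := (h 0).p_ne_zero
  have w1 : HasWinding (fun t : ℝ => 1 - r * Complex.exp (t * Complex.I) / p) 0 :=
    .one_sub (by fun_prop) (fun t => by rw [(HasWinding.circle hr).periodic])
      fun t => by
        rw [norm_div, norm_circleParam hr, div_lt_one (norm_pos_iff.2 hp0)]
        exact hp.1
  have w2 := ((HasWinding.const hp0).mul w1).mul (hasWinding_annThetaUnit hr h)
  refine HasWinding.congr (by simpa using w2) fun t => ?_
  rw [(h t).annTheta_eq]
  congr 1
  field_simp

lemma hasWinding_annTheta_outer (hr : 0 < r) (hr1 : r < 1) (hp : p ∈ annulus r) :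
    HasWinding (fun t : ℝ => annTheta r p ((1 : ℝ) * Complex.exp (t * Complex.I))) 1 := by
  have h : ∀ t : ℝ, ThetaDom r p ((1 : ℝ) * Complex.exp (t * Complex.I)) := fun t =>
    thetaDom_of_mem_annulus hr hr1 hp (hr1.le.trans (norm_circleParam one_pos t).ge)
      (norm_circleParam one_pos t).le
  have w1 : HasWinding (fun t : ℝ => 1 - p / ((1 : ℝ) * Complex.exp (t * Complex.I))) 0 :=
    .one_sub (continuous_const.div (by fun_prop) fun t => (h t).z_ne_zero)
      (fun t => by rw [(HasWinding.circle one_pos).periodic])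
      fun t => by
        rw [norm_div, norm_circleParam one_pos, div_one]
        exact hp.2
  have w2 := (((HasWinding.const (neg_ne_zero.2 one_ne_zero)).mul
    (HasWinding.circle one_pos)).mul w1).mul (hasWinding_annThetaUnit one_pos h)
  refine w2.congr fun t => ?_
  rw [(h t).annTheta_eq]
  have := (h t).z_ne_zero
  generalize ((1 : ℝ) : ℂ) * Complex.exp (t * Complex.I) = z at *
  congr 1
  field_simp
  ring

end

/-! ### The ends of the annulus and the maximum principle -/

/-- The filter of neighbourhoods of the two boundary circles in the annulus: `z` tends to the
boundary when `‖z‖` tends to `r` or to `1` from inside. -/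
noncomputable def annulusEnds (r : ℝ) : Filter ℂ :=
  Filter.comap (fun z : ℂ => ‖z‖) (nhdsWithin r (Set.Ioi r) ⊔ nhdsWithin 1 (Set.Iio 1))

lemma isOpen_annulus (r : ℝ) : IsOpen (annulus r) :=
  (isOpen_lt continuous_const continuous_norm).inter (isOpen_lt continuous_norm continuous_const)

section

variable {r : ℝ}

lemma eventually_mem_annulus (hr1 : r < 1) : ∀ᶠ z in annulusEnds r, z ∈ annulus r := by
  have h : Set.Ioo r 1 ∈ nhdsWithin r (Set.Ioi r) ⊔ nhdsWithin 1 (Set.Iio 1) :=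
    Filter.mem_sup.2 ⟨Ioo_mem_nhdsGT hr1, Ioo_mem_nhdsLT hr1⟩
  exact Filter.mem_of_superset (Filter.preimage_mem_comap h) fun z hz => hz

lemma annulusEnds_neBot (hr : 0 < r) : (annulusEnds r).NeBot := by
  refine Filter.NeBot.comap_of_range_mem (Filter.NeBot.mono inferInstance le_sup_left) ?_
  refine Filter.mem_sup.2 ⟨?_, ?_⟩
  · filter_upwards [self_mem_nhdsWithin] with x hx
    exact ⟨(x : ℂ), by beta_reduce; rw [Complex.norm_real, Real.norm_of_nonneg (hr.trans hx).le]⟩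
  · filter_upwards [Ioo_mem_nhdsLT (zero_lt_one' ℝ)] with x hx
    exact ⟨(x : ℂ), by beta_reduce; rw [Complex.norm_real, Real.norm_of_nonneg hx.1.le]⟩

/-- A property holding near the ends of the annulus holds off a compact subannulus. -/
lemma exists_of_eventually_annulusEnds {P : ℂ → Prop} (h : ∀ᶠ z in annulusEnds r, P z) :
    ∃ a b, r < a ∧ b < 1 ∧ ∀ z ∈ annulus r, ¬ P z → a ≤ ‖z‖ ∧ ‖z‖ ≤ b := by
  obtain ⟨S, hS, hSP⟩ := Filter.mem_comap.1 h
  obtain ⟨h1, h2⟩ := Filter.mem_sup.1 hS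
  obtain ⟨a, ha, haS⟩ := mem_nhdsGT_iff_exists_Ioo_subset.1 h1
  obtain ⟨b, hb, hbS⟩ := mem_nhdsLT_iff_exists_Ioo_subset.1 h2
  refine ⟨a, b, ha, hb, fun z hz hP => ⟨?_, ?_⟩⟩
  · by_contra! hlt
    exact hP (hSP (haS ⟨hz.1, hlt⟩))
  · by_contra! hlt
    exact hP (hSP (hbS ⟨hlt, hz.2⟩))

lemma isCompact_closedAnnulus (a b : ℝ) : IsCompact {z : ℂ | a ≤ ‖z‖ ∧ ‖z‖ ≤ b} := by
  refine Metric.isCompact_of_isClosed_isBounded ?_ ?_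
  · exact (isClosed_le continuous_const continuous_norm).inter
      (isClosed_le continuous_norm continuous_const)
  · exact (Metric.isBounded_closedBall (x := (0 : ℂ)) (r := b)).subset fun z hz => by
      simpa using hz.2

lemma closedAnnulus_subset_annulus {a b : ℝ} (ha : r < a) (hb : b < 1) :
    {z : ℂ | a ≤ ‖z‖ ∧ ‖z‖ ≤ b} ⊆ annulus r :=
  fun _ hz => ⟨ha.trans_le hz.1, hz.2.trans_lt hb⟩

lemma annulus_subset_closedAnnulus : annulus r ⊆ {z : ℂ | r ≤ ‖z‖ ∧ ‖z‖ ≤ 1} :=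
  fun _ hz => ⟨hz.1.le, hz.2.le⟩

lemma tendsto_annulusEnds_of_continuousOn (hr1 : r < 1) {Q : ℂ → ℝ}
    (hQ : ContinuousOn Q {z | r ≤ ‖z‖ ∧ ‖z‖ ≤ 1}) (h0 : ∀ z, ‖z‖ = r → Q z = 1)
    (h1 : ∀ z, ‖z‖ = 1 → Q z = 1) : Filter.Tendsto Q (annulusEnds r) (nhds 1) := by
  rw [Metric.tendsto_nhds]
  intro ε hε
  set S : Set ℂ := {z | r ≤ ‖z‖ ∧ ‖z‖ ≤ 1} ∩ (fun z => dist (Q z) 1) ⁻¹' Set.Ici ε with hS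
  have hc : ContinuousOn (fun z => dist (Q z) 1) {z | r ≤ ‖z‖ ∧ ‖z‖ ≤ 1} :=
    continuous_id.dist continuous_const |>.comp_continuousOn hQ
  have hSc : IsCompact S := (isCompact_closedAnnulus r 1).of_isClosed_subset
    (hc.preimage_isClosed_of_isClosed (isCompact_closedAnnulus r 1).isClosed isClosed_Ici)
    Set.inter_subset_left
  have hN := (hSc.image continuous_norm).isClosed.isOpen_compl
  have hnot : ∀ ρ : ℝ, (∀ z : ℂ, ‖z‖ = ρ → Q z = 1) →
      ρ ∈ ((fun z : ℂ => ‖z‖) '' S)ᶜ := by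
    rintro ρ hρ ⟨z, hz, hzρ⟩
    have := hz.2
    simp only [Set.mem_preimage, hρ z hzρ, dist_self, Set.mem_Ici] at this
    linarith
  have hmem : ((fun z : ℂ => ‖z‖) '' S)ᶜ ∈ nhdsWithin r (Set.Ioi r) ⊔ nhdsWithin 1 (Set.Iio 1) :=
    Filter.mem_sup.2 ⟨mem_nhdsWithin_of_mem_nhds (hN.mem_nhds (hnot r h0)),
      mem_nhdsWithin_of_mem_nhds (hN.mem_nhds (hnot 1 h1))⟩
  filter_upwards [eventually_mem_annulus hr1, Filter.preimage_mem_comap hmem] with z hz hz'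
  by_contra! hlt
  exact hz' ⟨z, ⟨annulus_subset_closedAnnulus hz, hlt⟩, rfl⟩

/-- The strip that the exponential map wraps onto the annulus. -/
def logStrip (r : ℝ) : Set ℂ := {ζ | Real.log r < ζ.re ∧ ζ.re < 0}

lemma isOpen_logStrip (r : ℝ) : IsOpen (logStrip r) :=
  (isOpen_lt continuous_const Complex.continuous_re).inter
    (isOpen_lt Complex.continuous_re continuous_const)

lemma isPreconnected_logStrip (r : ℝ) : IsPreconnected (logStrip r) :=
  ((convex_halfSpace_re_gt _).inter (convex_halfSpace_re_lt _)).isPreconnected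

lemma exp_mem_annulus (hr : 0 < r) {ζ : ℂ} (hζ : ζ ∈ logStrip r) : Complex.exp ζ ∈ annulus r := by
  refine ⟨?_, ?_⟩
  · rw [Complex.norm_exp, ← Real.log_lt_iff_lt_exp hr]
    exact hζ.1
  · rw [Complex.norm_exp, Real.exp_lt_one_iff]
    exact hζ.2

lemma ne_zero_of_mem_annulus (hr : 0 < r) {z : ℂ} (hz : z ∈ annulus r) : z ≠ 0 :=
  norm_pos_iff.1 (hr.trans hz.1)

lemma log_mem_logStrip (hr : 0 < r) {z : ℂ} (hz : z ∈ annulus r) : Complex.log z ∈ logStrip r := by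
  have hz0 := norm_pos_iff.2 (ne_zero_of_mem_annulus hr hz)
  refine ⟨?_, ?_⟩
  · rw [Complex.log_re]
    exact Real.log_lt_log hr hz.1
  · rw [Complex.log_re]
    exact Real.log_neg hz0 hz.2

lemma isPreconnected_annulus (hr : 0 < r) : IsPreconnected (annulus r) := by
  have : annulus r = Complex.exp '' logStrip r := by
    ext z
    refine ⟨fun hz => ⟨Complex.log z, log_mem_logStrip hr hz,
      Complex.exp_log (ne_zero_of_mem_annulus hr hz)⟩, ?_⟩
    rintro ⟨ζ, hζ, rfl⟩
    exact exp_mem_annulus hr hζ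
  rw [this]
  exact (isPreconnected_logStrip r).image _ Complex.continuous_exp.continuousOn

/-- The maximum principle on the annulus for the modulus of a multivalued holomorphic function:
`v` is a branch on the universal cover, and `m` its single-valued modulus. -/
lemma norm_le_one_of_tendsto_annulusEnds (hr : 0 < r) (hr1 : r < 1) {v : ℂ → ℂ}
    (hv : DifferentiableOn ℂ v (logStrip r)) {m : ℂ → ℝ} (hm : ContinuousOn m (annulus r))
    (hm1 : Filter.Tendsto m (annulusEnds r) (nhds 1))
    (hvm : ∀ ζ ∈ logStrip r, ‖v ζ‖ = m (Complex.exp ζ)) {ζ : ℂ} (hζ : ζ ∈ logStrip r) :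
    ‖v ζ‖ ≤ 1 := by
  by_contra! hlt
  rw [hvm ζ hζ] at hlt
  obtain ⟨a, b, ha, hb, hab⟩ := exists_of_eventually_annulusEnds
    (hm1.eventually (gt_mem_nhds hlt))
  set K : Set ℂ := {z : ℂ | a ≤ ‖z‖ ∧ ‖z‖ ≤ b} with hK
  have hKA : K ⊆ annulus r := closedAnnulus_subset_annulus ha hb
  have hexp := exp_mem_annulus hr hζ
  have hζK : Complex.exp ζ ∈ K := hab _ hexp (lt_irrefl _)
  obtain ⟨z₁, hz₁, hmax⟩ := (isCompact_closedAnnulus a b).exists_isMaxOn ⟨_, hζK⟩ (hm.mono hKA)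
  have hmax' : ∀ z ∈ annulus r, m z ≤ m z₁ := by
    intro z hz
    by_cases hzK : z ∈ K
    · exact hmax hzK
    · have : m z < m (Complex.exp ζ) := by
        by_contra hn
        exact hzK (hab z hz hn)
      exact this.le.trans (hmax hζK)
  have hlog := log_mem_logStrip hr (hKA hz₁)
  have hexplog := Complex.exp_log (ne_zero_of_mem_annulus hr (hKA hz₁))
  have hconst := Complex.norm_eqOn_of_isPreconnected_of_isMaxOn (isPreconnected_logStrip r)
    (isOpen_logStrip r) hv hlog (fun η hη => by
      simp only [Function.comp, Set.mem_ofPred_eq]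
      rw [hvm η hη, hvm _ hlog, hexplog]
      exact hmax' _ (exp_mem_annulus hr hη))
  have hall : ∀ z ∈ annulus r, m z = m z₁ := by
    intro z hz
    have h1 := hconst (log_mem_logStrip hr hz)
    simp only [Function.comp, Function.const] at h1
    rwa [hvm _ (log_mem_logStrip hr hz), hvm _ hlog, hexplog,
      Complex.exp_log (ne_zero_of_mem_annulus hr hz)] at h1
  have := annulusEnds_neBot hr
  have h2 : Filter.Tendsto m (annulusEnds r) (nhds (m z₁)) :=
    tendsto_const_nhds.congr' ((eventually_mem_annulus hr1).mono fun z hz => (hall z hz).symm)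
  have h3 := tendsto_nhds_unique h2 hm1
  have h4 := hmax hζK
  simp only [Set.mem_ofPred_eq] at h4
  linarith

/-- A zero-free holomorphic function on the annulus whose modulus is asymptotic to `‖z‖ ^ (-s)` at
both ends is a monomial, and `s` is an integer. -/
lemma eq_const_mul_zpow_of_tendsto (hr : 0 < r) (hr1 : r < 1) {u : ℂ → ℂ}
    (hu : DifferentiableOn ℂ u (annulus r)) (hu0 : ∀ z ∈ annulus r, u z ≠ 0) {s : ℝ}
    (hlim : Filter.Tendsto (fun z => ‖u z‖ * ‖z‖ ^ s) (annulusEnds r) (nhds 1)) :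
    ∃ d : ℤ, s = d ∧ ∃ c : ℂ, ‖c‖ = 1 ∧ ∀ z ∈ annulus r, u z = c * z ^ (-d) := by
  set v : ℂ → ℂ := fun ζ => u (Complex.exp ζ) * Complex.exp (s * ζ) with hv
  have hvd : DifferentiableOn ℂ v (logStrip r) := by
    refine DifferentiableOn.mul ?_ (by fun_prop)
    exact hu.comp Complex.differentiable_exp.differentiableOn fun ζ hζ => exp_mem_annulus hr hζ
  have hv0 : ∀ ζ ∈ logStrip r, v ζ ≠ 0 := fun ζ hζ =>
    mul_ne_zero (hu0 _ (exp_mem_annulus hr hζ)) (Complex.exp_ne_zero _)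
  have hvm : ∀ ζ : ℂ, ‖v ζ‖ = ‖u (Complex.exp ζ)‖ * ‖Complex.exp ζ‖ ^ s := by
    intro ζ
    rw [hv, norm_mul, Complex.norm_exp, Complex.norm_exp, ← Real.exp_mul]
    congr 2
    simp [mul_comm]
  have hmc : ContinuousOn (fun z => ‖u z‖ * ‖z‖ ^ s) (annulus r) := by
    refine hu.continuousOn.norm.mul (ContinuousOn.rpow_const continuous_norm.continuousOn ?_)
    exact fun z hz => Or.inl (norm_ne_zero_iff.2 (ne_zero_of_mem_annulus hr hz))
  have hm0 : ∀ z ∈ annulus r, ‖u z‖ * ‖z‖ ^ s ≠ 0 := fun z hz =>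
    mul_ne_zero (norm_ne_zero_iff.2 (hu0 z hz))
      (Real.rpow_pos_of_pos (norm_pos_iff.2 (ne_zero_of_mem_annulus hr hz)) _).ne'
  have hle : ∀ ζ ∈ logStrip r, ‖v ζ‖ ≤ 1 := fun ζ hζ =>
    norm_le_one_of_tendsto_annulusEnds hr hr1 hvd hmc hlim (fun ζ _ => hvm ζ) hζ
  have hge : ∀ ζ ∈ logStrip r, ‖(v ζ)⁻¹‖ ≤ 1 := fun ζ hζ =>
    norm_le_one_of_tendsto_annulusEnds hr hr1 (v := fun ζ => (v ζ)⁻¹)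
      (m := fun z => (‖u z‖ * ‖z‖ ^ s)⁻¹) (hvd.inv hv0)
      (hmc.inv₀ hm0) (by simpa using hlim.inv₀ one_ne_zero)
      (fun ζ _ => by rw [norm_inv, hvm]) hζ
  have hone : ∀ ζ ∈ logStrip r, ‖v ζ‖ = 1 := by
    intro ζ hζ
    refine le_antisymm (hle ζ hζ) ?_
    have := hge ζ hζ
    rw [norm_inv] at this
    exact (inv_le_one₀ (norm_pos_iff.2 (hv0 ζ hζ))).1 this
  set ζ₀ : ℂ := ((Real.log r / 2 : ℝ) : ℂ) with hζ₀
  have hlr := Real.log_neg hr hr1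
  have hmem : ζ₀ ∈ logStrip r := by
    constructor
    · rw [hζ₀, Complex.ofReal_re]
      linarith
    · rw [hζ₀, Complex.ofReal_re]
      linarith
  have hmem' : ζ₀ + 2 * Real.pi * Complex.I ∈ logStrip r := by
    have : (ζ₀ + 2 * Real.pi * Complex.I).re = ζ₀.re := by simp
    rw [logStrip, Set.mem_ofPred_eq, this]
    exact hmem
  have hconst : ∀ ζ ∈ logStrip r, v ζ = v ζ₀ := fun ζ hζ =>
    Complex.eqOn_of_isPreconnected_of_isMaxOn_norm (isPreconnected_logStrip r)
      (isOpen_logStrip r) hvd hmem (fun η hη => by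
        simp only [Function.comp, Set.mem_ofPred_eq]
        rw [hone _ hη, hone _ hmem]) hζ
  -- The function `u ∘ exp` has period `2πi`, so `exp (s ζ)` must have it as well.
  have hper := hconst _ hmem'
  simp only [hv, Complex.exp_periodic ζ₀] at hper
  have hper' := mul_left_cancel₀ (hu0 _ (exp_mem_annulus hr hmem)) hper
  rw [Complex.exp_eq_exp_iff_exists_int] at hper'
  obtain ⟨d, hd⟩ := hper'
  have hsd : (s : ℂ) = d := by
    have h2 : (2 * Real.pi * Complex.I : ℂ) ≠ 0 := Complex.two_pi_I_ne_zero
    have : (s : ℂ) * (2 * Real.pi * Complex.I) = d * (2 * Real.pi * Complex.I) := by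
      linear_combination hd
    exact mul_right_cancel₀ h2 this
  refine ⟨d, by exact_mod_cast hsd, v ζ₀, hone _ hmem, fun z hz => ?_⟩
  have h1 := hconst _ (log_mem_logStrip hr hz)
  have hz0 := ne_zero_of_mem_annulus hr hz
  rw [← h1]
  simp only [hv, Complex.exp_log hz0]
  rw [hsd, Complex.exp_int_mul, Complex.exp_log hz0, zpow_neg,
    mul_inv_cancel_right₀ (zpow_ne_zero _ hz0)]

end

/-- Two holomorphic functions with the same finite orders of vanishing differ by a zero-free
holomorphic factor. -/
lemma exists_eq_mul_of_analyticOrderAt_eq {U : Set ℂ} {f g : ℂ → ℂ} (hf : AnalyticOnNhd ℂ f U)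
    (hg : AnalyticOnNhd ℂ g U) (hfg : ∀ z ∈ U, analyticOrderAt f z = analyticOrderAt g z)
    (hg0 : ∀ z ∈ U, analyticOrderAt g z ≠ ⊤) :
    ∃ u : ℂ → ℂ, AnalyticOnNhd ℂ u U ∧ ∀ z ∈ U, u z ≠ 0 ∧ f z = u z * g z := by
  have hmer : MeromorphicOn (f / g) U := fun z hz =>
    (hf z hz).meromorphicAt.div (hg z hz).meromorphicAt
  have hNF := meromorphicNFOn_toMeromorphicNFOn (f / g) U
  have hord : ∀ z ∈ U, meromorphicOrderAt (toMeromorphicNFOn (f / g) U) z = 0 := by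
    intro z hz
    rw [meromorphicOrderAt_toMeromorphicNFOn hmer hz,
      meromorphicOrderAt_div (hf z hz).meromorphicAt (hg z hz).meromorphicAt,
      (hf z hz).meromorphicOrderAt_eq, (hg z hz).meromorphicOrderAt_eq, hfg z hz]
    lift analyticOrderAt g z to ℕ using hg0 z hz with n
    simp only [ENat.map_natCast]
    norm_cast
    simp
  refine ⟨toMeromorphicNFOn (f / g) U, fun z hz =>
    (hNF hz).meromorphicOrderAt_nonneg_iff_analyticAt.1 (hord z hz).ge, fun z hz =>
    ⟨(hNF hz).meromorphicOrderAt_eq_zero_iff.1 (hord z hz), ?_⟩⟩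
  have han := (hNF hz).meromorphicOrderAt_nonneg_iff_analyticAt.1 (hord z hz).ge
  have h1 : f =ᶠ[nhdsWithin z {z}ᶜ] fun w => toMeromorphicNFOn (f / g) U w * g w := by
    have hne := (hg z hz).eventually_eq_zero_or_eventually_ne_zero.resolve_left
      (fun h => hg0 z hz (analyticOrderAt_eq_top.2 h))
    filter_upwards [hne, hmer.toMeromorphicNFOn_eq_self_on_nhdsNE hz] with w hw1 hw2
    rw [hw2, Pi.div_apply, div_mul_cancel₀ _ hw1]
  exact (((hf z hz).continuousAt.eventuallyEq_nhds_iff_eventuallyEq_nhdsNE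
    (han.continuousAt.mul (hg z hz).continuousAt)).1 h1).eq_of_nhds

/-! ### Products of elementary factors and the structure of unimodular functions -/

/-- The product of the elementary factors with zeros `p_1, …, p_n`. -/
noncomputable def annThetaProd (r : ℝ) {n : ℕ} (p : Fin n → ℂ) (z : ℂ) : ℂ :=
  ∏ k, annTheta r (p k) z

lemma analyticOrderAt_fun_prod {ι : Type*} (s : Finset ι) {f : ι → ℂ → ℂ} {z : ℂ}
    (hf : ∀ i ∈ s, AnalyticAt ℂ (f i) z) :
    analyticOrderAt (fun w => ∏ i ∈ s, f i w) z = ∑ i ∈ s, analyticOrderAt (f i) z := by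
  classical
  induction s using Finset.induction_on with
  | empty => simpa using (analyticAt_const (v := (1 : ℂ))).analyticOrderAt_eq_zero.2 one_ne_zero
  | insert a s ha ih =>
    have hs := fun i hi => hf i (Finset.mem_insert_of_mem hi)
    simp only [Finset.prod_insert ha, Finset.sum_insert ha]
    rw [← ih hs, ← analyticOrderAt_mul (hf a (Finset.mem_insert_self _ _))
      (s.analyticAt_fun_prod hs)]
    rfl

section

variable {r : ℝ} {n : ℕ} {p : Fin n → ℂ} {z : ℂ}

lemma analyticAt_annThetaProd (h : ∀ k, ThetaDom r (p k) z) :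
    AnalyticAt ℂ (annThetaProd r p) z :=
  Finset.univ.analyticAt_fun_prod fun k _ => (h k).analyticAt_annTheta

lemma analyticOrderAt_annThetaProd (h : ∀ k, ThetaDom r (p k) z) :
    analyticOrderAt (annThetaProd r p) z = ((Finset.univ.filter fun k => p k = z).card : ℕ∞) := by
  unfold annThetaProd
  rw [analyticOrderAt_fun_prod _ fun k _ => (h k).analyticAt_annTheta]
  simp only [(h _).analyticOrderAt_annTheta, Finset.sum_boole]

lemma annThetaProd_ne_zero (h : ∀ k, ThetaDom r (p k) z) (hne : ∀ k, p k ≠ z) :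
    annThetaProd r p z ≠ 0 :=
  Finset.prod_ne_zero_iff.2 fun k _ => (h k).annTheta_ne_zero (hne k).symm

lemma norm_annThetaProd_inner (h : ∀ k, ThetaDom r (p k) z) (hz : ‖z‖ = r) :
    ‖annThetaProd r p z‖ = ‖∏ k, p k‖ := by
  rw [annThetaProd, norm_prod, norm_prod]
  exact Finset.prod_congr rfl fun k _ => norm_annTheta_inner (h k) hz

lemma norm_annThetaProd_outer (h : ∀ k, ThetaDom r (p k) z) (hz : ‖z‖ = 1) :
    ‖annThetaProd r p z‖ = 1 := by
  rw [annThetaProd, norm_prod]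
  exact Finset.prod_eq_one fun k _ => norm_annTheta_outer (h k) hz

variable (hr : 0 < r) (hr1 : r < 1) (hp : ∀ k, p k ∈ annulus r)
include hr hr1 hp

lemma continuousOn_annThetaProd : ContinuousOn (annThetaProd r p) {z | r ≤ ‖z‖ ∧ ‖z‖ ≤ 1} :=
  fun _ hz => (analyticAt_annThetaProd fun k =>
    thetaDom_of_mem_annulus hr hr1 (hp k) hz.1 hz.2).continuousAt.continuousWithinAt

lemma continuousOn_monomial_mul_annThetaProd (c : ℂ) (d : ℤ) :
    ContinuousOn (fun z => c * z ^ (-d) * annThetaProd r p z) {z | r ≤ ‖z‖ ∧ ‖z‖ ≤ 1} := by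
  refine ContinuousOn.mul (continuousOn_const.mul ?_) (continuousOn_annThetaProd hr hr1 hp)
  exact continuousOn_id.zpow₀ _ fun z hz => Or.inl (norm_pos_iff.1 (hr.trans_le hz.1))

lemma hasWinding_annThetaProd_inner {c : ℂ} (hc : c ≠ 0) (d : ℤ) :
    HasWinding (fun t : ℝ => c * (r * Complex.exp (t * Complex.I)) ^ (-d) *
      annThetaProd r p (r * Complex.exp (t * Complex.I))) (-d) := by
  have h := ((HasWinding.const hc).mul ((HasWinding.circle hr).zpow (-d))).mul
    (HasWinding.prod Finset.univ fun k _ => hasWinding_annTheta_inner hr hr1 (hp k))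
  simpa [annThetaProd] using h

lemma hasWinding_annThetaProd_outer {c : ℂ} (hc : c ≠ 0) (d : ℤ) :
    HasWinding (fun t : ℝ => c * ((1 : ℝ) * Complex.exp (t * Complex.I)) ^ (-d) *
      annThetaProd r p ((1 : ℝ) * Complex.exp (t * Complex.I))) (-d + n) := by
  have h := ((HasWinding.const hc).mul ((HasWinding.circle one_pos).zpow (-d))).mul
    (HasWinding.prod Finset.univ fun k _ => hasWinding_annTheta_outer hr hr1 (hp k))
  simpa [annThetaProd] using h

/-- A holomorphic function on the annulus whose modulus tends to `1` at the boundary is determined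
up to a unimodular constant by its zeros `p_1, …, p_n`; the modulus of `p_1 ⋯ p_n` is an integral
power of `r`. -/
theorem exists_eq_monomial_mul_annThetaProd {f : ℂ → ℂ} (hf : DifferentiableOn ℂ f (annulus r))
    (hlim : Filter.Tendsto (fun z => ‖f z‖) (annulusEnds r) (nhds 1))
    (hord : ∀ z ∈ annulus r,
      analyticOrderAt f z = ((Finset.univ.filter fun k => p k = z).card : ℕ∞)) :
    ∃ d : ℤ, ‖∏ k, p k‖ = r ^ d ∧ ∃ c : ℂ, ‖c‖ = 1 ∧
      ∀ z ∈ annulus r, f z = c * z ^ (-d) * annThetaProd r p z := by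
  have hdom : ∀ z ∈ annulus r, ∀ k, ThetaDom r (p k) z := fun z hz k =>
    thetaDom_of_mem_annulus hr hr1 (hp k) hz.1.le hz.2.le
  obtain ⟨u, hu, huf⟩ := exists_eq_mul_of_analyticOrderAt_eq
    (hf.analyticOnNhd (isOpen_annulus r))
    (fun z hz => analyticAt_annThetaProd (hdom z hz))
    (fun z hz => by rw [hord z hz, analyticOrderAt_annThetaProd (hdom z hz)])
    (fun z hz => by rw [analyticOrderAt_annThetaProd (hdom z hz)]; exact ENat.natCast_ne_top _)
  have hN : 0 < ‖∏ k, p k‖ := norm_pos_iff.2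
    (Finset.prod_ne_zero_iff.2 fun k _ => ne_zero_of_mem_annulus hr (hp k))
  set s : ℝ := Real.log ‖∏ k, p k‖ / Real.log r with hs
  have hrs : r ^ s = ‖∏ k, p k‖ := by
    rw [Real.rpow_def_of_pos hr, hs, mul_div_cancel₀ _ (Real.log_neg hr hr1).ne, Real.exp_log hN]
  have hQ : Filter.Tendsto (fun z => ‖annThetaProd r p z‖ * ‖z‖ ^ (-s)) (annulusEnds r)
      (nhds 1) := by
    refine tendsto_annulusEnds_of_continuousOn hr1 ?_ ?_ ?_
    · refine (continuousOn_annThetaProd hr hr1 hp).norm.mul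
        (ContinuousOn.rpow_const continuous_norm.continuousOn fun z hz => Or.inl ?_)
      exact (hr.trans_le hz.1).ne'
    · intro z hz
      have hd : ∀ k, ThetaDom r (p k) z := fun k =>
        thetaDom_of_mem_annulus hr hr1 (hp k) hz.ge (hz.le.trans hr1.le)
      rw [norm_annThetaProd_inner hd hz, hz, Real.rpow_neg hr.le, hrs, mul_inv_cancel₀ hN.ne']
    · intro z hz
      have hd : ∀ k, ThetaDom r (p k) z := fun k =>
        thetaDom_of_mem_annulus hr hr1 (hp k) (hr1.le.trans hz.ge) hz.le
      rw [norm_annThetaProd_outer hd hz, hz, Real.one_rpow, one_mul]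
  have hu1 : Filter.Tendsto (fun z => ‖u z‖ * ‖z‖ ^ s) (annulusEnds r) (nhds 1) := by
    have h1 := hlim.div hQ one_ne_zero
    rw [div_one] at h1
    refine h1.congr' ?_
    filter_upwards [hQ.eventually (lt_mem_nhds one_pos), eventually_mem_annulus hr1] with z hz hzA
    have hz0 := norm_pos_iff.2 (ne_zero_of_mem_annulus hr hzA)
    rw [Pi.div_apply, div_eq_iff hz.ne', (huf z hzA).2, norm_mul, Real.rpow_neg hz0.le]
    have := (Real.rpow_pos_of_pos hz0 s).ne'
    field_simp
  obtain ⟨d, hsd, c, hc, hcu⟩ := eq_const_mul_zpow_of_tendsto hr hr1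
    hu.differentiableOn (fun z hz => (huf z hz).1) hu1
  refine ⟨d, ?_, c, hc, fun z hz => by rw [(huf z hz).2, hcu z hz]⟩
  rw [← hrs, hsd, Real.rpow_intCast]

end

/-- A finitely supported multiplicity function is the divisor of a finite list of points. -/
lemma exists_list_of_multiplicity (Z : Finset ℂ) (m : ℂ → ℕ) (hm : ∀ z ∉ Z, m z = 0) :
    ∃ p : Fin (∑ z ∈ Z, m z) → ℂ, (∀ k, p k ∈ Z) ∧
      ∀ z, (Finset.univ.filter fun k => p k = z).card = m z := by
  classical
  set s : Multiset ℂ := ∑ z ∈ Z, Multiset.replicate (m z) z with hs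
  have hcount : ∀ z, s.count z = m z := by
    intro z
    rw [hs, Multiset.count_sum']
    simp only [Multiset.count_replicate]
    rw [Finset.sum_ite_eq' Z z m]
    split_ifs with h
    · rfl
    · exact (hm z h).symm
  have hcard : s.toList.length = ∑ z ∈ Z, m z := by
    rw [Multiset.length_toList, hs, Multiset.card_sum]
    simp
  rw [← hcard]
  have key : ∀ z, (Finset.univ.filter fun k => s.toList.get k = z).card = m z := by
    intro z
    rw [← hcount z]
    conv_rhs => rw [← Multiset.coe_toList s, ← List.ofFn_get s.toList, ← Fin.univ_val_map,
      Multiset.count_map]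
    rw [Finset.card_def, Finset.filter_val]
    simp only [eq_comm]
  refine ⟨s.toList.get, fun k => ?_, key⟩
  by_contra hk
  have := key (s.toList.get k)
  rw [hm _ hk, Finset.card_eq_zero, Finset.filter_eq_empty_iff] at this
  exact this (Finset.mem_univ k) rfl

lemma exists_perm_of_card_filter_eq {n : ℕ} {p q : Fin n → ℂ}
    (h : ∀ z, (Finset.univ.filter fun k => p k = z).card =
      (Finset.univ.filter fun k => q k = z).card) :
    ∃ σ : Equiv.Perm (Fin n), ∀ k, q k = p (σ k) := by
  classical
  have e : ∀ z, Nonempty ({k // q k = z} ≃ {k // p k = z}) := fun z => by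
    rw [← Fintype.card_eq, Fintype.card_subtype, Fintype.card_subtype, h]
  refine ⟨Equiv.ofFiberEquiv fun z => (e z).some, fun k => ?_⟩
  exact (Equiv.ofFiberEquiv_map (fun z => (e z).some) k).symm

section

variable {r : ℝ}

lemma closedAnnulus_subset_closure (hr : 0 < r) (hr1 : r < 1) :
    {z : ℂ | r ≤ ‖z‖ ∧ ‖z‖ ≤ 1} ⊆ closure (annulus r) := by
  intro z hz
  have hz0 : 0 < ‖z‖ := hr.trans_le hz.1
  have h1 : ‖z‖ ∈ closure (Set.Ioo r 1) := by
    rw [closure_Ioo hr1.ne]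
    exact hz
  have h2 := map_mem_closure (f := fun ρ : ℝ => (ρ : ℂ) * (z / ‖z‖)) (by fun_prop) h1
    (t := annulus r) fun ρ hρ => by
      have : ‖(ρ : ℂ) * (z / ‖z‖)‖ = ρ := by
        rw [norm_mul, norm_div, Complex.norm_real, Complex.norm_real,
          Real.norm_of_nonneg (hr.trans hρ.1).le, norm_norm, div_self hz0.ne', mul_one]
      simp only [annulus, Set.mem_ofPred_eq, this]
      exact hρ
  have h3 : ((‖z‖ : ℝ) : ℂ) * (z / ‖z‖) = z := by
    have : ((‖z‖ : ℝ) : ℂ) ≠ 0 := by exact_mod_cast hz0.ne'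
    field_simp
  simpa only [h3] using h2

lemma eqOn_closedAnnulus (hr : 0 < r) (hr1 : r < 1) {f g : ℂ → ℂ} {S : Set ℂ}
    (hAS : annulus r ⊆ S) (hS : S ⊆ {z | r ≤ ‖z‖ ∧ ‖z‖ ≤ 1}) (hf : ContinuousOn f S)
    (hg : ContinuousOn g S) (h : Set.EqOn f g (annulus r)) : Set.EqOn f g S :=
  h.of_subset_closure hf hg hAS (hS.trans (closedAnnulus_subset_closure hr hr1))

lemma frequently_ne_zero_of_tendsto (hr : 0 < r) (hr1 : r < 1) {f : ℂ → ℂ}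
    (hf : DifferentiableOn ℂ f (annulus r))
    (hlim : Filter.Tendsto (fun z => ‖f z‖) (annulusEnds r) (nhds 1)) {z : ℂ}
    (hz : z ∈ annulus r) : ∃ᶠ w in nhdsWithin z {z}ᶜ, f w ≠ 0 := by
  by_contra hcon
  have h0 := (hf.analyticOnNhd (isOpen_annulus r)).eqOn_zero_of_preconnected_of_frequently_eq_zero
    (isPreconnected_annulus hr) hz
    ((Filter.not_frequently.1 hcon).mono fun w hw => not_not.1 hw).frequently
  have := annulusEnds_neBot hr
  have h1 : Filter.Tendsto (fun z => ‖f z‖) (annulusEnds r) (nhds 0) := by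
    refine tendsto_const_nhds.congr' ((eventually_mem_annulus hr1).mono fun w hw => ?_)
    simp [h0 hw]
  exact zero_ne_one (tendsto_nhds_unique h1 hlim)

/-- The zeros of a holomorphic function on the annulus whose modulus tends to `1` at the boundary
form a finite divisor. -/
lemma exists_zero_list (hr : 0 < r) (hr1 : r < 1) {f : ℂ → ℂ}
    (hf : DifferentiableOn ℂ f (annulus r))
    (hlim : Filter.Tendsto (fun z => ‖f z‖) (annulusEnds r) (nhds 1)) :
    ∃ (n : ℕ) (p : Fin n → ℂ), (∀ k, p k ∈ annulus r) ∧ ∀ z ∈ annulus r,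
      analyticOrderAt f z = ((Finset.univ.filter fun k => p k = z).card : ℕ∞) := by
  classical
  have han := hf.analyticOnNhd (isOpen_annulus r)
  have hne : ∀ z ∈ annulus r, analyticOrderAt f z ≠ ⊤ := by
    intro z hz htop
    refine frequently_ne_zero_of_tendsto hr hr1 hf hlim hz ?_
    exact ((analyticOrderAt_eq_top.1 htop).filter_mono nhdsWithin_le_nhds).mono
      fun w hw => not_not.2 hw
  obtain ⟨a, b, ha, hb, hab⟩ := exists_of_eventually_annulusEnds
    (hlim.eventually (lt_mem_nhds one_pos))
  have hfin : (annulus r ∩ {z | f z = 0}).Finite := by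
    by_contra hinf
    obtain ⟨x, hxK, hx⟩ := Set.Infinite.exists_accPt_of_subset_isCompact hinf
      (isCompact_closedAnnulus a b) fun z hz => hab z hz.1 (by simp [show f z = 0 from hz.2])
    have hxA := closedAnnulus_subset_annulus ha hb hxK
    have h0 := han.eqOn_zero_of_preconnected_of_frequently_eq_zero
      (isPreconnected_annulus hr) hxA ((accPt_iff_frequently_nhdsNE.1 hx).mono fun w hw => hw.2)
    refine hne x hxA (analyticOrderAt_eq_top.2 ?_)
    filter_upwards [(isOpen_annulus r).mem_nhds hxA] with w hw using h0 hw
  obtain ⟨p, hpZ, hp⟩ := exists_list_of_multiplicity hfin.toFinset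
    (fun z => if z ∈ annulus r then analyticOrderNatAt f z else 0) (fun z hz => by
      rw [Set.Finite.mem_toFinset] at hz
      split_ifs with hA
      · have : analyticOrderAt f z = 0 :=
          (han z hA).analyticOrderAt_eq_zero.2 fun h => hz ⟨hA, h⟩
        rw [analyticOrderNatAt, this]
        rfl
      · rfl)
  refine ⟨_, p, fun k => ?_, fun z hz => ?_⟩
  · have := hpZ k
    rw [Set.Finite.mem_toFinset] at this
    exact this.1
  · rw [hp z, if_pos hz, Nat.cast_analyticOrderNatAt (hne z hz)]

lemma one_sub_conj_mul_ne_zero {w ζ : ℂ} (hw : ‖w‖ < 1) (hζ : ‖ζ‖ ≤ 1) :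
    1 - starRingEnd ℂ w * ζ ≠ 0 := by
  intro h
  have h1 : ‖starRingEnd ℂ w * ζ‖ = 1 := by rw [← sub_eq_zero.1 h, norm_one]
  rw [norm_mul, RCLike.norm_conj] at h1
  nlinarith [norm_nonneg w, norm_nonneg ζ]

lemma norm_moebius_of_norm_eq_one {w ζ : ℂ} (hw : ‖w‖ < 1) (hζ : ‖ζ‖ = 1) :
    ‖(ζ - w) / (1 - starRingEnd ℂ w * ζ)‖ = 1 := by
  have h0 : ζ ≠ 0 := norm_pos_iff.1 (by rw [hζ]; exact one_pos)
  have h1 := one_sub_conj_mul_ne_zero hw hζ.le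
  have h2 : starRingEnd ℂ ζ = 1 / ζ := by
    rw [eq_div_iff h0, mul_comm, Complex.mul_conj', hζ]
    simp
  rw [norm_div, div_eq_one_iff_eq (norm_ne_zero_iff.2 h1)]
  have : starRingEnd ℂ (ζ - w) = (1 - starRingEnd ℂ w * ζ) * starRingEnd ℂ ζ := by
    rw [map_sub, h2]
    field_simp
  rw [← RCLike.norm_conj, this, norm_mul, RCLike.norm_conj, hζ, mul_one]

/-- All values of the disk are taken equally often. Composition with a Möbius transformation moves
`w` to `0` and preserves the winding numbers on the boundary circles, and their sum is the number
of zeros. -/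
theorem exists_preimage_list (hr : 0 < r) (hr1 : r < 1) {f : ℂ → ℂ}
    (hf : DifferentiableOn ℂ f (annulus r)) (hf1 : ∀ z ∈ annulus r, ‖f z‖ < 1)
    (hlim : Filter.Tendsto (fun z => ‖f z‖) (annulusEnds r) (nhds 1)) {e : ℕ} {p : Fin e → ℂ}
    (hp : ∀ k, p k ∈ annulus r) (hord : ∀ z ∈ annulus r,
      analyticOrderAt f z = ((Finset.univ.filter fun k => p k = z).card : ℕ∞))
    {w : ℂ} (hw : ‖w‖ < 1) :
    ∃ q : Fin e → ℂ, (∀ k, q k ∈ annulus r) ∧ ∀ z ∈ annulus r,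
      analyticOrderAt (fun ζ => f ζ - w) z =
        ((Finset.univ.filter fun k => q k = z).card : ℕ∞) := by
  have hden : ∀ z ∈ annulus r, 1 - starRingEnd ℂ w * f z ≠ 0 := fun z hz =>
    one_sub_conj_mul_ne_zero hw (hf1 z hz).le
  have hg : DifferentiableOn ℂ (fun z => (f z - w) / (1 - starRingEnd ℂ w * f z)) (annulus r) :=
    (hf.sub_const w).div ((hf.const_mul _).const_sub 1) hden
  obtain ⟨d, hd, c, hc, hfc⟩ := exists_eq_monomial_mul_annThetaProd hr hr1 hp hf hlim hord
  have hc0 : c ≠ 0 := norm_pos_iff.1 (by rw [hc]; exact one_pos)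
  set G : ℂ → ℂ := fun z => c * z ^ (-d) * annThetaProd r p z with hG
  have hGc : ContinuousOn G {z | r ≤ ‖z‖ ∧ ‖z‖ ≤ 1} :=
    continuousOn_monomial_mul_annThetaProd hr hr1 hp c d
  have hGr : ∀ z, ‖z‖ = r → ‖G z‖ = 1 := by
    intro z hz
    rw [hG, norm_mul, norm_mul, hc, norm_zpow, hz, norm_annThetaProd_inner (fun k =>
      thetaDom_of_mem_annulus hr hr1 (hp k) hz.ge (hz.le.trans hr1.le)) hz, hd, one_mul,
      zpow_neg, inv_mul_cancel₀ (zpow_ne_zero _ hr.ne')]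
  have hG1 : ∀ z, ‖z‖ = 1 → ‖G z‖ = 1 := by
    intro z hz
    rw [hG, norm_mul, norm_mul, hc, norm_zpow, hz, norm_annThetaProd_outer (fun k =>
      thetaDom_of_mem_annulus hr hr1 (hp k) (hr1.le.trans hz.ge) hz.le) hz, one_zpow]
    norm_num
  have hGle : ∀ z ∈ {z : ℂ | r ≤ ‖z‖ ∧ ‖z‖ ≤ 1}, ‖G z‖ ≤ 1 := by
    intro z hz
    rcases eq_or_lt_of_le hz.1 with h | h
    · exact (hGr z h.symm).le
    rcases eq_or_lt_of_le hz.2 with h' | h'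
    · exact (hG1 z h').le
    have hGf : G z = f z := (hfc z ⟨h, h'⟩).symm
    rw [hGf]
    exact (hf1 z ⟨h, h'⟩).le
  set M : ℂ → ℂ := fun z => (G z - w) / (1 - starRingEnd ℂ w * G z) with hM
  have hMc : ContinuousOn M {z | r ≤ ‖z‖ ∧ ‖z‖ ≤ 1} :=
    (hGc.sub continuousOn_const).div (continuousOn_const.sub (continuousOn_const.mul hGc))
      fun z hz => one_sub_conj_mul_ne_zero hw (hGle z hz)
  have hMf : ∀ z ∈ annulus r, (f z - w) / (1 - starRingEnd ℂ w * f z) = M z := fun z hz => by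
    rw [hM, hfc z hz]
  have hglim : Filter.Tendsto (fun z => ‖(f z - w) / (1 - starRingEnd ℂ w * f z)‖)
      (annulusEnds r) (nhds 1) := by
    refine (tendsto_annulusEnds_of_continuousOn hr1 hMc.norm (fun z hz => ?_)
      fun z hz => ?_).congr' ((eventually_mem_annulus hr1).mono fun z hz => by simp only [hMf z hz])
    · exact norm_moebius_of_norm_eq_one hw (hGr z hz)
    · exact norm_moebius_of_norm_eq_one hw (hG1 z hz)
  obtain ⟨n, q, hq, hqord⟩ := exists_zero_list hr hr1 hg hglim
  obtain ⟨d', hd', c', hc', hgc⟩ := exists_eq_monomial_mul_annThetaProd hr hr1 hq hg hglim hqord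
  have hc0' : c' ≠ 0 := norm_pos_iff.1 (by rw [hc']; exact one_pos)
  have hEq : Set.EqOn M (fun z => c' * z ^ (-d') * annThetaProd r q z)
      {z | r ≤ ‖z‖ ∧ ‖z‖ ≤ 1} :=
    eqOn_closedAnnulus hr hr1 annulus_subset_closedAnnulus subset_rfl hMc
      (continuousOn_monomial_mul_annThetaProd hr hr1 hq c' d')
      fun z hz => by rw [← hMf z hz, hgc z hz]
  have hin : -d = -d' := by
    refine ((hasWinding_annThetaProd_inner hr hr1 hp hc0 d).moebius
      (fun t => hGr _ (norm_circleParam hr t)) hw).unique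
      ((hasWinding_annThetaProd_inner hr hr1 hq hc0' d').congr fun t => ?_)
    exact hEq ⟨(norm_circleParam hr t).ge, (norm_circleParam hr t).le.trans hr1.le⟩
  have hout : -d + e = -d' + n := by
    refine ((hasWinding_annThetaProd_outer hr hr1 hp hc0 d).moebius
      (fun t => hG1 _ (norm_circleParam one_pos t)) hw).unique
      ((hasWinding_annThetaProd_outer hr hr1 hq hc0' d').congr fun t => ?_)
    exact hEq ⟨hr1.le.trans (norm_circleParam one_pos t).ge, (norm_circleParam one_pos t).le⟩
  have hen : n = e := by omega
  subst hen
  refine ⟨q, hq, fun z hz => ?_⟩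
  rw [← hqord z hz]
  have hfz := hf.analyticAt ((isOpen_annulus r).mem_nhds hz)
  have h1 : AnalyticAt ℂ (fun z => (1 - starRingEnd ℂ w * f z)⁻¹) z := by
    have : AnalyticAt ℂ (fun z => 1 - starRingEnd ℂ w * f z) z := by fun_prop
    exact this.inv (hden z hz)
  have h2 : AnalyticAt ℂ (fun z => f z - w) z := by fun_prop
  have h3 := analyticOrderAt_mul h2 h1
  rw [h1.analyticOrderAt_eq_zero.2 (inv_ne_zero (hden z hz)), add_zero] at h3
  rw [← h3]
  rfl

end

/-! ### The product formula -/

lemma one_sub_mul_pow_ne_zero {q x : ℂ} (hq : ‖q‖ < 1) (hx : ‖x‖ < 1) (i : ℕ) :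
    1 - x * q ^ i ≠ 0 := by
  intro h
  have h1 : ‖x * q ^ i‖ = 1 := by rw [← sub_eq_zero.1 h, norm_one]
  have h2 : ‖x * q ^ i‖ ≤ ‖x‖ := by
    rw [norm_mul, norm_pow]
    exact mul_le_of_le_one_right (norm_nonneg _) (pow_le_one₀ (norm_nonneg _) hq.le)
  linarith

/-- The `i`-th factor in the product representation of `(1 - p̄ z) * annThetaUnit r p z`. -/
noncomputable def thetaFactor (r : ℝ) (p z : ℂ) (i : ℕ) : ℂ :=
  (1 - (r : ℂ) ^ 2 * (z / p) * ((r : ℂ) ^ 2) ^ i) * (1 - (r : ℂ) ^ 2 * p / z * ((r : ℂ) ^ 2) ^ i) /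
    ((1 - (r : ℂ) ^ 2 * (starRingEnd ℂ p * z) * ((r : ℂ) ^ 2) ^ i) *
      (1 - (r : ℂ) ^ 2 / (starRingEnd ℂ p * z) * ((r : ℂ) ^ 2) ^ i))

section

variable {r : ℝ} {p z : ℂ}

lemma ThetaDom.norm_mul_conj_mul_lt (h : ThetaDom r p z) :
    ‖(r : ℂ) ^ 2 * (starRingEnd ℂ p * z)‖ < 1 := by
  rw [norm_mul]
  exact mul_lt_one_of_nonneg_of_lt_one_left (norm_nonneg _) h.norm_q_lt h.norm_conj_mul_lt.le

lemma ThetaDom.hasProd_thetaFactor (h : ThetaDom r p z) :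
    HasProd (thetaFactor r p z) ((1 - starRingEnd ℂ p * z) * annThetaUnit r p z) := by
  have hq := h.norm_q_lt
  have h3 := qProd_ne_zero hq h.norm_mul_conj_mul_lt
  have h4 := qProd_ne_zero hq h.norm_div_conj_mul_lt
  have hP := ((hasProd_qProd hq ((r : ℂ) ^ 2 * (z / p))).mul
    (hasProd_qProd hq ((r : ℂ) ^ 2 * p / z))).mul
    (((hasProd_qProd hq ((r : ℂ) ^ 2 * (starRingEnd ℂ p * z))).mul
      (hasProd_qProd hq ((r : ℂ) ^ 2 / (starRingEnd ℂ p * z)))).inv₀ (mul_ne_zero h3 h4))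
  have h5 : 1 - starRingEnd ℂ p * z ≠ 0 := by
    simpa using one_sub_mul_pow_ne_zero hq h.norm_conj_mul_lt 0
  convert hP using 1
  · funext i
    rw [thetaFactor, div_eq_mul_inv]
  · rw [annThetaUnit, qProd_eq hq (starRingEnd ℂ p * z)]
    field_simp

/-- The symmetric pair of Blaschke factors with parameters `ρ` and `ρ⁻¹`; here `a = p` and
`b = p̄`. -/
lemma blaschke_pair_identity {a b ρ z : ℂ} (ha : a ≠ 0) (hb : b ≠ 0) (hρ : ρ ≠ 0) (hz : z ≠ 0)
    (h1 : 1 - a * ρ ≠ 0) (h2 : 1 - ρ / a ≠ 0) (h3 : 1 - b * ρ * z ≠ 0) (h4 : 1 - ρ / (b * z) ≠ 0)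
    (h5 : 1 - b * ρ ≠ 0) (h6 : 1 - ρ / b ≠ 0) :
    ((1 - b * ρ) / (1 - a * ρ) * ((z - a * ρ) / (1 - b * ρ * z))) *
      ((1 - b * ρ⁻¹) / (1 - a * ρ⁻¹) * ((z - a * ρ⁻¹) / (1 - b * ρ⁻¹ * z))) =
    ((1 - ρ * (z / a)) * (1 - ρ * a / z) / ((1 - b * ρ * z) * (1 - ρ / (b * z)))) /
      ((1 - ρ / a) * (1 - a * ρ) / ((1 - b * ρ) * (1 - ρ / b))) := by
  have e1 : 1 - b * ρ⁻¹ = -(b / ρ) * (1 - ρ / b) := by field_simp; ring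
  have e2 : 1 - a * ρ⁻¹ = -(a / ρ) * (1 - ρ / a) := by field_simp; ring
  have e3 : 1 - b * ρ⁻¹ * z = -(b * z / ρ) * (1 - ρ / (b * z)) := by field_simp; ring
  have e4 : z - a * ρ⁻¹ = -(a / ρ) * (1 - ρ * (z / a)) := by field_simp; ring
  have e5 : z - a * ρ = z * (1 - ρ * a / z) := by field_simp
  rw [e1, e2, e3, e4, e5]
  generalize 1 - ρ * (z / a) = A at *
  generalize 1 - ρ * a / z = B at *
  generalize 1 - ρ / (b * z) = C at *
  generalize 1 - ρ / b = D at *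
  generalize 1 - ρ / a = E at *
  generalize 1 - b * ρ * z = F at *
  generalize 1 - b * ρ = G at *
  generalize 1 - a * ρ = H at *
  field_simp

lemma pairedFactor_eq_prod {n : ℕ} {p : Fin n → ℂ} (h : ∀ k, ThetaDom r (p k) z)
    (h1 : ∀ k, ThetaDom r (p k) 1) (i : ℕ) :
    pairedFactor r p z i = ∏ k, thetaFactor r (p k) z i / thetaFactor r (p k) 1 i := by
  simp only [pairedFactor, blaschkeFactor, ← Finset.prod_mul_distrib]
  refine Finset.prod_congr rfl fun k _ => ?_
  have hq := (h k).norm_q_lt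
  have hp := (h k).p_ne_zero
  have hp' : starRingEnd ℂ (p k) ≠ 0 := (map_ne_zero _).2 hp
  have hr : (r : ℂ) ≠ 0 := by exact_mod_cast (h k).r_pos.ne'
  have hρ1 : (r : ℂ) ^ (2 * ((i : ℤ) + 1)) = (r : ℂ) ^ 2 * ((r : ℂ) ^ 2) ^ i := by
    rw [zpow_mul, zpow_add₀ (zpow_ne_zero _ hr), zpow_one, zpow_natCast, mul_comm]
    norm_cast
  have hρ2 : (r : ℂ) ^ (2 * (-((i : ℤ) + 1))) = ((r : ℂ) ^ 2 * ((r : ℂ) ^ 2) ^ i)⁻¹ := by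
    rw [mul_neg, zpow_neg, hρ1]
  have hρ0 : (r : ℂ) ^ 2 * ((r : ℂ) ^ 2) ^ i ≠ 0 := by positivity
  have a1 := one_sub_mul_pow_ne_zero hq (h1 k).norm_mul_div_lt i
  have a2 := one_sub_mul_pow_ne_zero hq (h1 k).norm_mul_div_lt' i
  have a3 := one_sub_mul_pow_ne_zero hq (h k).norm_mul_conj_mul_lt i
  have a4 := one_sub_mul_pow_ne_zero hq (h k).norm_div_conj_mul_lt i
  have a5 := one_sub_mul_pow_ne_zero hq (h1 k).norm_mul_conj_mul_lt i
  have a6 := one_sub_mul_pow_ne_zero hq (h1 k).norm_div_conj_mul_lt i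
  rw [hρ1, hρ2]
  have key := blaschke_pair_identity (ρ := (r : ℂ) ^ 2 * ((r : ℂ) ^ 2) ^ i) hp hp' hρ0
    (h k).z_ne_zero
    (by convert a1 using 1; ring) (by convert a2 using 1; ring) (by convert a3 using 1; ring)
    (by convert a4 using 1; ring) (by convert a5 using 1; ring)
    (by convert a6 using 1; ring)
  refine key.trans ?_
  simp only [thetaFactor]
  congr 1
  · congr 1
    · ring
    · ring
  · congr 1
    · ring
    · ring

lemma hasProd_pairedFactor {n : ℕ} {p : Fin n → ℂ} (h : ∀ k, ThetaDom r (p k) z)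
    (h1 : ∀ k, ThetaDom r (p k) 1) :
    HasProd (pairedFactor r p z) (∏ k, ((1 - starRingEnd ℂ (p k) * z) * annThetaUnit r (p k) z) /
      ((1 - starRingEnd ℂ (p k) * 1) * annThetaUnit r (p k) 1)) := by
  rw [funext (pairedFactor_eq_prod h h1)]
  refine hasProd_prod fun k _ => ?_
  simp only [div_eq_mul_inv]
  refine (h k).hasProd_thetaFactor.mul ((h1 k).hasProd_thetaFactor.inv₀ ?_)
  refine mul_ne_zero ?_ (h1 k).annThetaUnit_ne_zero
  simpa using one_sub_mul_pow_ne_zero (h1 k).norm_q_lt (h1 k).norm_conj_mul_lt 0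

lemma annulusBlaschke_eq {n : ℕ} {p : Fin n → ℂ} (h : ∀ k, ThetaDom r (p k) z)
    (h1 : ∀ k, ThetaDom r (p k) 1) (hp1 : ∀ k, p k ≠ 1) (δ : ℕ) :
    annulusBlaschke r δ p z =
      (annThetaProd r p 1)⁻¹ * z ^ (-(δ : ℤ)) * annThetaProd r p z := by
  rw [annulusBlaschke, (hasProd_pairedFactor h h1).tprod_eq]
  have : blaschkeFactor r p 0 z * (∏ k, ((1 - starRingEnd ℂ (p k) * z) * annThetaUnit r (p k) z) /
      ((1 - starRingEnd ℂ (p k) * 1) * annThetaUnit r (p k) 1)) =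
      (annThetaProd r p 1)⁻¹ * annThetaProd r p z := by
    simp only [blaschkeFactor, annThetaProd, ← Finset.prod_mul_distrib, ← Finset.prod_inv_distrib]
    refine Finset.prod_congr rfl fun k _ => ?_
    have e1 := (h1 k).annThetaUnit_ne_zero
    have e2 : 1 - starRingEnd ℂ (p k) * z ≠ 0 := by
      simpa using one_sub_mul_pow_ne_zero (h k).norm_q_lt (h k).norm_conj_mul_lt 0
    have e3 : 1 - starRingEnd ℂ (p k) ≠ 0 := by
      simpa using one_sub_mul_pow_ne_zero (h1 k).norm_q_lt (h1 k).norm_conj_mul_lt 0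
    have e4 : 1 - p k ≠ 0 := sub_ne_zero.2 (hp1 k).symm
    have e5 : p k - 1 ≠ 0 := sub_ne_zero.2 (hp1 k)
    rw [(h k).annTheta_eq, (h1 k).annTheta_eq]
    simp only [mul_zero, zpow_zero, mul_one]
    field_simp
    ring
  rw [mul_assoc, this]
  ring

end

/-! ### Proper maps of the annulus onto the disk -/

section

variable {r : ℝ}

lemma annulusExt_apply (f : annulus r → disk) (z : annulus r) : annulusExt f z = f z :=
  Subtype.val_injective.extend_apply _ _ z

lemma annulusExt_eq (f : annulus r → disk) {z : ℂ} (hz : z ∈ annulus r) :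
    annulusExt f z = f ⟨z, hz⟩ :=
  annulusExt_apply f ⟨z, hz⟩

lemma norm_annulusExt_lt_one (f : annulus r → disk) {z : ℂ} (hz : z ∈ annulus r) :
    ‖annulusExt f z‖ < 1 := by
  rw [annulusExt_eq f hz]
  exact mem_ball_zero_iff.1 (f ⟨z, hz⟩).2

lemma IsProperHolomorphic.tendsto_norm (hr1 : r < 1) {f : annulus r → disk}
    (hf : IsProperHolomorphic f) :
    Filter.Tendsto (fun z => ‖annulusExt f z‖) (annulusEnds r) (nhds 1) := by
  refine tendsto_order.2 ⟨fun c hc => ?_, fun c hc => ?_⟩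
  · have hK : IsCompact {w : disk | ‖(w : ℂ)‖ ≤ c} := by
      rw [Subtype.isCompact_iff]
      have : ((↑) : disk → ℂ) '' {w : disk | ‖(w : ℂ)‖ ≤ c} = Metric.closedBall 0 c := by
        ext w
        simp only [Set.mem_image, mem_closedBall_zero_iff]
        constructor
        · rintro ⟨w, hw, rfl⟩
          exact hw
        · exact fun hw => ⟨⟨w, by simpa using hw.trans_lt hc⟩, hw, rfl⟩
      rw [this]
      exact isCompact_closedBall _ _
    have hK' := (hf.proper.isCompact_preimage hK).image
      (continuous_norm.comp (continuous_subtype_val (p := fun z => z ∈ annulus r)))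
    have hN := hK'.isClosed.isOpen_compl
    have hsub : ∀ ρ, ¬ (r < ρ ∧ ρ < 1) → ρ ∈ ((norm ∘ Subtype.val) ''
        (f ⁻¹' {w : disk | ‖(w : ℂ)‖ ≤ c}))ᶜ := by
      rintro ρ hρ ⟨z, -, rfl⟩
      exact hρ z.2
    have hmem : ((norm ∘ Subtype.val) '' (f ⁻¹' {w : disk | ‖(w : ℂ)‖ ≤ c}))ᶜ ∈
        nhdsWithin r (Set.Ioi r) ⊔ nhdsWithin 1 (Set.Iio 1) := Filter.mem_sup.2
      ⟨mem_nhdsWithin_of_mem_nhds (hN.mem_nhds (hsub r fun h => h.1.false)),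
      mem_nhdsWithin_of_mem_nhds (hN.mem_nhds (hsub 1 fun h => h.2.false))⟩
    filter_upwards [eventually_mem_annulus hr1, Filter.preimage_mem_comap hmem] with z hz hz'
    by_contra! hle
    refine hz' ⟨⟨z, hz⟩, ?_, rfl⟩
    rw [annulusExt_eq f hz] at hle
    exact hle
  · filter_upwards [eventually_mem_annulus hr1] with z hz
    exact (norm_annulusExt_lt_one f hz).trans hc

lemma isProperHolomorphic_of_tendsto {f : annulus r → disk}
    (hf : DifferentiableOn ℂ (annulusExt f) (annulus r))
    (hlim : Filter.Tendsto (fun z => ‖annulusExt f z‖) (annulusEnds r) (nhds 1)) :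
    IsProperHolomorphic f := by
  refine ⟨?_, hf⟩
  have hc : Continuous f := by
    rw [Topology.IsInducing.subtypeVal.continuous_iff]
    have := continuousOn_iff_continuous_domRestrict.1 hf.continuousOn
    exact this.congr fun z => annulusExt_apply f z
  have : LocallyCompactSpace disk := Metric.isOpen_ball.locallyCompactSpace
  rw [isProperMap_iff_isCompact_preimage]
  refine ⟨hc, fun K hK => ?_⟩
  have hlt : ∃ c < 1, ∀ w ∈ K, ‖(w : ℂ)‖ ≤ c := by
    rcases K.eq_empty_or_nonempty with rfl | hne
    · exact ⟨0, one_pos, by simp⟩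
    · obtain ⟨w, -, hw⟩ := hK.exists_isMaxOn hne
        (continuous_norm.comp (continuous_subtype_val (p := fun z => z ∈ disk))).continuousOn
      exact ⟨‖(w : ℂ)‖, mem_ball_zero_iff.1 w.2, fun v hv => hw hv⟩
  obtain ⟨c, hc1, hcK⟩ := hlt
  obtain ⟨a, b, ha, hb, hab⟩ := exists_of_eventually_annulusEnds
    (hlim.eventually (lt_mem_nhds hc1))
  have hcomp : IsCompact {z : annulus r | a ≤ ‖(z : ℂ)‖ ∧ ‖(z : ℂ)‖ ≤ b} := by
    rw [Subtype.isCompact_iff]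
    have : ((↑) : annulus r → ℂ) '' {z : annulus r | a ≤ ‖(z : ℂ)‖ ∧ ‖(z : ℂ)‖ ≤ b} =
        {z : ℂ | a ≤ ‖z‖ ∧ ‖z‖ ≤ b} := by
      ext z
      constructor
      · rintro ⟨z, hz, rfl⟩
        exact hz
      · exact fun hz => ⟨⟨z, closedAnnulus_subset_annulus ha hb hz⟩, hz, rfl⟩
    rw [this]
    exact isCompact_closedAnnulus a b
  refine hcomp.of_isClosed_subset (hK.isClosed.preimage hc) fun z hz => ?_
  refine hab z z.2 ?_
  rw [annulusExt_apply]
  exact not_lt.2 (hcK _ hz)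

/-- Boundary behaviour makes `d` the degree on the inner boundary circle. -/
lemma eq_of_hasInnerDegree (hr : 0 < r) (hr1 : r < 1) {n : ℕ} {p : Fin n → ℂ}
    (hp : ∀ k, p k ∈ annulus r) {f : annulus r → disk} {δ : ℕ} (hδ : HasInnerDegree f δ) {c : ℂ}
    (hc : c ≠ 0) {d : ℤ}
    (hf : ∀ z ∈ annulus r, annulusExt f z = c * z ^ (-d) * annThetaProd r p z) : d = δ := by
  obtain ⟨F, hF, hFf, θ, hθ, hFθ, hθp⟩ := hδ
  have hEq : Set.EqOn F (fun z => c * z ^ (-d) * annThetaProd r p z)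
      {z | r ≤ ‖z‖ ∧ ‖z‖ < 1} := by
    refine eqOn_closedAnnulus hr hr1 (fun z hz => ⟨hz.1.le, hz.2⟩) (fun z hz => ⟨hz.1, hz.2.le⟩)
      hF ((continuousOn_monomial_mul_annThetaProd hr hr1 hp c d).mono
      fun z hz => ⟨hz.1, hz.2.le⟩) fun z hz => ?_
    rw [hFf ⟨z, hz⟩, ← annulusExt_eq f hz, hf z hz]
  have w1 := (hasWinding_annThetaProd_inner hr hr1 hp hc d).comp_neg
  have w2 : HasWinding (fun t : ℝ => F (r * Complex.exp (-(t * Complex.I)))) δ := by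
    refine ⟨fun t => (θ t - δ * t) * Complex.I, by fun_prop, fun t => ?_, fun t => ?_⟩
    · beta_reduce
      rw [hθp]
      push_cast
      ring
    · beta_reduce
      rw [hFθ]
      congr 1
      push_cast
      ring
  have w3 := w1.congr (v := fun t : ℝ => F (r * Complex.exp (-(t * Complex.I)))) fun t => by
    have h1 := norm_circleParam hr (-t)
    have h2 := hEq (x := r * Complex.exp ((-t : ℝ) * Complex.I)) ⟨h1.ge, h1.le.trans_lt hr1⟩
    simpa using h2
  have := w3.unique w2
  omega

/-- The structure of proper holomorphic maps with given zeros and inner degree. -/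
lemma IsProperHolomorphic.exists_eq (hr : 0 < r) (hr1 : r < 1) {n : ℕ} {p : Fin n → ℂ}
    (hp : ∀ k, p k ∈ annulus r) {f : annulus r → disk} (hf : IsProperHolomorphic f)
    (hz : HasZeroDivisor f p) {δ : ℕ} (hδ : HasInnerDegree f δ) :
    ‖∏ k, p k‖ = r ^ δ ∧ ∃ c : ℂ, ‖c‖ = 1 ∧
      ∀ z ∈ annulus r, annulusExt f z = c * z ^ (-(δ : ℤ)) * annThetaProd r p z := by
  obtain ⟨d, hd, c, hc, hfc⟩ := exists_eq_monomial_mul_annThetaProd hr hr1 hp hf.holomorphic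
    (hf.tendsto_norm hr1) hz
  have hdδ := eq_of_hasInnerDegree hr hr1 hp hδ
    (norm_pos_iff.1 (by rw [hc]; exact one_pos)) hfc
  subst hdδ
  exact ⟨by simpa using hd, c, hc, hfc⟩

end

lemma ne_one_of_mem_annulus {r : ℝ} {z : ℂ} (hz : z ∈ annulus r) : z ≠ 1 := fun h => by
  have := hz.2
  rw [h, norm_one] at this
  exact this.false

/-! ### The normalized map with given zeros -/

/-- The function `z ^ (-δ) ∏ θ_{p_k}(z) / θ_{p_k}(1)`, which has the value `1` at `1`. -/
noncomputable def normalizedMap (r : ℝ) {n : ℕ} (δ : ℕ) (p : Fin n → ℂ) (z : ℂ) : ℂ :=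
  (annThetaProd r p 1)⁻¹ * z ^ (-(δ : ℤ)) * annThetaProd r p z

section

variable {r : ℝ} {n : ℕ} {p : Fin n → ℂ} (hr : 0 < r) (hr1 : r < 1) (hp : ∀ k, p k ∈ annulus r)
include hr hr1 hp

lemma thetaDom_one (k : Fin n) : ThetaDom r (p k) 1 :=
  thetaDom_of_mem_annulus hr hr1 (hp k) (by simpa using hr1.le) (by simp)

lemma annThetaProd_one_ne_zero : annThetaProd r p 1 ≠ 0 :=
  annThetaProd_ne_zero (thetaDom_one hr hr1 hp) (fun k => ne_one_of_mem_annulus (hp k))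

lemma norm_annThetaProd_one : ‖(annThetaProd r p 1)⁻¹‖ = 1 := by
  rw [norm_inv, norm_annThetaProd_outer (thetaDom_one hr hr1 hp) norm_one, inv_one]

lemma normalizedMap_one (δ : ℕ) : normalizedMap r δ p 1 = 1 := by
  rw [normalizedMap, one_zpow, mul_one, inv_mul_cancel₀ (annThetaProd_one_ne_zero hr hr1 hp)]

lemma annulusBlaschke_eq_normalizedMap (δ : ℕ) {z : ℂ} (hz : z ∈ annulus r) :
    annulusBlaschke r δ p z = normalizedMap r δ p z :=
  annulusBlaschke_eq (fun k => thetaDom_of_mem_annulus hr hr1 (hp k) hz.1.le hz.2.le)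
    (thetaDom_one hr hr1 hp) (fun k => ne_one_of_mem_annulus (hp k)) δ

lemma continuousOn_normalizedMap (δ : ℕ) :
    ContinuousOn (normalizedMap r δ p) {z | r ≤ ‖z‖ ∧ ‖z‖ ≤ 1} :=
  continuousOn_monomial_mul_annThetaProd hr hr1 hp _ _

lemma analyticOrderAt_normalizedMap (δ : ℕ) {z : ℂ} (hz : z ∈ annulus r) :
    analyticOrderAt (normalizedMap r δ p) z =
      ((Finset.univ.filter fun k => p k = z).card : ℕ∞) := by
  have hdom := fun k => thetaDom_of_mem_annulus hr hr1 (hp k) hz.1.le hz.2.le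
  have hz0 := ne_zero_of_mem_annulus hr hz
  have h1 : AnalyticAt ℂ (fun w : ℂ => (annThetaProd r p 1)⁻¹ * w ^ (-(δ : ℤ))) z :=
    analyticAt_const.mul (analyticAt_id.zpow hz0)
  have h2 : (annThetaProd r p 1)⁻¹ * z ^ (-(δ : ℤ)) ≠ 0 :=
    mul_ne_zero (inv_ne_zero (annThetaProd_one_ne_zero hr hr1 hp)) (zpow_ne_zero _ hz0)
  have h3 := analyticOrderAt_mul h1 (analyticAt_annThetaProd hdom)
  rw [h1.analyticOrderAt_eq_zero.2 h2, zero_add, analyticOrderAt_annThetaProd hdom] at h3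
  exact h3

lemma differentiableOn_normalizedMap (δ : ℕ) :
    DifferentiableOn ℂ (normalizedMap r δ p) (annulus r) := by
  intro z hz
  have hdom := fun k => thetaDom_of_mem_annulus hr hr1 (hp k) hz.1.le hz.2.le
  have hz0 := ne_zero_of_mem_annulus hr hz
  have h1 : DifferentiableAt ℂ (fun w : ℂ => (annThetaProd r p 1)⁻¹ * w ^ (-(δ : ℤ))) z :=
    (differentiableAt_zpow.2 (Or.inl hz0)).const_mul _
  exact (h1.mul (analyticAt_annThetaProd hdom).differentiableAt).differentiableWithinAt

variable {δ : ℕ} (hpr : ‖∏ k, p k‖ = r ^ δ)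
include hpr

lemma norm_normalizedMap_inner {z : ℂ} (hz : ‖z‖ = r) : ‖normalizedMap r δ p z‖ = 1 := by
  rw [normalizedMap, norm_mul, norm_mul, norm_annThetaProd_one hr hr1 hp, norm_zpow, hz,
    norm_annThetaProd_inner (fun k => thetaDom_of_mem_annulus hr hr1 (hp k) hz.ge
      (hz.le.trans hr1.le)) hz, hpr, one_mul, zpow_neg, zpow_natCast,
    inv_mul_cancel₀ (pow_ne_zero _ hr.ne')]

lemma tendsto_norm_normalizedMap :
    Filter.Tendsto (fun z => ‖normalizedMap r δ p z‖) (annulusEnds r) (nhds 1) := by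
  refine tendsto_annulusEnds_of_continuousOn hr1 (continuousOn_normalizedMap hr hr1 hp δ).norm
    (fun z hz => norm_normalizedMap_inner hr hr1 hp hpr hz) fun z hz => ?_
  rw [normalizedMap, norm_mul, norm_mul, norm_annThetaProd_one hr hr1 hp, norm_zpow, hz,
    norm_annThetaProd_outer (fun k => thetaDom_of_mem_annulus hr hr1 (hp k)
      (hr1.le.trans hz.ge) hz.le) hz, one_zpow]
  norm_num

lemma norm_normalizedMap_lt_one (hn : 0 < n) {z : ℂ} (hz : z ∈ annulus r) :
    ‖normalizedMap r δ p z‖ < 1 := by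
  have hd := differentiableOn_normalizedMap hr hr1 hp δ
  have hle : ∀ w ∈ annulus r, ‖normalizedMap r δ p w‖ ≤ 1 := by
    intro w hw
    have := norm_le_one_of_tendsto_annulusEnds hr hr1
      (v := fun ζ => normalizedMap r δ p (Complex.exp ζ))
      (m := fun z => ‖normalizedMap r δ p z‖)
      (hd.comp Complex.differentiable_exp.differentiableOn fun ζ hζ => exp_mem_annulus hr hζ)
      hd.continuousOn.norm (tendsto_norm_normalizedMap hr hr1 hp hpr) (fun _ _ => rfl)
      (log_mem_logStrip hr hw)
    rwa [Complex.exp_log (ne_zero_of_mem_annulus hr hw)] at this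
  refine lt_of_le_of_ne (hle z hz) fun h1 => ?_
  have h2 := Complex.norm_eqOn_of_isPreconnected_of_isMaxOn (isPreconnected_annulus hr)
    (isOpen_annulus r) hd hz (fun w hw => by
      simp only [Function.comp, Set.mem_ofPred_eq, h1]
      exact hle w hw) (hp ⟨0, hn⟩)
  have h3 : normalizedMap r δ p (p ⟨0, hn⟩) = 0 := by
    by_contra hne
    have h4 := analyticOrderAt_normalizedMap hr hr1 hp δ (hp ⟨0, hn⟩)
    rw [((hd.analyticAt ((isOpen_annulus r).mem_nhds (hp ⟨0, hn⟩)))).analyticOrderAt_eq_zero.2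
      hne] at h4
    have h5 := (Nat.cast_eq_zero (R := ℕ∞)).1 h4.symm
    rw [Finset.card_eq_zero, Finset.filter_eq_empty_iff] at h5
    exact h5 (Finset.mem_univ _) rfl
  simp only [Function.comp, Function.const, h1, h3, norm_zero] at h2
  exact zero_ne_one h2

end

section

variable {r : ℝ} {n δ : ℕ} {p : Fin n → ℂ}

/-- The normalized map with zeros `p_1, …, p_n` as a map from the annulus to the disk. -/
noncomputable def normalizedAnnulusMap (hr : 0 < r) (hr1 : r < 1) (hp : ∀ k, p k ∈ annulus r)
    (hpr : ‖∏ k, p k‖ = r ^ δ) (hn : 0 < n) : annulus r → disk :=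
  fun z => ⟨normalizedMap r δ p z,
    mem_ball_zero_iff.2 (norm_normalizedMap_lt_one hr hr1 hp hpr hn z.2)⟩

lemma HasZeroDivisor.hasMappingDegree (hr : 0 < r) (hr1 : r < 1) (hp : ∀ k, p k ∈ annulus r)
    {f : annulus r → disk} (hf : IsProperHolomorphic f) (hz : HasZeroDivisor f p) :
    HasMappingDegree f n := by
  classical
  intro w hw
  obtain ⟨q, hq, hqord⟩ := exists_preimage_list hr hr1 hf.holomorphic
    (fun z hz => norm_annulusExt_lt_one f hz) (hf.tendsto_norm hr1) hp hz
    (mem_ball_zero_iff.1 hw)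
  set q' : Fin n → annulus r := fun k => ⟨q k, hq k⟩ with hq'
  have h1 : ∀ z : annulus r, analyticOrderNatAt (fun ζ => annulusExt f ζ - w) (z : ℂ) =
      (Finset.univ.filter fun k => q' k = z).card := by
    intro z
    rw [analyticOrderNatAt, hqord z z.2, ENat.toNat_natCast]
    congr 1
    ext k
    simp [hq', Subtype.ext_iff]
  rw [finsum_congr h1, finsum_eq_sum_of_support_subset (s := Finset.univ.image q')]
  · have := Finset.card_eq_sum_card_image q' Finset.univ
    rw [Finset.card_univ, Fintype.card_fin] at this
    exact this.symm
  · intro z hz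
    rw [Function.mem_support, Finset.card_ne_zero] at hz
    obtain ⟨k, hk⟩ := hz
    rw [Finset.mem_filter] at hk
    simpa using ⟨k, hk.2⟩

lemma FixesOne.eq_normalizedMap (hr : 0 < r) (hr1 : r < 1) (hp : ∀ k, p k ∈ annulus r)
    {f : annulus r → disk} (hf : IsProperHolomorphic f) (hz : HasZeroDivisor f p)
    (hδ : HasInnerDegree f δ) (h1 : FixesOne f) {z : ℂ} (hzA : z ∈ annulus r) :
    annulusExt f z = normalizedMap r δ p z := by
  obtain ⟨-, c, -, hfc⟩ := hf.exists_eq hr hr1 hp hz hδ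
  have hone : (1 : ℂ) ∈ {z : ℂ | r ≤ ‖z‖ ∧ ‖z‖ ≤ 1} := ⟨by simpa using hr1.le, by simp⟩
  have : (nhdsWithin 1 (annulus r)).NeBot :=
    mem_closure_iff_nhdsWithin_neBot.1 (closedAnnulus_subset_closure hr hr1 hone)
  have h2 : Filter.Tendsto (fun z => c * z ^ (-(δ : ℤ)) * annThetaProd r p z)
      (nhdsWithin 1 (annulus r)) (nhds (c * 1 ^ (-(δ : ℤ)) * annThetaProd r p 1)) :=
    (continuousOn_monomial_mul_annThetaProd hr hr1 hp c δ 1 hone).mono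
      annulus_subset_closedAnnulus
  have h3 : Filter.Tendsto (annulusExt f) (nhdsWithin 1 (annulus r))
      (nhds (c * 1 ^ (-(δ : ℤ)) * annThetaProd r p 1)) := by
    refine h2.congr' ?_
    filter_upwards [self_mem_nhdsWithin] with w hw using (hfc w hw).symm
  have h4 := tendsto_nhds_unique h3 h1
  rw [one_zpow, mul_one] at h4
  rw [hfc z hzA, normalizedMap, ← eq_inv_of_mul_eq_one_left h4]

variable (hr : 0 < r) (hr1 : r < 1) (hp : ∀ k, p k ∈ annulus r) (hpr : ‖∏ k, p k‖ = r ^ δ)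
  (hn : 0 < n)

lemma annulusExt_normalizedAnnulusMap {z : ℂ} (hz : z ∈ annulus r) :
    annulusExt (normalizedAnnulusMap hr hr1 hp hpr hn) z = normalizedMap r δ p z :=
  annulusExt_eq _ hz

lemma isProperHolomorphic_normalizedAnnulusMap :
    IsProperHolomorphic (normalizedAnnulusMap hr hr1 hp hpr hn) := by
  refine isProperHolomorphic_of_tendsto ?_ ?_
  · exact (differentiableOn_normalizedMap hr hr1 hp δ).congr fun z hz =>
      annulusExt_normalizedAnnulusMap hr hr1 hp hpr hn hz
  · refine (tendsto_norm_normalizedMap hr hr1 hp hpr).congr' ?_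
    filter_upwards [eventually_mem_annulus hr1] with z hz
    rw [annulusExt_normalizedAnnulusMap hr hr1 hp hpr hn hz]

lemma hasZeroDivisor_normalizedAnnulusMap :
    HasZeroDivisor (normalizedAnnulusMap hr hr1 hp hpr hn) p := by
  intro z hz
  rw [← analyticOrderAt_normalizedMap hr hr1 hp δ hz]
  refine analyticOrderAt_congr ?_
  filter_upwards [(isOpen_annulus r).mem_nhds hz] with w hw
    using annulusExt_normalizedAnnulusMap hr hr1 hp hpr hn hw

lemma hasMappingDegree_normalizedAnnulusMap :
    HasMappingDegree (normalizedAnnulusMap hr hr1 hp hpr hn) n :=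
  (hasZeroDivisor_normalizedAnnulusMap hr hr1 hp hpr hn).hasMappingDegree hr hr1 hp
    (isProperHolomorphic_normalizedAnnulusMap hr hr1 hp hpr hn)

lemma hasInnerDegree_normalizedAnnulusMap :
    HasInnerDegree (normalizedAnnulusMap hr hr1 hp hpr hn) δ := by
  refine ⟨normalizedMap r δ p, (continuousOn_normalizedMap hr hr1 hp δ).mono
    fun z hz => ⟨hz.1, hz.2.le⟩, fun z => rfl, ?_⟩
  obtain ⟨L, hLc, hLp, hL⟩ := (hasWinding_annThetaProd_inner hr hr1 hp
    (inv_ne_zero (annThetaProd_one_ne_zero hr hr1 hp)) (δ : ℤ)).comp_neg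
  refine ⟨fun t => δ * t + (L t).im, by fun_prop, fun t => ?_, fun t => ?_⟩
  · have h1 : normalizedMap r δ p (r * Complex.exp (-(t * Complex.I))) =
        Complex.exp (δ * t * Complex.I + L t) := by
      have := hL t
      push_cast at this
      rw [neg_neg] at this
      rw [← this, normalizedMap, neg_mul]
    have h2 : ‖normalizedMap r δ p (r * Complex.exp (-(t * Complex.I)))‖ = 1 := by
      refine norm_normalizedMap_inner hr hr1 hp hpr ?_
      have := norm_circleParam hr (-t)
      push_cast at this
      rwa [neg_mul] at this
    rw [h1, Complex.norm_exp, Real.exp_eq_one_iff] at h2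
    have h3 : (L t).re = 0 := by simpa using h2
    rw [h1]
    congr 1
    conv_lhs => rw [← Complex.re_add_im (L t), h3]
    push_cast
    ring
  · simp only [hLp]
    ring

lemma fixesOne_normalizedAnnulusMap : FixesOne (normalizedAnnulusMap hr hr1 hp hpr hn) := by
  have h1 := continuousOn_normalizedMap hr hr1 hp δ 1 ⟨by simpa using hr1.le, by simp⟩
  have h2 := h1.mono annulus_subset_closedAnnulus
  rw [ContinuousWithinAt, normalizedMap_one hr hr1 hp] at h2
  refine h2.congr' ?_
  filter_upwards [self_mem_nhdsWithin] with w hw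
    using (annulusExt_normalizedAnnulusMap hr hr1 hp hpr hn hw).symm

end

/-- The zeros in the annulus and the exponent can be recovered from the product formula. -/
lemma eq_and_exists_perm_of_normalizedMap_eq {r : ℝ} (hr : 0 < r) (hr1 : r < 1) {n δ δ' : ℕ}
    {p q : Fin n → ℂ} (hp : ∀ k, p k ∈ annulus r) (hq : ∀ k, q k ∈ annulus r)
    (h : ∀ z ∈ annulus r, normalizedMap r δ p z = normalizedMap r δ' q z) :
    δ' = δ ∧ ∃ σ : Equiv.Perm (Fin n), ∀ k, q k = p (σ k) := by
  have hcard : ∀ z ∈ annulus r, (Finset.univ.filter fun k => p k = z).card =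
      (Finset.univ.filter fun k => q k = z).card := by
    intro z hz
    rw [← Nat.cast_inj (R := ℕ∞), ← analyticOrderAt_normalizedMap hr hr1 hp δ hz,
      ← analyticOrderAt_normalizedMap hr hr1 hq δ' hz]
    refine analyticOrderAt_congr ?_
    filter_upwards [(isOpen_annulus r).mem_nhds hz] with w hw using h w hw
  obtain ⟨σ, hσ⟩ : ∃ σ : Equiv.Perm (Fin n), ∀ k, q k = p (σ k) := by
    refine exists_perm_of_card_filter_eq fun z => ?_
    by_cases hz : z ∈ annulus r
    · exact hcard z hz
    · rw [Finset.filter_false_of_mem fun k _ (hk : p k = z) => hz (hk ▸ hp k),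
        Finset.filter_false_of_mem fun k _ (hk : q k = z) => hz (hk ▸ hq k)]
  refine ⟨?_, σ, hσ⟩
  have hprod : ∀ z, annThetaProd r q z = annThetaProd r p z := fun z => by
    simp only [annThetaProd, hσ]
    exact Equiv.prod_comp σ fun k => annTheta r (p k) z
  -- Away from the finitely many zeros, the two monomials can be compared.
  obtain ⟨z, hz, hzp⟩ : ∃ z ∈ annulus r, ∀ k, p k ≠ z := by
    have hinf : (annulus r).Infinite := by
      have hmem : (((r + 1) / 2 : ℝ) : ℂ) ∈ annulus r := by
        have : ‖(((r + 1) / 2 : ℝ) : ℂ)‖ = (r + 1) / 2 := by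
          rw [Complex.norm_real, Real.norm_of_nonneg (by linarith)]
        constructor
        · rw [this]
          linarith
        · rw [this]
          linarith
      exact infinite_of_mem_nhds _ ((isOpen_annulus r).mem_nhds hmem)
    obtain ⟨z, hz, hzp⟩ := (hinf.sdiff (Set.finite_range p)).nonempty
    exact ⟨z, hz, fun k hk => hzp ⟨k, hk⟩⟩
  have h1 := h z hz
  have h2 : annThetaProd r p z ≠ 0 := annThetaProd_ne_zero
    (fun k => thetaDom_of_mem_annulus hr hr1 (hp k) hz.1.le hz.2.le) hzp
  rw [normalizedMap, normalizedMap, hprod, hprod, mul_left_inj' h2,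
    mul_right_inj' (inv_ne_zero (annThetaProd_one_ne_zero hr hr1 hp))] at h1
  have h3 : ‖z‖ ^ δ = ‖z‖ ^ δ' := by
    have := congrArg norm h1
    rw [norm_zpow, norm_zpow, zpow_neg, zpow_neg, inv_inj] at this
    exact_mod_cast this
  exact (pow_right_injective₀ (hr.trans hz.1) hz.2.ne h3).symm

/-- Existence, uniqueness and the product formula for the maps with given zeros on a fixed annulus.
The case `δ = 0` is included. -/
theorem product_representation (e δ : ℕ) (hδe : δ < e) (r : ℝ) (hr : 0 < r) (hr1 : r < 1)
    (p : Fin e → ℂ) (hp : ∀ k, p k ∈ annulus r) :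
    ((∃ f : annulus r → disk, IsProperHolomorphic f ∧ HasMappingDegree f e ∧
        HasZeroDivisor f p ∧ HasInnerDegree f δ) ↔ ‖∏ k, p k‖ = r ^ δ) ∧
    (‖∏ k, p k‖ = r ^ δ →
      ∃! f : annulus r → disk, IsProperHolomorphic f ∧ HasMappingDegree f e ∧
        HasZeroDivisor f p ∧ HasInnerDegree f δ ∧ FixesOne f) ∧
    (∀ f : annulus r → disk, IsProperHolomorphic f → HasMappingDegree f e →
      HasZeroDivisor f p → HasInnerDegree f δ → FixesOne f →
      (∀ z : annulus r, Multipliable (pairedFactor r p (z : ℂ)) ∧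
        (f z : ℂ) = annulusBlaschke r δ p (z : ℂ)) ∧
      ∀ (δ' : ℕ) (q : Fin e → ℂ), (∀ k, q k ∈ annulus r) →
        (∀ z : annulus r, (f z : ℂ) = annulusBlaschke r δ' q (z : ℂ)) →
        δ' = δ ∧ ∃ σ : Equiv.Perm (Fin e), ∀ k, q k = p (σ k)) := by
  have hn : 0 < e := by omega
  refine ⟨⟨?_, fun hpr => ?_⟩, fun hpr => ?_, ?_⟩
  · rintro ⟨f, hf, -, hz, hδ⟩
    exact (hf.exists_eq hr hr1 hp hz hδ).1
  · exact ⟨normalizedAnnulusMap hr hr1 hp hpr hn,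
      isProperHolomorphic_normalizedAnnulusMap hr hr1 hp hpr hn,
      hasMappingDegree_normalizedAnnulusMap hr hr1 hp hpr hn,
      hasZeroDivisor_normalizedAnnulusMap hr hr1 hp hpr hn,
      hasInnerDegree_normalizedAnnulusMap hr hr1 hp hpr hn⟩
  · refine ⟨normalizedAnnulusMap hr hr1 hp hpr hn,
      ⟨isProperHolomorphic_normalizedAnnulusMap hr hr1 hp hpr hn,
      hasMappingDegree_normalizedAnnulusMap hr hr1 hp hpr hn,
      hasZeroDivisor_normalizedAnnulusMap hr hr1 hp hpr hn,
      hasInnerDegree_normalizedAnnulusMap hr hr1 hp hpr hn,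
      fixesOne_normalizedAnnulusMap hr hr1 hp hpr hn⟩, ?_⟩
    rintro f ⟨hf, -, hz, hδ, h1⟩
    funext z
    refine Subtype.ext ?_
    rw [← annulusExt_apply f, h1.eq_normalizedMap hr hr1 hp hf hz hδ z.2]
    rfl
  · intro f hf _ hz hδ h1
    have hfz : ∀ z : annulus r, (f z : ℂ) = normalizedMap r δ p z := fun z => by
      rw [← annulusExt_apply f, h1.eq_normalizedMap hr hr1 hp hf hz hδ z.2]
    refine ⟨fun z => ⟨(hasProd_pairedFactor
      (fun k => thetaDom_of_mem_annulus hr hr1 (hp k) z.2.1.le z.2.2.le)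
      (thetaDom_one hr hr1 hp)).multipliable, ?_⟩, fun δ' q hq hfq => ?_⟩
    · rw [hfz, annulusBlaschke_eq_normalizedMap hr hr1 hp δ z.2]
    · refine eq_and_exists_perm_of_normalizedMap_eq hr hr1 hp hq fun z hzA => ?_
      rw [← hfz ⟨z, hzA⟩, hfq ⟨z, hzA⟩, annulusBlaschke_eq_normalizedMap hr hr1 hq δ' hzA]

/-! ### The space of normalized maps as a quotient of the space of zeros -/

section

variable {r : ℝ} {n : ℕ} {p : Fin n → ℂ} {z : ℂ}

lemma continuousAt_annThetaProd (h : ∀ k, ThetaDom r (p k) z) :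
    ContinuousAt (fun a : ℝ × (Fin n → ℂ) × ℂ => annThetaProd a.1 a.2.1 a.2.2) (r, p, z) := by
  refine tendsto_finsetProd _ fun k _ => ?_
  exact ContinuousAt.comp (f := fun a : ℝ × (Fin n → ℂ) × ℂ => (a.1, a.2.1 k, a.2.2))
    (g := fun a : ℝ × ℂ × ℂ => annTheta a.1 a.2.1 a.2.2) (h k).continuousAt_annTheta
    (by fun_prop)

lemma tendsto_annThetaProd (h : ∀ k, ThetaDom r (p k) z) {ι : Type*} {l : Filter ι}
    {a : ι → ℝ × (Fin n → ℂ) × ℂ} (ha : Filter.Tendsto a l (nhds (r, p, z))) :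
    Filter.Tendsto (fun i => annThetaProd (a i).1 (a i).2.1 (a i).2.2) l
      (nhds (annThetaProd r p z)) :=
  (continuousAt_annThetaProd h).tendsto.comp ha

lemma continuousAt_normalizedMap (hr : 0 < r) (hr1 : r < 1) (hp : ∀ k, p k ∈ annulus r)
    (hz : z ∈ annulus r) (δ : ℕ) :
    ContinuousAt (fun a : (ℝ × (Fin n → ℂ)) × ℂ => normalizedMap a.1.1 δ a.1.2 a.2)
      ((r, p), z) := by
  have h1 : ContinuousAt (fun a : (ℝ × (Fin n → ℂ)) × ℂ => annThetaProd a.1.1 a.1.2 1)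
      ((r, p), z) :=
    ContinuousAt.comp (f := fun a : (ℝ × (Fin n → ℂ)) × ℂ => ((a.1.1, a.1.2, 1) :
      ℝ × (Fin n → ℂ) × ℂ)) (g := fun a : ℝ × (Fin n → ℂ) × ℂ => annThetaProd a.1 a.2.1 a.2.2)
      (continuousAt_annThetaProd (thetaDom_one hr hr1 hp)) (by fun_prop)
  have h2 : ContinuousAt (fun a : (ℝ × (Fin n → ℂ)) × ℂ => annThetaProd a.1.1 a.1.2 a.2)
      ((r, p), z) :=
    ContinuousAt.comp (f := fun a : (ℝ × (Fin n → ℂ)) × ℂ => ((a.1.1, a.1.2, a.2) :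
      ℝ × (Fin n → ℂ) × ℂ)) (g := fun a : ℝ × (Fin n → ℂ) × ℂ => annThetaProd a.1 a.2.1 a.2.2)
      (continuousAt_annThetaProd fun k =>
        thetaDom_of_mem_annulus hr hr1 (hp k) hz.1.le hz.2.le) (by fun_prop)
  have h3 : ContinuousAt (fun a : (ℝ × (Fin n → ℂ)) × ℂ => a.2 ^ (-(δ : ℤ))) ((r, p), z) :=
    continuousAt_snd.zpow₀ _ (Or.inl (ne_zero_of_mem_annulus hr hz))
  exact ((h1.inv₀ (annThetaProd_one_ne_zero hr hr1 hp)).mul h3).mul h2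

end

/-- Pairs `(r, (p_1, …, p_e))` of a radius and points of the annulus with `|p_1 ⋯ p_e| = r ^ δ`. -/
def zeroSpace (e δ : ℕ) : Set (ℝ × (Fin e → ℂ)) :=
  {y | 0 < y.1 ∧ y.1 < 1 ∧ (∀ k, y.2 k ∈ annulus y.1) ∧ ‖∏ k, y.2 k‖ = y.1 ^ δ}

lemma ModelSpace.ext_of_annulusExt {e δ : ℕ} {m m' : ModelSpace e δ} (h : m.r = m'.r)
    (h' : ∀ z ∈ annulus m.r, annulusExt m.toMap z = annulusExt m'.toMap z) : m = m' := by
  obtain ⟨r, h1, f, h2, h3, h4, h5⟩ := m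
  obtain ⟨r', h1', f', h2', h3', h4', h5'⟩ := m'
  simp only at h h'
  subst h
  have : f = f' := by
    funext z
    refine Subtype.ext ?_
    rw [← annulusExt_apply f, h' z z.2, annulusExt_apply]
  subst this
  rfl

lemma ModelSpace.isOpen_iff {e δ : ℕ} {U : Set (ModelSpace e δ)} :
    IsOpen U ↔ ∀ ψ ∈ U, ∀ φ : ℕ → ModelSpace e δ, ModelSpace.ConvergesTo φ ψ →
      ∀ᶠ k in Filter.atTop, φ k ∈ U :=
  Iff.rfl

section

variable {e δ : ℕ}

/-- The normalized map with given radius and zeros. -/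
noncomputable def toModelSpace (he : 0 < e) (y : zeroSpace e δ) : ModelSpace e δ where
  r := y.1.1
  r_mem := ⟨y.2.1, y.2.2.1⟩
  toMap := normalizedAnnulusMap y.2.1 y.2.2.1 y.2.2.2.1 y.2.2.2.2 he
  isProperHolomorphic := isProperHolomorphic_normalizedAnnulusMap _ _ _ _ _
  degree := hasMappingDegree_normalizedAnnulusMap _ _ _ _ _
  innerDegree := hasInnerDegree_normalizedAnnulusMap _ _ _ _ _
  fixesOne := fixesOne_normalizedAnnulusMap _ _ _ _ _

variable (he : 0 < e)

lemma annulusExt_toModelSpace (y : zeroSpace e δ) {z : ℂ} (hz : z ∈ annulus y.1.1) :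
    annulusExt (toModelSpace he y).toMap z = normalizedMap y.1.1 δ y.1.2 z :=
  annulusExt_normalizedAnnulusMap y.2.1 y.2.2.1 y.2.2.2.1 y.2.2.2.2 he hz

lemma toModelSpace_eq_iff {y y' : zeroSpace e δ} :
    toModelSpace he y = toModelSpace he y' ↔
      y.1.1 = y'.1.1 ∧ ∃ σ : Equiv.Perm (Fin e), ∀ k, y'.1.2 k = y.1.2 (σ k) := by
  constructor
  · intro h
    have hr : y.1.1 = y'.1.1 := congrArg ModelSpace.r h
    refine ⟨hr, ?_⟩
    refine (eq_and_exists_perm_of_normalizedMap_eq y.2.1 y.2.2.1 (δ := δ) (δ' := δ) y.2.2.2.1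
      (q := y'.1.2) (by rw [hr]; exact y'.2.2.2.1) fun z hz => ?_).2
    have hz' : z ∈ annulus y'.1.1 := hr ▸ hz
    rw [← annulusExt_toModelSpace he y hz, hr, ← annulusExt_toModelSpace he y' hz', h]
  · rintro ⟨hr, σ, hσ⟩
    refine ModelSpace.ext_of_annulusExt hr fun z hz => ?_
    have hz' : z ∈ annulus y'.1.1 := hr ▸ hz
    rw [annulusExt_toModelSpace he y hz, annulusExt_toModelSpace he y' hz', ← hr]
    have hprod : ∀ z, annThetaProd y.1.1 y'.1.2 z = annThetaProd y.1.1 y.1.2 z := fun z => by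
      simp only [annThetaProd, hσ]
      exact Equiv.prod_comp σ fun k => annTheta y.1.1 (y.1.2 k) z
    simp only [normalizedMap, hprod]

lemma surjective_toModelSpace : Function.Surjective (toModelSpace he (δ := δ)) := by
  classical
  intro m
  obtain ⟨hr, hr1⟩ := m.r_mem
  have hdiff := m.isProperHolomorphic.holomorphic
  have hlim := m.isProperHolomorphic.tendsto_norm hr1
  obtain ⟨n, p, hp, hz⟩ := exists_zero_list hr hr1 hdiff hlim
  have hne : n = e := by
    have h1 := HasZeroDivisor.hasMappingDegree hr hr1 hp m.isProperHolomorphic hz 0 (by simp)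
    rw [← h1]
    exact m.degree 0 (by simp)
  subst hne
  obtain ⟨hpr, -⟩ := m.isProperHolomorphic.exists_eq hr hr1 hp hz m.innerDegree
  refine ⟨⟨(m.r, p), hr, hr1, hp, hpr⟩, ?_⟩
  refine ModelSpace.ext_of_annulusExt rfl fun z hzA => ?_
  rw [annulusExt_toModelSpace he _ hzA,
    m.fixesOne.eq_normalizedMap hr hr1 hp m.isProperHolomorphic hz m.innerDegree hzA]

lemma convergesTo_toModelSpace {y : ℕ → zeroSpace e δ} {y₀ : zeroSpace e δ}
    (hy : Filter.Tendsto y Filter.atTop (nhds y₀)) :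
    ModelSpace.ConvergesTo (fun k => toModelSpace he (y k)) (toModelSpace he y₀) := by
  have hy' : Filter.Tendsto (fun k => (y k).1) Filter.atTop (nhds y₀.1) :=
    (continuous_subtype_val.tendsto y₀).comp hy
  have hr' : Filter.Tendsto (fun k => (y k).1.1) Filter.atTop (nhds y₀.1.1) :=
    (continuous_fst.tendsto _).comp hy'
  refine ⟨hr', fun K hKA hK => ?_⟩
  rw [← tendstoLocallyUniformlyOn_iff_tendstoUniformlyOn_of_compact hK,
    tendstoLocallyUniformlyOn_iff_forall_tendsto]
  intro z hz
  have hzA : z ∈ annulus y₀.1.1 := hKA hz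
  have hcont := continuousAt_normalizedMap y₀.2.1 y₀.2.2.1 y₀.2.2.2.1 hzA δ
  have ht : Filter.Tendsto (fun a : ℕ × ℂ => ((y a.1).1, a.2))
      (Filter.atTop ×ˢ nhdsWithin z K) (nhds (y₀.1, z)) := by
    rw [nhds_prod_eq]
    exact (hy'.comp Filter.tendsto_fst).prodMk
      (Filter.tendsto_snd.mono_right nhdsWithin_le_nhds)
  have ht0 : Filter.Tendsto (fun a : ℕ × ℂ => (y₀.1, a.2))
      (Filter.atTop ×ˢ nhdsWithin z K) (nhds (y₀.1, z)) := by
    rw [nhds_prod_eq]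
    exact tendsto_const_nhds.prodMk (Filter.tendsto_snd.mono_right nhdsWithin_le_nhds)
  have hA : ∀ᶠ b : (ℝ × (Fin e → ℂ)) × ℂ in nhds (y₀.1, z), b.2 ∈ annulus b.1.1 := by
    have e1 : ∀ᶠ b : (ℝ × (Fin e → ℂ)) × ℂ in nhds (y₀.1, z), b.1.1 < ‖b.2‖ :=
      ContinuousAt.eventually_lt (by fun_prop) (by fun_prop) hzA.1
    have e2 : ∀ᶠ b : (ℝ × (Fin e → ℂ)) × ℂ in nhds (y₀.1, z), ‖b.2‖ < 1 :=
      ContinuousAt.eventually_lt (by fun_prop) (by fun_prop) hzA.2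
    filter_upwards [e1, e2] with b h1 h2 using ⟨h1, h2⟩
  have h1 : Filter.Tendsto (fun a : ℕ × ℂ => annulusExt (toModelSpace he y₀).toMap a.2)
      (Filter.atTop ×ˢ nhdsWithin z K) (nhds (normalizedMap y₀.1.1 δ y₀.1.2 z)) := by
    refine (hcont.tendsto.comp ht0).congr' ?_
    filter_upwards [ht0.eventually hA] with a ha using (annulusExt_toModelSpace he y₀ ha).symm
  have h2 : Filter.Tendsto (fun a : ℕ × ℂ => annulusExt (toModelSpace he (y a.1)).toMap a.2)
      (Filter.atTop ×ˢ nhdsWithin z K) (nhds (normalizedMap y₀.1.1 δ y₀.1.2 z)) := by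
    refine (hcont.tendsto.comp ht).congr' ?_
    filter_upwards [ht.eventually hA] with a ha using (annulusExt_toModelSpace he (y a.1) ha).symm
  have h3 := h1.prodMk_nhds h2
  exact h3.mono_right (nhds_le_uniformity _)

lemma continuous_toModelSpace : Continuous (toModelSpace he (δ := δ)) := by
  refine continuous_def.2 fun U hU => isOpen_iff_eventually.2 fun y hy => ?_
  rw [Filter.eventually_iff_seq_eventually]
  intro x hx
  exact ModelSpace.isOpen_iff.1 hU _ hy _ (convergesTo_toModelSpace he hx)

/-- If all points of `p` lie in the annulus, and `p'` has there the same multiplicities, then no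
point of `p'` is left to lie outside. -/
lemma mem_annulus_of_card_filter_eq {r : ℝ} {p p' : Fin e → ℂ} (hp : ∀ k, p k ∈ annulus r)
    (hcard : ∀ z ∈ annulus r, (Finset.univ.filter fun k => p k = z).card =
      (Finset.univ.filter fun k => p' k = z).card) (k : Fin e) : p' k ∈ annulus r := by
  classical
  set I : Finset ℂ := Finset.univ.image p with hI
  have hIA : ∀ z ∈ I, z ∈ annulus r := by
    intro z hz
    obtain ⟨k, -, rfl⟩ := Finset.mem_image.1 hz
    exact hp k
  have h1 : (Finset.univ.filter fun k => p' k ∈ I).card = (Finset.univ : Finset (Fin e)).card := by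
    rw [Finset.card_eq_sum_card_fiberwise (f := p') (s := Finset.univ.filter fun k => p' k ∈ I)
      (t := I) (fun k hk => (Finset.mem_filter.1 hk).2),
      Finset.card_eq_sum_card_image p Finset.univ]
    refine Finset.sum_congr rfl fun z hz => ?_
    rw [hcard z (hIA z hz), Finset.filter_filter]
    congr 1
    refine Finset.filter_congr fun k _ => ?_
    exact ⟨fun h => h.2, fun h => ⟨h ▸ hz, h⟩⟩
  have h2 := Finset.eq_of_subset_of_card_le (Finset.filter_subset _ _) h1.ge
  have h3 : k ∈ Finset.univ.filter fun k => p' k ∈ I := by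
    rw [h2]
    exact Finset.mem_univ k
  exact hIA _ (Finset.mem_filter.1 h3).2

/-- A degenerate product of elementary factors, with zeros in the closed annulus, still determines
the multiplicities of the zeros inside. -/
lemma card_filter_eq_of_normalizedMap_eq {r : ℝ} (hr : 0 < r) (hr1 : r < 1) {p₀ p : Fin e → ℂ}
    (hp₀ : ∀ k, p₀ k ∈ annulus r) (hpr : ∀ k, r ≤ ‖p k‖) (hp1 : ∀ k, ‖p k‖ ≤ 1) {c : ℂ}
    (hc0 : c ≠ 0) (hform : ∀ z ∈ annulus r,
      normalizedMap r δ p₀ z = c * z ^ (-(δ : ℤ)) * annThetaProd r p z) {z : ℂ}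
    (hz : z ∈ annulus r) : (Finset.univ.filter fun k => p₀ k = z).card =
      (Finset.univ.filter fun k => p k = z).card := by
  have hdom := fun k => thetaDom_of_mem_annulus' hr hr1 (hpr k) (hp1 k) hz
  have hz0 := ne_zero_of_mem_annulus hr hz
  have h1 : AnalyticAt ℂ (fun w : ℂ => c * w ^ (-(δ : ℤ))) z :=
    analyticAt_const.mul (analyticAt_id.zpow hz0)
  have h3 := analyticOrderAt_mul h1 (analyticAt_annThetaProd hdom)
  rw [h1.analyticOrderAt_eq_zero.2 (mul_ne_zero hc0 (zpow_ne_zero _ hz0)), zero_add,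
    analyticOrderAt_annThetaProd hdom] at h3
  rw [← Nat.cast_inj (R := ℕ∞), ← analyticOrderAt_normalizedMap hr hr1 hp₀ δ hz]
  refine Eq.trans ?_ h3
  refine analyticOrderAt_congr ?_
  filter_upwards [(isOpen_annulus r).mem_nhds hz] with w hw using hform w hw

/-- Compactness of the space of zeros over a convergent sequence of maps: some subsequence of the
zeros converges to the zeros of the limit. A limit point of the zeros on the boundary is excluded,
since the limit map would then have fewer than `e` zeros. -/
lemma exists_subseq_tendsto {y : ℕ → zeroSpace e δ} {y₀ : zeroSpace e δ}
    (h : ModelSpace.ConvergesTo (fun k => toModelSpace he (y k)) (toModelSpace he y₀)) :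
    ∃ y₁ : zeroSpace e δ, toModelSpace he y₁ = toModelSpace he y₀ ∧
      ∃ s : ℕ → ℕ, StrictMono s ∧ Filter.Tendsto (y ∘ s) Filter.atTop (nhds y₁) := by
  classical
  obtain ⟨hr, hr1, hp₀, hpr₀⟩ := y₀.2
  set r := y₀.1.1
  have hrk : Filter.Tendsto (fun k => (y k).1.1) Filter.atTop (nhds r) := h.1
  set a : ℕ → (Fin e → ℂ) × ℂ := fun k =>
    ((y k).1.2, (annThetaProd (y k).1.1 (y k).1.2 1)⁻¹) with ha
  have haK : ∀ k, a k ∈ (Metric.closedBall (0 : Fin e → ℂ) 1 ×ˢ Metric.sphere (0 : ℂ) 1) := by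
    intro k
    obtain ⟨h0, h1, h2, -⟩ := (y k).2
    refine ⟨?_, ?_⟩
    · rw [mem_closedBall_zero_iff, pi_norm_le_iff_of_nonneg zero_le_one]
      exact fun i => (h2 i).2.le
    · rw [mem_sphere_zero_iff_norm]
      exact norm_annThetaProd_one h0 h1 h2
  obtain ⟨⟨p, c⟩, hpc, s, hs, hlim⟩ :=
    ((isCompact_closedBall (0 : Fin e → ℂ) 1).prod (isCompact_sphere (0 : ℂ) 1)).tendsto_subseq haK
  have hc1 : ‖c‖ = 1 := mem_sphere_zero_iff_norm.1 hpc.2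
  have hc0 : c ≠ 0 := norm_pos_iff.1 (by rw [hc1]; exact one_pos)
  have hplim : Filter.Tendsto (fun k => (y (s k)).1.2) Filter.atTop (nhds p) :=
    (continuous_fst.tendsto _).comp hlim
  have hclim : Filter.Tendsto (fun k => (annThetaProd (y (s k)).1.1 (y (s k)).1.2 1)⁻¹)
      Filter.atTop (nhds c) := (continuous_snd.tendsto _).comp hlim
  have hrlim : Filter.Tendsto (fun k => (y (s k)).1.1) Filter.atTop (nhds r) :=
    hrk.comp hs.tendsto_atTop
  have hpi : ∀ i, Filter.Tendsto (fun k => ‖(y (s k)).1.2 i‖) Filter.atTop (nhds ‖p i‖) :=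
    fun i => ((tendsto_pi_nhds.1 hplim) i).norm
  have hp1 : ∀ i, ‖p i‖ ≤ 1 := fun i =>
    le_of_tendsto (hpi i) (Filter.Eventually.of_forall fun k => ((y (s k)).2.2.2.1 i).2.le)
  have hpr : ∀ i, r ≤ ‖p i‖ := fun i =>
    le_of_tendsto_of_tendsto' hrlim (hpi i) fun k => ((y (s k)).2.2.2.1 i).1.le
  have hform : ∀ z ∈ annulus r,
      normalizedMap r δ y₀.1.2 z = c * z ^ (-(δ : ℤ)) * annThetaProd r p z := by
    intro z hz
    have t1 : Filter.Tendsto (fun k => annulusExt (toModelSpace he (y (s k))).toMap z)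
        Filter.atTop (nhds (normalizedMap r δ y₀.1.2 z)) := by
      have := (h.2 {z} (Set.singleton_subset_iff.2 hz) isCompact_singleton).tendsto_at
        (Set.mem_singleton z)
      rw [annulusExt_toModelSpace he y₀ hz] at this
      exact this.comp hs.tendsto_atTop
    have t0 : Filter.Tendsto (fun k => (((y (s k)).1.1, (y (s k)).1.2, z) : ℝ × (Fin e → ℂ) × ℂ))
        Filter.atTop (nhds (r, p, z)) :=
      hrlim.prodMk_nhds (hplim.prodMk_nhds tendsto_const_nhds)
    have t2 := tendsto_annThetaProd (fun k =>
      thetaDom_of_mem_annulus' hr hr1 (hpr k) (hp1 k) hz) t0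
    have t3 := (hclim.mul_const (z ^ (-(δ : ℤ)))).mul t2
    refine tendsto_nhds_unique t1 (t3.congr' ?_)
    filter_upwards [hrlim.eventually (gt_mem_nhds hz.1)] with k hk
    have h1 := annulusExt_toModelSpace he (y (s k)) (z := z) ⟨hk, hz.2⟩
    rw [normalizedMap] at h1
    exact h1.symm
  have hcard := fun z hz =>
    card_filter_eq_of_normalizedMap_eq hr hr1 hp₀ hpr hp1 hc0 hform (z := z) hz
  have hpA := mem_annulus_of_card_filter_eq hp₀ hcard
  have hprod : ‖∏ k, p k‖ = r ^ δ := by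
    have t1 : Filter.Tendsto (fun k => ‖∏ i, (y (s k)).1.2 i‖) Filter.atTop (nhds ‖∏ i, p i‖) :=
      ((continuous_norm.comp (continuous_finsetProd _ fun i _ => continuous_apply i)).tendsto
        p).comp hplim
    refine tendsto_nhds_unique t1 ((hrlim.pow δ).congr fun k => ?_)
    exact ((y (s k)).2.2.2.2).symm
  refine ⟨⟨(r, p), hr, hr1, hpA, hprod⟩, ?_, s, hs, ?_⟩
  · symm
    rw [toModelSpace_eq_iff]
    refine ⟨rfl, exists_perm_of_card_filter_eq fun z => ?_⟩
    by_cases hz : z ∈ annulus r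
    · exact hcard z hz
    · rw [Finset.filter_false_of_mem fun k _ (hk : y₀.1.2 k = z) => hz (hk ▸ hp₀ k),
        Finset.filter_false_of_mem fun k _ (hk : p k = z) => hz (hk ▸ hpA k)]
  · rw [tendsto_subtype_rng]
    exact hrlim.prodMk_nhds hplim

/-- If the preimage of `U` is open, a sequence of maps converging into `U` cannot stay outside `U`,
since the zeros along a subsequence converge to zeros of the limit. -/
theorem isQuotientMap_toModelSpace : Topology.IsQuotientMap (toModelSpace he (δ := δ)) := by
  refine ⟨.of_isOpen_preimage_iff_isOpen fun U =>
    ⟨fun hU => ?_, fun hU => hU.preimage (continuous_toModelSpace he)⟩, surjective_toModelSpace he⟩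
  refine ModelSpace.isOpen_iff.2 fun ψ hψ φ hφ => ?_
  by_contra hcon
  obtain ⟨s, hs, hsU⟩ := Filter.extraction_of_frequently_atTop (Filter.not_eventually.1 hcon)
  choose y hy using fun k => surjective_toModelSpace he (φ (s k))
  obtain ⟨y₀, rfl⟩ := surjective_toModelSpace he ψ
  have hconv : ModelSpace.ConvergesTo (fun k => toModelSpace he (y k)) (toModelSpace he y₀) := by
    simp only [hy]
    refine ⟨hφ.1.comp hs.tendsto_atTop, fun K hKA hK => ?_⟩
    intro u hu
    exact hs.tendsto_atTop.eventually (hφ.2 K hKA hK u hu)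
  obtain ⟨y₁, hy₁, s', -, hlim⟩ := exists_subseq_tendsto he hconv
  have hmem : y₁ ∈ toModelSpace he ⁻¹' U := by
    rw [Set.mem_preimage, hy₁]
    exact hψ
  obtain ⟨k, hk⟩ := (hlim.eventually (hU.mem_nhds hmem)).exists
  refine hsU (s' k) ?_
  rw [← hy]
  exact hk

end

/-! ### Logarithmic coordinates on the space of zeros -/

/-- The logit `log (t / (1 - t))`, the inverse of `Real.sigmoid` on `(0, 1)`. -/
noncomputable def logit (t : ℝ) : ℝ := Real.log t - Real.log (1 - t)

theorem sigmoid_logit {t : ℝ} (h0 : 0 < t) (h1 : t < 1) : Real.sigmoid (logit t) = t := by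
  have h2 : 0 < 1 - t := by linarith
  rw [Real.sigmoid_def, logit, neg_sub, Real.exp_sub, Real.exp_log h0, Real.exp_log h2]
  field_simp
  ring

theorem logit_sigmoid (x : ℝ) : logit (Real.sigmoid x) = x :=
  Real.sigmoid_injective (sigmoid_logit (Real.sigmoid_pos x) (Real.sigmoid_lt_one x))

section SigmoidShift

variable {e : ℕ} {d : ℝ}

theorem strictMono_sum_sigmoid (he : 0 < e) (x : Fin e → ℝ) :
    StrictMono fun c : ℝ => ∑ k, Real.sigmoid (x k + c) := by
  have : Nonempty (Fin e) := ⟨⟨0, he⟩⟩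
  intro a b hab
  exact Finset.sum_lt_sum_of_nonempty Finset.univ_nonempty fun k _ =>
    Real.sigmoid_strictMono (add_lt_add_right hab (x k))

theorem exists_sum_sigmoid_eq (h0 : 0 < d) (h1 : d < e) (x : Fin e → ℝ) :
    ∃ c : ℝ, ∑ k, Real.sigmoid (x k + c) = d := by
  have hbot : Filter.Tendsto (fun c : ℝ => ∑ k, Real.sigmoid (x k + c)) Filter.atBot (nhds 0) := by
    have := tendsto_finsetSum (Finset.univ : Finset (Fin e)) fun k _ =>
      Real.tendsto_sigmoid_atBot.comp (Filter.tendsto_atBot_add_const_left Filter.atBot (x k)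
        Filter.tendsto_id)
    simpa using this
  have htop : Filter.Tendsto (fun c : ℝ => ∑ k, Real.sigmoid (x k + c)) Filter.atTop
      (nhds (e : ℝ)) := by
    have := tendsto_finsetSum (Finset.univ : Finset (Fin e)) fun k _ =>
      Real.tendsto_sigmoid_atTop.comp (Filter.tendsto_atTop_add_const_left Filter.atTop (x k)
        Filter.tendsto_id)
    simpa using this
  obtain ⟨a, ha⟩ := (hbot.eventually (gt_mem_nhds h0)).exists
  obtain ⟨b, hb⟩ := (htop.eventually (lt_mem_nhds h1)).exists
  exact mem_range_of_exists_le_of_exists_ge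
    (continuous_finsetSum _ fun k _ =>
      continuous_sigmoid.comp (continuous_const.add continuous_id))
    ⟨a, ha.le⟩ ⟨b, hb.le⟩

/-- The number `c` for which `∑ sigmoid (x_k + c) = d`. It exists and is unique for `0 < d < e`. -/
noncomputable def sigmoidShift (d : ℝ) (x : Fin e → ℝ) : ℝ :=
  Classical.epsilon fun c : ℝ => ∑ k, Real.sigmoid (x k + c) = d

theorem sum_sigmoid_sigmoidShift (h0 : 0 < d) (h1 : d < e) (x : Fin e → ℝ) :
    ∑ k, Real.sigmoid (x k + sigmoidShift d x) = d :=
  Classical.epsilon_spec (exists_sum_sigmoid_eq h0 h1 x)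

theorem sigmoidShift_eq (h0 : 0 < d) (h1 : d < e) {x : Fin e → ℝ} {c : ℝ}
    (hc : ∑ k, Real.sigmoid (x k + c) = d) : sigmoidShift d x = c :=
  (strictMono_sum_sigmoid (Nat.cast_pos.1 (h0.trans h1)) x).injective
    ((sum_sigmoid_sigmoidShift h0 h1 x).trans hc.symm)

/-- By monotonicity in `c`, each of the inequalities `c < sigmoidShift d x` and
`sigmoidShift d x < c` is an open condition on `x`. -/
theorem continuous_sigmoidShift (h0 : 0 < d) (h1 : d < e) :
    Continuous (sigmoidShift d : (Fin e → ℝ) → ℝ) := by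
  have he : 0 < e := Nat.cast_pos.1 (h0.trans h1)
  have hcont : ∀ c : ℝ, Continuous fun x : Fin e → ℝ => ∑ k, Real.sigmoid (x k + c) := fun c =>
    continuous_finsetSum _ fun k _ =>
      continuous_sigmoid.comp ((continuous_apply k).add continuous_const)
  rw [continuous_iff_continuousAt]
  intro x
  refine tendsto_order.2 ⟨fun c hc => ?_, fun c hc => ?_⟩
  · have h := strictMono_sum_sigmoid he x hc
    simp only [sum_sigmoid_sigmoidShift h0 h1] at h
    filter_upwards [(hcont c).continuousAt.eventually (gt_mem_nhds h)] with y hy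
    rw [← sum_sigmoid_sigmoidShift h0 h1 y] at hy
    exact (strictMono_sum_sigmoid he y).lt_iff_lt.1 hy
  · have h := strictMono_sum_sigmoid he x hc
    simp only [sum_sigmoid_sigmoidShift h0 h1] at h
    filter_upwards [(hcont c).continuousAt.eventually (lt_mem_nhds h)] with y hy
    rw [← sum_sigmoid_sigmoidShift h0 h1 y] at hy
    exact (strictMono_sum_sigmoid he y).lt_iff_lt.1 hy

end SigmoidShift

/-- The complex number of norm `a` with the same argument as `u`. -/
noncomputable def withNorm (u : ℂ) (a : ℝ) : ℂ := u / (‖u‖ : ℂ) * (a : ℂ)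

theorem norm_withNorm {u : ℂ} (hu : u ≠ 0) {a : ℝ} (ha : 0 < a) : ‖withNorm u a‖ = a := by
  have : ‖u‖ ≠ 0 := norm_ne_zero_iff.2 hu
  rw [withNorm, norm_mul, norm_div, Complex.norm_real, Complex.norm_real, norm_norm, div_self this,
    one_mul, Real.norm_of_nonneg ha.le]

theorem withNorm_norm {u : ℂ} (hu : u ≠ 0) : withNorm u ‖u‖ = u :=
  div_mul_cancel₀ u (Complex.ofReal_ne_zero.2 (norm_ne_zero_iff.2 hu))

theorem withNorm_withNorm {u : ℂ} (hu : u ≠ 0) {a : ℝ} (ha : 0 < a) (b : ℝ) :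
    withNorm (withNorm u a) b = withNorm u b := by
  have ha' : (a : ℂ) ≠ 0 := Complex.ofReal_ne_zero.2 ha.ne'
  rw [withNorm, norm_withNorm hu ha, withNorm, withNorm, mul_div_cancel_right₀ _ ha']

theorem Continuous.withNorm {X : Type*} [TopologicalSpace X] {f : X → ℂ} {g : X → ℝ}
    (hf : Continuous f) (hg : Continuous g) (h0 : ∀ x, f x ≠ 0) :
    Continuous fun x => withNorm (f x) (g x) :=
  (hf.div (Complex.continuous_ofReal.comp hf.norm) fun x =>
    Complex.ofReal_ne_zero.2 (norm_ne_zero_iff.2 (h0 x))).mul (Complex.continuous_ofReal.comp hg)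

/-- The families of `e` complex numbers whose product has norm one. -/
def unimodularFamilies (e : ℕ) : Set (Fin e → ℂ) := {q | ‖∏ k, q k‖ = 1}

theorem ne_zero_of_mem_unimodularFamilies {e : ℕ} {q : Fin e → ℂ}
    (hq : q ∈ unimodularFamilies e) (k : Fin e) : q k ≠ 0 := by
  intro h
  have h1 : ‖∏ k, q k‖ = 1 := hq
  rw [Finset.prod_eq_zero (Finset.mem_univ k) h, norm_zero] at h1
  exact zero_ne_one h1

theorem norm_prod_eq_exp_sum_log {e : ℕ} {q : Fin e → ℂ} (hq : ∀ k, q k ≠ 0) :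
    ‖∏ k, q k‖ = Real.exp (∑ k, Real.log ‖q k‖) := by
  rw [Real.exp_sum, norm_prod]
  exact Finset.prod_congr rfl fun k _ => (Real.exp_log (norm_pos_iff.2 (hq k))).symm

theorem sum_log_norm_eq_zero {e : ℕ} {q : Fin e → ℂ} (hq : q ∈ unimodularFamilies e) :
    ∑ k, Real.log ‖q k‖ = 0 := by
  have h : ‖∏ k, q k‖ = 1 := hq
  rwa [norm_prod_eq_exp_sum_log (ne_zero_of_mem_unimodularFamilies hq),
    Real.exp_eq_one_iff] at h

/-- The logarithmic radius of `p`, rescaled such that the annulus of inner radius `r` corresponds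
to `(0, 1)`, as a real number. -/
noncomputable def logitRadius (r : ℝ) (p : ℂ) : ℝ := logit (Real.log ‖p‖ / Real.log r)

theorem log_ratio_mem {r : ℝ} (hr : 0 < r) (hr1 : r < 1) {p : ℂ} (hp : p ∈ annulus r) :
    0 < Real.log ‖p‖ / Real.log r ∧ Real.log ‖p‖ / Real.log r < 1 := by
  have h1 : Real.log r < 0 := Real.log_neg hr hr1
  refine ⟨div_pos_of_neg_of_neg (Real.log_neg (hr.trans hp.1) hp.2) h1, ?_⟩
  rw [div_lt_one_of_neg h1]
  exact Real.log_lt_log hr hp.1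

theorem sum_sigmoid_logitRadius {e δ : ℕ} (y : zeroSpace e δ) :
    ∑ k, Real.sigmoid (logitRadius y.1.1 (y.1.2 k)) = δ := by
  obtain ⟨⟨r, p⟩, hr, hr1, hp, hprod⟩ := y
  have h1 : Real.log r < 0 := Real.log_neg hr hr1
  have hp0 : ∀ k, p k ≠ 0 := fun k => norm_pos_iff.1 (hr.trans (hp k).1)
  have h2 : ∑ k, Real.log ‖p k‖ = δ * Real.log r := by
    rw [← Real.log_exp (∑ k, Real.log ‖p k‖), ← norm_prod_eq_exp_sum_log hp0, ← Real.log_pow]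
    exact congrArg Real.log hprod
  have h3 : ∀ k, Real.sigmoid (logitRadius r (p k)) = Real.log ‖p k‖ / Real.log r := fun k =>
    sigmoid_logit (log_ratio_mem hr hr1 (hp k)).1 (log_ratio_mem hr hr1 (hp k)).2
  simp only [h3]
  rw [← Finset.sum_div, h2, mul_div_cancel_right₀ _ h1.ne]

/-- The family with the same arguments as `p` in which `log ‖q_k‖` is the deviation of
`logitRadius r p_k` from the mean. -/
noncomputable def centredFamily {e : ℕ} (r : ℝ) (p : Fin e → ℂ) (k : Fin e) : ℂ :=
  withNorm (p k)
    (Real.exp (logitRadius r (p k) - (∑ i, logitRadius r (p i)) / e))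

/-- The inverse of `centredFamily`: the logarithmic radii are shifted by the constant for which
the product of the family has norm `r ^ δ`. -/
noncomputable def annulusFamily {e : ℕ} (δ : ℕ) (r : ℝ) (q : Fin e → ℂ) (k : Fin e) : ℂ :=
  withNorm (q k)
    (r ^ Real.sigmoid (Real.log ‖q k‖ + sigmoidShift δ fun i => Real.log ‖q i‖))

theorem centredFamily_comp_perm {e : ℕ} (r : ℝ) (p : Fin e → ℂ) (σ : Equiv.Perm (Fin e)) :
    centredFamily r (p ∘ σ) = centredFamily r p ∘ σ := by
  funext k
  simp only [centredFamily, Function.comp_apply]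
  rw [Equiv.sum_comp σ fun i => logitRadius r (p i)]

theorem annulusFamily_comp_perm {e : ℕ} (δ : ℕ) (r : ℝ) (q : Fin e → ℂ)
    (σ : Equiv.Perm (Fin e)) : annulusFamily δ r (q ∘ σ) = annulusFamily δ r q ∘ σ := by
  have h : (sigmoidShift (δ : ℝ) fun i => Real.log ‖(q ∘ σ) i‖) =
      sigmoidShift (δ : ℝ) fun i => Real.log ‖q i‖ := by
    have h1 : ∀ c, ∑ k, Real.sigmoid (Real.log ‖(q ∘ σ) k‖ + c) =
        ∑ k, Real.sigmoid (Real.log ‖q k‖ + c) := fun c =>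
      Equiv.sum_comp σ fun k => Real.sigmoid (Real.log ‖q k‖ + c)
    simp only [sigmoidShift, h1]
  funext k
  rw [annulusFamily, h]
  rfl

theorem log_norm_centredFamily {e : ℕ} {r : ℝ} {p : Fin e → ℂ} (hp : ∀ k, p k ≠ 0) (k : Fin e) :
    Real.log ‖centredFamily r p k‖ =
      logitRadius r (p k) - (∑ i, logitRadius r (p i)) / e := by
  rw [centredFamily, norm_withNorm (hp k) (Real.exp_pos _), Real.log_exp]

theorem centredFamily_mem {e : ℕ} (he : 0 < e) {r : ℝ} {p : Fin e → ℂ} (hp : ∀ k, p k ≠ 0) :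
    centredFamily r p ∈ unimodularFamilies e := by
  have h0 : ∀ k, centredFamily r p k ≠ 0 := fun k => norm_pos_iff.1 <| by
    rw [centredFamily, norm_withNorm (hp k) (Real.exp_pos _)]
    exact Real.exp_pos _
  have he' : (e : ℝ) ≠ 0 := Nat.cast_ne_zero.2 he.ne'
  change ‖∏ k, centredFamily r p k‖ = 1
  rw [norm_prod_eq_exp_sum_log h0, Real.exp_eq_one_iff]
  simp only [log_norm_centredFamily hp]
  rw [Finset.sum_sub_distrib, Finset.sum_const, Finset.card_univ, Fintype.card_fin, nsmul_eq_mul,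
    mul_div_cancel₀ _ he', sub_self]

theorem logitRadius_annulusFamily {e δ : ℕ} {r : ℝ} (hr : 0 < r) (hr1 : r < 1) {q : Fin e → ℂ}
    (hq : ∀ k, q k ≠ 0) (k : Fin e) :
    logitRadius r (annulusFamily δ r q k) =
      Real.log ‖q k‖ + sigmoidShift δ fun i => Real.log ‖q i‖ := by
  rw [logitRadius, annulusFamily, norm_withNorm (hq k) (Real.rpow_pos_of_pos hr _),
    Real.log_rpow hr, mul_div_cancel_right₀ _ (Real.log_neg hr hr1).ne, logit_sigmoid]

theorem annulusFamily_mem {e δ : ℕ} (hδ : 1 ≤ δ) (hδe : δ < e) {r : ℝ} (hr : 0 < r) (hr1 : r < 1)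
    {q : Fin e → ℂ} (hq : ∀ k, q k ≠ 0) : (r, annulusFamily δ r q) ∈ zeroSpace e δ := by
  refine ⟨hr, hr1, fun k => ?_, ?_⟩
  · change r < ‖annulusFamily δ r q k‖ ∧ ‖annulusFamily δ r q k‖ < 1
    rw [annulusFamily, norm_withNorm (hq k) (Real.rpow_pos_of_pos hr _)]
    refine ⟨?_, Real.rpow_lt_one hr.le hr1 (Real.sigmoid_pos _)⟩
    conv_lhs => rw [← Real.rpow_one r]
    exact Real.rpow_lt_rpow_of_exponent_gt hr hr1 (Real.sigmoid_lt_one _)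
  · change ‖∏ k, annulusFamily δ r q k‖ = r ^ δ
    have h0 : (0 : ℝ) < δ := by exact_mod_cast hδ
    have h1 : (δ : ℝ) < e := by exact_mod_cast hδe
    have h2 : ∀ k, ‖annulusFamily δ r q k‖ =
        r ^ Real.sigmoid (Real.log ‖q k‖ + sigmoidShift δ fun i => Real.log ‖q i‖) := fun k =>
      norm_withNorm (hq k) (Real.rpow_pos_of_pos hr _)
    rw [norm_prod]
    simp only [h2]
    rw [← Real.rpow_sum_of_pos hr, sum_sigmoid_sigmoidShift h0 h1 fun i => Real.log ‖q i‖,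
      Real.rpow_natCast]

theorem centredFamily_annulusFamily {e δ : ℕ} (he : 0 < e) {r : ℝ} (hr : 0 < r) (hr1 : r < 1)
    {q : Fin e → ℂ} (hq : q ∈ unimodularFamilies e) :
    centredFamily r (annulusFamily δ r q) = q := by
  have hq0 := ne_zero_of_mem_unimodularFamilies hq
  have he' : (e : ℝ) ≠ 0 := Nat.cast_ne_zero.2 he.ne'
  funext k
  rw [centredFamily]
  simp only [logitRadius_annulusFamily hr hr1 hq0]
  rw [Finset.sum_add_distrib, sum_log_norm_eq_zero hq, zero_add, Finset.sum_const,
    Finset.card_univ, Fintype.card_fin, nsmul_eq_mul, mul_div_cancel_left₀ _ he',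
    add_sub_cancel_right, Real.exp_log (norm_pos_iff.2 (hq0 k)), annulusFamily,
    withNorm_withNorm (hq0 k) (Real.rpow_pos_of_pos hr _), withNorm_norm (hq0 k)]

theorem annulusFamily_centredFamily {e δ : ℕ} (hδ : 1 ≤ δ) (hδe : δ < e) (y : zeroSpace e δ) :
    annulusFamily δ y.1.1 (centredFamily y.1.1 y.1.2) = y.1.2 := by
  have hsum := sum_sigmoid_logitRadius y
  obtain ⟨⟨r, p⟩, hr, hr1, hp, hprod⟩ := y
  simp only at hr hr1 hp hsum ⊢
  have h0 : (0 : ℝ) < δ := by exact_mod_cast hδ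
  have h1 : (δ : ℝ) < e := by exact_mod_cast hδe
  have hp0 : ∀ k, p k ≠ 0 := fun k => norm_pos_iff.1 (hr.trans (hp k).1)
  funext k
  have hshift : (sigmoidShift δ fun i => Real.log ‖centredFamily r p i‖) =
      (∑ i, logitRadius r (p i)) / e := by
    refine sigmoidShift_eq h0 h1 ?_
    simpa only [log_norm_centredFamily hp0, sub_add_cancel] using hsum
  have hk := log_ratio_mem hr hr1 (hp k)
  have hpk : 0 < ‖p k‖ := norm_pos_iff.2 (hp0 k)
  rw [annulusFamily, hshift, log_norm_centredFamily hp0, sub_add_cancel, logitRadius,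
    sigmoid_logit hk.1 hk.2, centredFamily, withNorm_withNorm (hp0 k) (Real.exp_pos _),
    Real.rpow_def_of_pos hr, mul_div_cancel₀ _ (Real.log_neg hr hr1).ne, Real.exp_log hpk,
    withNorm_norm (hp0 k)]

theorem Continuous.logit {X : Type*} [TopologicalSpace X] {f : X → ℝ} (hf : Continuous f)
    (h : ∀ x, 0 < f x ∧ f x < 1) : Continuous fun x => logit (f x) :=
  (hf.log fun x => (h x).1.ne').sub
    ((continuous_const.sub hf).log fun x => (sub_pos.2 (h x).2).ne')

theorem Continuous.logitRadius {X : Type*} [TopologicalSpace X] {f : X → ℝ} {g : X → ℂ}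
    (hf : Continuous f) (hg : Continuous g) (hf0 : ∀ x, 0 < f x) (hf1 : ∀ x, f x < 1)
    (h : ∀ x, g x ∈ annulus (f x)) : Continuous fun x => logitRadius (f x) (g x) :=
  Continuous.logit
    ((hg.norm.log fun x => ((hf0 x).trans (h x).1).ne').div (hf.log fun x => (hf0 x).ne')
      fun x => (Real.log_neg (hf0 x) (hf1 x)).ne)
    fun x => log_ratio_mem (hf0 x) (hf1 x) (h x)

theorem Continuous.centredFamily {X : Type*} [TopologicalSpace X] {e : ℕ} {f : X → ℝ}
    {g : X → Fin e → ℂ} (hf : Continuous f) (hg : Continuous g) (hf0 : ∀ x, 0 < f x)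
    (hf1 : ∀ x, f x < 1) (h : ∀ x k, g x k ∈ annulus (f x)) :
    Continuous fun x => centredFamily (f x) (g x) := by
  have hg' : ∀ k, Continuous fun x => g x k := fun k => (continuous_apply k).comp hg
  have hL : ∀ k, Continuous fun x => _root_.logitRadius (f x) (g x k) := fun k =>
    hf.logitRadius (hg' k) hf0 hf1 fun x => h x k
  refine continuous_pi fun k => (hg' k).withNorm (Real.continuous_exp.comp ((hL k).sub
    ((continuous_finsetSum _ fun i _ => hL i).div_const _)))
    fun x => norm_pos_iff.1 ((hf0 x).trans (h x k).1)

theorem Continuous.annulusFamily {X : Type*} [TopologicalSpace X] {e δ : ℕ} (hδ : 1 ≤ δ)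
    (hδe : δ < e) {f : X → ℝ} {g : X → Fin e → ℂ} (hf : Continuous f) (hg : Continuous g)
    (hf0 : ∀ x, 0 < f x) (hg0 : ∀ x k, g x k ≠ 0) :
    Continuous fun x => annulusFamily δ (f x) (g x) := by
  have h0 : (0 : ℝ) < δ := by exact_mod_cast hδ
  have h1 : (δ : ℝ) < e := by exact_mod_cast hδe
  have hg' : ∀ k, Continuous fun x => g x k := fun k => (continuous_apply k).comp hg
  have hlog : ∀ k, Continuous fun x => Real.log ‖g x k‖ := fun k =>
    (hg' k).norm.log fun x => norm_ne_zero_iff.2 (hg0 x k)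
  have hshift : Continuous fun x => sigmoidShift (δ : ℝ) fun i => Real.log ‖g x i‖ :=
    (continuous_sigmoidShift h0 h1).comp (continuous_pi hlog)
  exact continuous_pi fun k => (hg' k).withNorm
    (hf.rpow (continuous_sigmoid.comp ((hlog k).add hshift)) fun x => Or.inl (hf0 x).ne')
    (hg0 · k)

/-- The radius and the zeros in the coordinates `logit r` and `centredFamily r p`. The symmetric
group acts on both sides by permuting the family. -/
noncomputable def zeroSpaceHomeomorph {e δ : ℕ} (hδ : 1 ≤ δ) (hδe : δ < e) :
    zeroSpace e δ ≃ₜ ℝ × unimodularFamilies e where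
  toFun y := (logit y.1.1, ⟨centredFamily y.1.1 y.1.2, centredFamily_mem (by omega)
    fun k => norm_pos_iff.1 (y.2.1.trans (y.2.2.2.1 k).1)⟩)
  invFun w := ⟨(Real.sigmoid w.1, annulusFamily δ (Real.sigmoid w.1) w.2),
    annulusFamily_mem hδ hδe (Real.sigmoid_pos _) (Real.sigmoid_lt_one _)
      (ne_zero_of_mem_unimodularFamilies w.2.2)⟩
  left_inv y := by
    apply Subtype.ext
    apply Prod.ext
    · exact sigmoid_logit y.2.1 y.2.2.1
    · simp only [sigmoid_logit y.2.1 y.2.2.1]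
      exact annulusFamily_centredFamily hδ hδe y
  right_inv w := by
    apply Prod.ext
    · exact logit_sigmoid _
    · apply Subtype.ext
      exact centredFamily_annulusFamily (by omega) (Real.sigmoid_pos _) (Real.sigmoid_lt_one _)
        w.2.2
  continuous_toFun :=
    have hr : Continuous fun y : zeroSpace e δ => y.1.1 :=
      continuous_fst.comp continuous_subtype_val
    have hp : Continuous fun y : zeroSpace e δ => y.1.2 :=
      continuous_snd.comp continuous_subtype_val
    (hr.logit fun y => ⟨y.2.1, y.2.2.1⟩).prodMk
      ((hr.centredFamily hp (fun y => y.2.1) (fun y => y.2.2.1) fun y => y.2.2.2.1).subtype_mk _)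
  continuous_invFun :=
    have hr : Continuous fun w : ℝ × unimodularFamilies e => Real.sigmoid w.1 :=
      continuous_sigmoid.comp continuous_fst
    Continuous.subtype_mk (hr.prodMk (Continuous.annulusFamily hδ hδe hr
      (continuous_subtype_val.comp continuous_snd) (fun _ => Real.sigmoid_pos _)
      fun w => ne_zero_of_mem_unimodularFamilies w.2.2)) _

/-! ### Roots and coefficients of monic polynomials -/

section Roots

open Polynomial

variable {e m : ℕ}

/-- The coefficients of `∏ (X - q_k)` below the leading one. -/
noncomputable def coeffsOfRoots (q : Fin e → ℂ) (i : Fin e) : ℂ :=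
  (∏ k, (X - C (q k))).coeff i

theorem continuous_coeff_prod_X_sub_C {ι : Type*} (s : Finset ι) (n : ℕ) :
    Continuous fun q : ι → ℂ => (∏ k ∈ s, (X - C (q k))).coeff n := by
  classical
  induction s using Finset.induction_on generalizing n with
  | empty => simpa using continuous_const
  | insert a s ha ih =>
    simp only [Finset.prod_insert ha, coeff_mul, coeff_sub, coeff_C]
    refine continuous_finsetSum _ fun x _ => Continuous.mul (continuous_const.sub ?_) (ih _)
    split_ifs
    · exact continuous_apply a
    · exact continuous_const

theorem continuous_coeffsOfRoots : Continuous (coeffsOfRoots : (Fin e → ℂ) → Fin e → ℂ) :=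
  continuous_pi fun i => continuous_coeff_prod_X_sub_C _ i

theorem surjective_coeffsOfRoots :
    Function.Surjective (coeffsOfRoots : (Fin e → ℂ) → Fin e → ℂ) := by
  intro a
  set P : ℂ[X] := X ^ e + ∑ i : Fin e, C (a i) * X ^ (i : ℕ) with hP
  have hdeg : (∑ i : Fin e, C (a i) * X ^ (i : ℕ)).degree < (e : WithBot ℕ) := degree_sum_fin_lt a
  have hmonic : P.Monic := monic_X_pow_add hdeg
  have hPdeg : P.natDegree = e := by
    rw [hP, natDegree_eq_of_degree_eq_some (n := e)]
    rw [degree_add_eq_left_of_degree_lt (by rwa [degree_X_pow]), degree_X_pow]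
  have hsplit := IsAlgClosed.splits P
  have hlen : P.roots.toList.length = e := by
    rw [Multiset.length_toList, ← hsplit.natDegree_eq_card_roots, hPdeg]
  refine ⟨fun k => P.roots.toList.get (k.cast hlen.symm), funext fun i => ?_⟩
  have hprod : ∏ k : Fin e, (X - C (P.roots.toList.get (k.cast hlen.symm))) = P := by
    conv_rhs => rw [hsplit.eq_prod_roots_of_monic hmonic, ← Multiset.coe_toList P.roots,
      Multiset.map_coe, Multiset.prod_coe]
    rw [← Fin.prod_univ_getElem]
    refine Fintype.prod_equiv (finCongr (by simp [hlen])) _ _ fun k => by simp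
  rw [coeffsOfRoots, hprod, hP, coeff_add, coeff_X_pow, if_neg i.2.ne, zero_add, finsetSum_coeff]
  simp only [coeff_C_mul, coeff_X_pow]
  rw [Finset.sum_eq_single i]
  · simp
  · intro j _ hj
    rw [if_neg fun h => hj (Fin.ext h.symm), mul_zero]
  · simp

theorem coeffsOfRoots_comp_perm (q : Fin e → ℂ) (σ : Equiv.Perm (Fin e)) :
    coeffsOfRoots (q ∘ σ) = coeffsOfRoots q := by
  funext i
  simp only [coeffsOfRoots, Function.comp_apply]
  rw [Equiv.prod_comp σ fun k => X - C (q k)]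

theorem coeffsOfRoots_eq_iff {q q' : Fin e → ℂ} :
    coeffsOfRoots q = coeffsOfRoots q' ↔ ∃ σ : Equiv.Perm (Fin e), q' = q ∘ σ := by
  refine ⟨fun h => ?_, fun ⟨σ, hσ⟩ => by rw [hσ, coeffsOfRoots_comp_perm]⟩
  have hd : ∀ q : Fin e → ℂ, (∏ k, (X - C (q k))).natDegree = e := fun q => by
    rw [natDegree_finsetProd_X_sub_C_eq_card, Finset.card_univ, Fintype.card_fin]
  have hpoly : ∏ k, (X - C (q k)) = ∏ k, (X - C (q' k)) := by
    ext n
    rcases lt_trichotomy n e with hn | rfl | hn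
    · exact congrFun h ⟨n, hn⟩
    · have h1 := (monic_prod_X_sub_C q Finset.univ).coeff_natDegree
      have h2 := (monic_prod_X_sub_C q' Finset.univ).coeff_natDegree
      rw [hd] at h1 h2
      rw [h1, h2]
    · rw [coeff_eq_zero_of_natDegree_lt (by rwa [hd]), coeff_eq_zero_of_natDegree_lt (by rwa [hd])]
  have hr : ∀ q : Fin e → ℂ, (∏ k, (X - C (q k))).roots = Finset.univ.val.map q := fun q => by
    have := roots_multiset_prod_X_sub_C (Finset.univ.val.map q)
    rwa [Multiset.map_map] at this
  have hmap : Finset.univ.val.map q = Finset.univ.val.map q' := by rw [← hr, ← hr, hpoly]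
  obtain ⟨σ, hσ⟩ := exists_perm_of_card_filter_eq (p := q) (q := q') fun z => by
    have hc : ∀ q : Fin e → ℂ,
        (Finset.univ.filter fun k => q k = z).card = (Finset.univ.val.map q).count z := fun q => by
      rw [Multiset.count_map, Finset.card_def, Finset.filter_val]
      simp only [eq_comm (b := z)]
    rw [hc, hc, hmap]
  exact ⟨σ, funext hσ⟩

/-- Cauchy's bound for the roots of a monic polynomial. -/
theorem norm_root_le (q : Fin e → ℂ) (k : Fin e) : ‖q k‖ ≤ ‖coeffsOfRoots q‖ + 1 := by
  set P : ℂ[X] := ∏ k, (X - C (q k)) with hP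
  have hmonic : P.Monic := monic_prod_X_sub_C q Finset.univ
  have hroot : P.IsRoot (q k) := by
    rw [IsRoot.def, hP, eval_prod]
    exact Finset.prod_eq_zero (Finset.mem_univ k) (by simp)
  have h := (hroot.norm_lt_cauchyBound hmonic.ne_zero).le
  have h2 : cauchyBound P ≤ ‖coeffsOfRoots q‖₊ + 1 := by
    rw [cauchyBound, hmonic.leadingCoeff, nnnorm_one, div_one]
    refine add_le_add_left (Finset.sup_le fun i hi => ?_) 1
    rw [hP, natDegree_finsetProd_X_sub_C_eq_card, Finset.card_univ, Fintype.card_fin,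
      Finset.mem_range] at hi
    exact nnnorm_le_pi_nnnorm (coeffsOfRoots q) ⟨i, hi⟩
  exact_mod_cast h.trans h2

theorem isProperMap_coeffsOfRoots :
    IsProperMap (coeffsOfRoots : (Fin e → ℂ) → Fin e → ℂ) := by
  refine isProperMap_iff_isCompact_preimage.2 ⟨continuous_coeffsOfRoots, fun K hK => ?_⟩
  obtain ⟨M, hM⟩ := hK.isBounded.exists_norm_le
  refine Metric.isCompact_of_isClosed_isBounded (hK.isClosed.preimage continuous_coeffsOfRoots)
    (isBounded_iff_forall_norm_le.2 ⟨|M| + 1, fun q hq => ?_⟩)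
  refine (pi_norm_le_iff_of_nonneg (by positivity)).2 fun k => ?_
  exact (norm_root_le q k).trans (add_le_add_left ((hM _ hq).trans (le_abs_self M)) 1)

theorem norm_coeffsOfRoots_zero (q : Fin (m + 1) → ℂ) :
    ‖coeffsOfRoots q 0‖ = ‖∏ k, q k‖ := by
  rw [coeffsOfRoots, Fin.val_zero, coeff_zero_eq_eval_zero, eval_prod, norm_prod, norm_prod]
  simp

end Roots

/-- The coefficients of the monic polynomial with roots `q`, when their product is unimodular: the
constant coefficient on the circle, and the other coefficients below the leading one. -/
noncomputable def circleCoeffs {m : ℕ} (q : unimodularFamilies (m + 1)) :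
    Circle × (Fin m → ℂ) :=
  (⟨coeffsOfRoots q.1 0, by
    exact mem_sphere_zero_iff_norm.2 ((norm_coeffsOfRoots_zero q.1).trans q.2)⟩,
    fun i => coeffsOfRoots q.1 i.succ)

theorem cons_circleCoeffs {m : ℕ} (q : unimodularFamilies (m + 1)) :
    Fin.cons ((circleCoeffs q).1 : ℂ) (circleCoeffs q).2 = coeffsOfRoots q.1 :=
  Fin.cons_self_tail (coeffsOfRoots q.1)

theorem circleCoeffs_eq_iff {m : ℕ} {q q' : unimodularFamilies (m + 1)} :
    circleCoeffs q = circleCoeffs q' ↔ ∃ σ : Equiv.Perm (Fin (m + 1)), q'.1 = q.1 ∘ σ := by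
  rw [← coeffsOfRoots_eq_iff]
  refine ⟨fun h => by rw [← cons_circleCoeffs q, ← cons_circleCoeffs q', h], fun h => ?_⟩
  apply Prod.ext
  · exact Subtype.ext (congrFun h 0)
  · exact funext fun i => congrFun h i.succ

theorem isClosed_unimodularFamilies (e : ℕ) : IsClosed (unimodularFamilies e) :=
  isClosed_eq (continuous_norm.comp (continuous_finsetProd _ fun k _ => continuous_apply k))
    continuous_const

theorem isProperMap_circleCoeffs (m : ℕ) :
    IsProperMap (circleCoeffs : unimodularFamilies (m + 1) → Circle × (Fin m → ℂ)) := by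
  have hR := continuous_coeffsOfRoots.comp
    (continuous_subtype_val : Continuous (Subtype.val : unimodularFamilies (m + 1) → _))
  refine isProperMap_of_comp_of_inj
    (g := fun c : Circle × (Fin m → ℂ) => (Fin.cons (c.1 : ℂ) c.2 : Fin (m + 1) → ℂ)) ?_ ?_ ?_ ?_
  · exact (((continuous_apply 0).comp hR).subtype_mk _).prodMk
      (continuous_pi fun i => (continuous_apply i.succ).comp hR)
  · exact Continuous.finCons (continuous_subtype_val.comp continuous_fst) continuous_snd
  -- Followed by the injective map `Fin.cons`, this is a restriction of `coeffsOfRoots` to a closed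
  -- set.
  · have h : (fun c : Circle × (Fin m → ℂ) => (Fin.cons (c.1 : ℂ) c.2 : Fin (m + 1) → ℂ)) ∘
        circleCoeffs = coeffsOfRoots ∘ Subtype.val := funext cons_circleCoeffs
    rw [h]
    exact isProperMap_coeffsOfRoots.comp
      (isClosed_unimodularFamilies _).isClosedEmbedding_subtypeVal.isProperMap
  · intro c c' h
    exact Prod.ext (Subtype.ext (congrFun h 0)) (funext fun i => congrFun h i.succ)

theorem surjective_circleCoeffs (m : ℕ) :
    Function.Surjective (circleCoeffs : unimodularFamilies (m + 1) → Circle × (Fin m → ℂ)) := by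
  intro c
  obtain ⟨q, hq⟩ := surjective_coeffsOfRoots (Fin.cons (c.1 : ℂ) c.2 : Fin (m + 1) → ℂ)
  have h1 : ‖∏ k, q k‖ = 1 := by
    rw [← norm_coeffsOfRoots_zero, hq, Fin.cons_zero, Circle.norm_coe]
  refine ⟨⟨q, h1⟩, Prod.ext (Subtype.ext ?_) (funext fun i => ?_)⟩
  · exact congrFun hq 0
  · exact congrFun hq i.succ

/-! ### The topology of the model space -/

/-- Two quotients of the same space with the same fibres are homeomorphic. -/
theorem Topology.IsQuotientMap.nonempty_homeomorph {X Y Z : Type*} [TopologicalSpace X]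
    [TopologicalSpace Y] [TopologicalSpace Z] {f : X → Y} {g : X → Z}
    (hf : Topology.IsQuotientMap f) (hg : Topology.IsQuotientMap g)
    (h : ∀ x x', f x = f x' ↔ g x = g x') : Nonempty (Y ≃ₜ Z) :=
  ⟨{  toFun := fun y => g (Function.surjInv hf.surjective y)
      invFun := fun z => f (Function.surjInv hg.surjective z)
      left_inv := fun y => ((h _ _).2 (Function.surjInv_eq hg.surjective _)).trans
        (Function.surjInv_eq hf.surjective y)
      right_inv := fun z => ((h _ _).1 (Function.surjInv_eq hf.surjective _)).trans
        (Function.surjInv_eq hg.surjective z)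
      continuous_toFun := hf.continuous_iff.2 <| hg.continuous.congr fun x =>
        ((h _ _).1 (Function.surjInv_eq hf.surjective (f x))).symm
      continuous_invFun := hg.continuous_iff.2 <| hf.continuous.congr fun x =>
        ((h _ _).2 (Function.surjInv_eq hg.surjective (g x))).symm }⟩

/-- Both the model space and `ℝ × (S¹ × ℂ^m)` are the quotient of the space of radii and zeros by
permutations of the zeros. -/
theorem nonempty_homeomorph_modelSpace {m δ : ℕ} (hδ : 1 ≤ δ) (hδm : δ < m + 1) :
    Nonempty (ModelSpace (m + 1) δ ≃ₜ ℝ × (Circle × (Fin m → ℂ))) := by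
  have hpr := IsProperMap.prodMap (Homeomorph.refl ℝ).isProperMap (isProperMap_circleCoeffs m)
  have hq : Topology.IsQuotientMap
      (Prod.map id circleCoeffs : ℝ × unimodularFamilies (m + 1) → ℝ × (Circle × (Fin m → ℂ))) :=
    hpr.isClosedMap.isQuotientMap hpr.continuous
      (Function.surjective_id.prodMap (surjective_circleCoeffs m))
  refine (isQuotientMap_toModelSpace (Nat.succ_pos m) (δ := δ)).nonempty_homeomorph
    (hq.comp (zeroSpaceHomeomorph hδ hδm).isQuotientMap) fun y y' => ?_
  rw [toModelSpace_eq_iff]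
  have h0 : (Prod.map id circleCoeffs ∘ zeroSpaceHomeomorph hδ hδm) y =
      (Prod.map id circleCoeffs ∘ zeroSpaceHomeomorph hδ hδm) y' ↔
      logit y.1.1 = logit y'.1.1 ∧ ∃ σ : Equiv.Perm (Fin (m + 1)),
        centredFamily y'.1.1 y'.1.2 = centredFamily y.1.1 y.1.2 ∘ σ :=
    Prod.ext_iff.trans (and_congr_right fun _ => circleCoeffs_eq_iff)
  rw [h0]
  constructor
  · rintro ⟨hr, σ, hσ⟩
    refine ⟨by rw [hr], σ, ?_⟩
    rw [← centredFamily_comp_perm, ← hr, funext hσ]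
    rfl
  · rintro ⟨hr, σ, hσ⟩
    have hr' : y.1.1 = y'.1.1 := by
      rw [← sigmoid_logit y.2.1 y.2.2.1, hr, sigmoid_logit y'.2.1 y'.2.2.1]
    refine ⟨hr', σ, fun k => ?_⟩
    rw [← annulusFamily_centredFamily hδ hδm y', ← annulusFamily_centredFamily hδ hδm y, hσ, hr',
      annulusFamily_comp_perm]
    rfl

theorem nonempty_homeomorph_euclideanSpace (m : ℕ) :
    Nonempty (ℝ × (Circle × (Fin m → ℂ)) ≃ₜ
      EuclideanSpace ℝ (Fin (2 * (m + 1) - 1)) × Circle) := by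
  have h : Module.finrank ℝ (ℝ × (Fin m → ℂ)) =
      Module.finrank ℝ (EuclideanSpace ℝ (Fin (2 * (m + 1) - 1))) := by
    rw [Module.finrank_prod, Module.finrank_self, Module.finrank_pi_fintype,
      finrank_euclideanSpace_fin]
    simp only [Complex.finrank_real_complex, Finset.sum_const, Finset.card_univ, Fintype.card_fin,
      smul_eq_mul]
    omega
  exact ⟨((Homeomorph.refl ℝ).prodCongr (Homeomorph.prodComm Circle (Fin m → ℂ))).trans
    ((Homeomorph.prodAssoc ℝ (Fin m → ℂ) Circle).symm.trans
      ((ContinuousLinearEquiv.ofFinrankEq h).toHomeomorph.prodCongr (Homeomorph.refl Circle)))⟩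

theorem theorem1p2 (e δ : ℕ) (hδ : 1 ≤ δ) (hδe : δ < e) :
    (∀ r : ℝ, 0 < r → r < 1 → ∀ p : Fin e → ℂ, (∀ k, p k ∈ annulus r) →
      -- existence criterion
      ((∃ f : annulus r → disk, IsProperHolomorphic f ∧ HasMappingDegree f e ∧
          HasZeroDivisor f p ∧ HasInnerDegree f δ) ↔ ‖∏ k, p k‖ = r ^ δ) ∧
      -- existence and uniqueness of the normalized map
      (‖∏ k, p k‖ = r ^ δ →
        ∃! f : annulus r → disk, IsProperHolomorphic f ∧ HasMappingDegree f e ∧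
          HasZeroDivisor f p ∧ HasInnerDegree f δ ∧ FixesOne f) ∧
      -- the product formula and the uniqueness of such a representation
      (∀ f : annulus r → disk, IsProperHolomorphic f → HasMappingDegree f e →
        HasZeroDivisor f p → HasInnerDegree f δ → FixesOne f →
        (∀ z : annulus r, Multipliable (pairedFactor r p (z : ℂ)) ∧
          (f z : ℂ) = annulusBlaschke r δ p (z : ℂ)) ∧
        ∀ (δ' : ℕ) (q : Fin e → ℂ), (∀ k, q k ∈ annulus r) →
          (∀ z : annulus r, (f z : ℂ) = annulusBlaschke r δ' q (z : ℂ)) →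
          δ' = δ ∧ ∃ σ : Equiv.Perm (Fin e), ∀ k, q k = p (σ k))) ∧
    -- the topology of the space of all normalized maps
    Nonempty (ModelSpace e δ ≃ₜ EuclideanSpace ℝ (Fin (2 * e - 1)) × Circle) := by
  refine ⟨fun r hr hr1 p hp => product_representation e δ hδe r hr hr1 p hp, ?_⟩
  obtain ⟨m, rfl⟩ := Nat.exists_eq_add_of_lt (Nat.zero_lt_of_lt hδe)
  rw [Nat.zero_add] at hδe ⊢
  obtain ⟨f⟩ := nonempty_homeomorph_modelSpace hδ hδe
  obtain ⟨g⟩ := nonempty_homeomorph_euclideanSpace m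
  exact ⟨f.trans g⟩
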